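/- All matrices are complex. A square rational (or polynomial) matrix $M(\lambda)$ is $T$-odd if $M(-\lambda)^T=-M(\lambda)$. **Data.** Let $G(\lambda)$ be an $n\times n$ $T$-odd (skew-Hamiltonian) rational matrix with a minimal realization $G(\lambda)=P(\lambda)+B^T(\lambda I_r-A)^{-1}B$, where $P(\lambda)=\sum_{j=0}^m\lambda^jA_j$ with $A_m\neq0$, and $P(\lambda)$ and $\lambda I_r-A$ are $T$-odd. Minimal means that $r$ is the smallest possible size among all realizations $P'(\lambda)+C'(\lambda E'-A')^{-1}B'$ of $G(\lambda)$ with $P'$ polynomial and $E'$ nonsingular. Let $\mathcal S(\lambda)=\begin{bmatrix}P(\lambda)&-B^T\\B&\lambda I_r-A\end{bmatrix}$. **Fiedler matrices.** For $X\in\mathbb C^{n\times n}$ and $1\le i\le m-1$ put $M_0(X)=I_{(m-1)n}\oplus X$, $M_{-m}(X)=X\oplus I_{(m-1)n}$, $M_i(X)=I_{(m-i-1)n}\oplus\begin{bmatrix}X&I_n\\I_n&0\end{bmatrix}\oplus I_{(i-1)n}$ and $M_{-i}(X)=I_{(m-i-1)n}\oplus\begin{bmatrix}0&I_n\\I_n&X\end{bmatrix}\oplus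 I_{(i-1)n}$. Let $M_i^P=M_i(-A_i)$ for $0\le i\le m-1$, $M_{-i}^P=M_{-i}(A_i)$ for $1\le i\le m$, and $\mathbb M_i^P=M_i^P\oplus I_r$. Let $\mathbb M_0^{\mathcal S}=\begin{bmatrix}M_0^P&e_m\otimes B^T\\-e_m^T\otimes B&A\end{bmatrix}$, $\mathbb M_{-m}^{\mathcal S}=M_{-m}^P\oplus I_r$ and $\mathbb M_i^{\mathcal S}=\mathbb M_i^P$ for all other $i$. For an index tuple $\mathbf t=(t_1,\dots,t_k)$ write $M_{\mathbf t}=M_{t_1}\cdots M_{t_k}$, and similarly for the other families. **Index tuples.** The admissible tuple of $\{0:k\}$ with index $p$ ($0\le p\le k$, $k-p$ even) is $\mathbf v=(k-1,k,\;k-3,k-2,\;\dots,\;p+1,p+2,\;0,1,\dots,p)$, and $\mathrm{Ind}(\mathbf v)=p$. It is simple if $p\in\{0,1\}$. Its symmetric complement is $(k-1,k-3,\dots,p+1)$ followed by the strings $(0:p-1),(0:p-2),\dots,(0:0)$, where $(0:j)=(0,1,\dots,j)$ and there are no such strings if $p=0$. Let $0\le h\le m-1$ be even, let $\mathbf w$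 be the simple admissible tuple of $\{0:h\}$, and let $\mathbf c_w$ be its symmetric complement. Let $\mathbf z+m$ be any admissible tuple of $\{0:m-h-1\}$, with symmetric complement $\mathbf c_z+m$. Let $i_0(\mathbf w)$ be the largest $s$ such that $(s,s-1,\dots,0)$ is a subtuple of $\mathbf w$. **Pencils.** Put $L(\lambda)=(\lambda M^P_{\mathbf z}-M^P_{\mathbf w})M^P_{\mathbf c_w}M^P_{\mathbf c_z}$ and $\mathbb L(\lambda)=(\lambda\mathbb M^{\mathcal S}_{\mathbf z}-\mathbb M^{\mathcal S}_{\mathbf w})\mathbb M^P_{\mathbf c_w}\mathbb M^P_{\mathbf c_z}$. A quasi-identity matrix is $Q=\epsilon_1I_n\oplus\cdots\oplus\epsilon_mI_n$ with parameters $\epsilon_i\in\{\pm1\}$. **Definition.** An $(mn+r)\times(mn+r)$ irreducible system matrix $\mathbb T(\lambda)=\begin{bmatrix}\mathcal X-\lambda\mathcal Y&\mathcal C\\\mathcal B&H-\lambda K\end{bmatrix}$ with $K$ ($r\times r$) nonsingular is a Rosenbrock strong linearization of $G(\lambda)$ if (a) and (b) hold. Irreducible means that the realization $\mathbb G_{\mathbb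 T}(\lambda)=\mathcal X-\lambda\mathcal Y+\mathcal C(\lambda K-H)^{-1}\mathcal B$ of its transfer function is minimal. (a) There are unimodular $U(\lambda),V(\lambda)$ and nonsingular constant $U_0,V_0$ with $\mathrm{diag}(U(\lambda),U_0)\,\mathbb T(\lambda)\,\mathrm{diag}(V(\lambda),V_0)=\mathrm{diag}(I_{(m-1)n},\mathcal S(\lambda))$. (b) There are $\mathcal O_\ell(\lambda),\mathcal O_r(\lambda)$, biproper (having a nonsingular limit as $\lambda\to\infty$), with $\mathcal O_\ell(\lambda)\,\lambda^{-1}\mathbb G_{\mathbb T}(\lambda)\,\mathcal O_r(\lambda)=\mathrm{diag}(I_{(m-1)n},\lambda^{-m}G(\lambda))$. **Theorem.** Let $k=m-i_0(\mathbf w)$; then $1\le k\le m$. There is a quasi-identity matrix $Q$, unique up to sign, such that $QL(\lambda)$ is $T$-odd. Let $\mathbf s$ be the $k$-th parameter of $Q$ and $\mathbb Q=\mathrm{diag}(\mathbf sQ,I_r)$. Then $$\mathbb Q\mathbb L(\lambda)=\begin{bmatrix}\mathbf sQL(\lambda)&-e_k\otimes B^T\\e_k^T\otimes B&\lambda I_r-A\end{bmatrix}$$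 is $T$-odd. Moreover, $\mathbb Q$ is the only matrix of the form $\mathrm{diag}(\mathbf s'Q',I_r)$, with $Q'$ a quasi-identity matrix and $\mathbf s'$ its $k$-th parameter, for which $\mathrm{diag}(\mathbf s'Q',I_r)\mathbb L(\lambda)$ is $T$-odd. If $r>0$, it is the only matrix of the form $\mathrm{diag}(Q',I_r)$, with $Q'$ a quasi-identity matrix, for which $\mathrm{diag}(Q',I_r)\mathbb L(\lambda)$ is $T$-odd. If $A_m$ is nonsingular or $\mathrm{Ind}(\mathbf z+m)=0$, then $\mathbb Q\mathbb L(\lambda)$ is a Rosenbrock strong linearization of $G(\lambda)$. The transfer function $\mathbb G(\lambda)=\mathbf sQL(\lambda)+(e_k\otimes B^T)(\lambda I_r-A)^{-1}(e_k^T\otimes B)$ of $\mathbb Q\mathbb L(\lambda)$ is $T$-odd. -/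

import Mathlib

open Polynomial Matrix

/-! ### Substitution `λ ↦ -λ` and `T`-odd matrices -/

/-- The automorphism `f(λ) ↦ f(-λ)` of the field of rational functions. -/
noncomputable def negSubst : RatFunc ℂ →+* RatFunc ℂ :=
  RatFunc.mapRingHom (Polynomial.algEquivAevalNegX (R := ℂ))
    (nonZeroDivisors_le_comap_nonZeroDivisors_of_injective _
      (Polynomial.algEquivAevalNegX (R := ℂ)).injective)

/-- A matrix polynomial `M(λ)` is `T`-odd if `M(-λ)ᵀ = -M(λ)`. -/
def IsTOddPoly {ι : Type} (M : Matrix ι ι ℂ[X]) : Prop :=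
  Mᵀ.map (fun f => f.comp (-X)) = -M

/-- A rational matrix `G(λ)` is `T`-odd (skew-Hamiltonian) if `G(-λ)ᵀ = -G(λ)`. -/
def IsTOddRat {ι : Type} (G : Matrix ι ι (RatFunc ℂ)) : Prop :=
  Gᵀ.map negSubst = -G

/-! ### Constant, polynomial and rational matrices -/

/-- A constant matrix, viewed as a matrix polynomial. -/
noncomputable def constPoly {ι κ : Type} (M : Matrix ι κ ℂ) : Matrix ι κ ℂ[X] :=
  M.map Polynomial.C

/-- A constant matrix, viewed as a rational matrix. -/
noncomputable def constRat {ι κ : Type} (M : Matrix ι κ ℂ) : Matrix ι κ (RatFunc ℂ) :=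
  M.map RatFunc.C

/-- A matrix polynomial, viewed as a rational matrix. -/
noncomputable def polyRat {ι κ : Type} (M : Matrix ι κ ℂ[X]) : Matrix ι κ (RatFunc ℂ) :=
  M.map (algebraMap ℂ[X] (RatFunc ℂ))

/-- The matrix polynomial `P(λ) = ∑_{j=0}^m λ^j A_j`. -/
noncomputable def matPoly {n : ℕ} (m : ℕ) (Ac : ℕ → Matrix (Fin n) (Fin n) ℂ) :
    Matrix (Fin n) (Fin n) ℂ[X] :=
  ∑ j ∈ Finset.range (m + 1), (X ^ j : ℂ[X]) • constPoly (Ac j)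

/-- The pencil `λ Y + Z` of constant matrices. -/
noncomputable def pencil {ι κ : Type} (Y Z : Matrix ι κ ℂ) : Matrix ι κ ℂ[X] :=
  (X : ℂ[X]) • constPoly Y + constPoly Z

/-- A matrix polynomial is unimodular if its determinant is a nonzero constant. -/
def IsUnimodular {ι : Type} [Fintype ι] [DecidableEq ι] (U : Matrix ι ι ℂ[X]) : Prop :=
  ∃ c : ℂ, c ≠ 0 ∧ U.det = Polynomial.C c

/-- A rational matrix `F` is biproper if `F(λ)` tends, as `|λ| → ∞`, to a nonsingular matrix. -/
def IsBiproper {ι : Type} [Fintype ι] [DecidableEq ι] (F : Matrix ι ι (RatFunc ℂ)) : Prop :=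
  ∃ D : Matrix ι ι ℂ, D.det ≠ 0 ∧ ∀ i j,
    Filter.Tendsto (fun x : ℂ => RatFunc.eval (RingHom.id ℂ) x (F i j))
      (Bornology.cobounded ℂ) (nhds (D i j))

/-! ### System matrices, realizations, minimality -/

/-- The data `P(λ), C, B, A, E` of a system matrix `[P(λ), C; B, A - λE]`. -/
structure SystemMatrix (ι ρ : Type) where
  P : Matrix ι ι ℂ[X]
  C : Matrix ι ρ ℂ
  B : Matrix ρ ι ℂ
  A : Matrix ρ ρ ℂ
  E : Matrix ρ ρ ℂ

namespace SystemMatrix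

/-- The matrix polynomial `[P(λ), C; B, A - λE]`. -/
noncomputable def toMatrix {ι ρ : Type} (S : SystemMatrix ι ρ) :
    Matrix (ι ⊕ ρ) (ι ⊕ ρ) ℂ[X] :=
  Matrix.fromBlocks S.P (constPoly S.C) (constPoly S.B) (pencil (-S.E) S.A)

/-- The transfer function `P(λ) + C (λE - A)⁻¹ B`. -/
noncomputable def transfer {ι ρ : Type} [Fintype ρ] [DecidableEq ρ] (S : SystemMatrix ι ρ) :
    Matrix ι ι (RatFunc ℂ) :=
  polyRat S.P + constRat S.C * (polyRat (pencil S.E (-S.A)))⁻¹ * constRat S.B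

/-- `S` is a realization of `G`: `E` is nonsingular and `G(λ) = P(λ) + C (λE - A)⁻¹ B`. -/
def IsRealization {ι ρ : Type} [Fintype ρ] [DecidableEq ρ] (S : SystemMatrix ι ρ)
    (G : Matrix ι ι (RatFunc ℂ)) : Prop :=
  S.E.det ≠ 0 ∧ S.transfer = G

/-- `S` is a minimal realization of `G`: the size `r` of the pencil `λE - A` is the smallest
among all the realizations of `G`. -/
def IsMinimalRealization {ι : Type} {r : ℕ} (S : SystemMatrix ι (Fin r))
    (G : Matrix ι ι (RatFunc ℂ)) : Prop :=
  S.IsRealization G ∧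
    ∀ (r' : ℕ) (T : SystemMatrix ι (Fin r')), T.IsRealization G → r ≤ r'

/-- A system matrix is irreducible if the realization of its transfer function is minimal. -/
def IsIrreducible {ι : Type} {r : ℕ} (S : SystemMatrix ι (Fin r)) : Prop :=
  S.IsMinimalRealization S.transfer

end SystemMatrix

/-! ### Block matrices

An `mn × mn` matrix is indexed by `Fin m × Fin n`: the first component is the (0-based) number of
the block. The integers `k` below count blocks from `1` to `m`. -/

/-- `e_k ⊗ C`, where `e_k` is the `k`-th column of the `m × m` identity matrix. -/
def blockCol {R : Type} [Zero R] {n r : ℕ} (m : ℕ) (k : ℤ) (C : Matrix (Fin n) (Fin r) R) :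
    Matrix (Fin m × Fin n) (Fin r) R :=
  Matrix.of fun a b => if ((a.1 : ℕ) : ℤ) + 1 = k then C a.2 b else 0

/-- `e_kᵀ ⊗ B`, where `e_k` is the `k`-th column of the `m × m` identity matrix. -/
def blockRow {R : Type} [Zero R] {n r : ℕ} (m : ℕ) (k : ℤ) (B : Matrix (Fin r) (Fin n) R) :
    Matrix (Fin r) (Fin m × Fin n) R :=
  Matrix.of fun b a => if ((a.1 : ℕ) : ℤ) + 1 = k then B b a.2 else 0

/-- The `n × n` block in block position `(s, t)` (0-based) of the elementary matrix `M_i(X)`. -/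
def elemBlock {R : Type} [Zero R] [One R] {n : ℕ} (m : ℕ) (i : ℤ) (X : Matrix (Fin n) (Fin n) R)
    (s t : ℕ) : Matrix (Fin n) (Fin n) R :=
  if i = 0 then
    if s = t then (if s + 1 = m then X else 1) else 0
  else if i = -(m : ℤ) then
    if s = t then (if s = 0 then X else 1) else 0
  else
    -- the special `2 × 2` block sits in the block rows and columns `m - |i|` and `m - |i| + 1`
    let k := m - i.natAbs
    if s + 1 = k ∧ t + 1 = k then (if 0 < i then X else 0)
    else if s = k ∧ t = k then (if 0 < i then 0 else X)
    else if (s + 1 = k ∧ t = k) ∨ (s = k ∧ t + 1 = k) then 1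
    else if s = t then 1 else 0

/-- The elementary matrices `M_i(X)`, for `i ∈ {-m : m-1}`:
`M_0(X) = I_{(m-1)n} ⊕ X`, `M_{-m}(X) = X ⊕ I_{(m-1)n}`, and for `1 ≤ i ≤ m-1`
`M_i(X) = I_{(m-i-1)n} ⊕ [X, I; I, 0] ⊕ I_{(i-1)n}`,
`M_{-i}(X) = I_{(m-i-1)n} ⊕ [0, I; I, X] ⊕ I_{(i-1)n}`. -/
def elemM {R : Type} [Zero R] [One R] {n : ℕ} (m : ℕ) (i : ℤ) (X : Matrix (Fin n) (Fin n) R) :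
    Matrix (Fin m × Fin n) (Fin m × Fin n) R :=
  Matrix.of fun a b => elemBlock m i X a.1 b.1 a.2 b.2

/-- The matrix `I_{(m-1)n} ⊕ X`. -/
def idOplus {R : Type} [Zero R] [One R] {n : ℕ} (m : ℕ) (X : Matrix (Fin n) (Fin n) R) :
    Matrix (Fin m × Fin n) (Fin m × Fin n) R :=
  Matrix.of fun a b =>
    if a.1 = b.1 then
      if (a.1 : ℕ) + 1 = m then X a.2 b.2 else (1 : Matrix (Fin n) (Fin n) R) a.2 b.2
    else 0

/-- The matrix `I_{(m-1)n} ⊕ S(λ)` for a system matrix `S(λ)`; its rows and columns are split as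
`mn + r`, so that `P(λ)` is in the last of the `m` diagonal `n × n` blocks. -/
noncomputable def idOplusSystem {n r : ℕ} (m : ℕ) (S : SystemMatrix (Fin n) (Fin r)) :
    Matrix ((Fin m × Fin n) ⊕ Fin r) ((Fin m × Fin n) ⊕ Fin r) ℂ[X] :=
  Matrix.fromBlocks (idOplus m S.P) (constPoly (blockCol m m S.C))
    (constPoly (blockRow m m S.B)) (pencil (-S.E) S.A)

/-- The matrix `diag(U, V)`. -/
def blockDiag2 {R ι ρ : Type} [Zero R] (U : Matrix ι ι R) (V : Matrix ρ ρ R) :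
    Matrix (ι ⊕ ρ) (ι ⊕ ρ) R :=
  Matrix.fromBlocks U 0 0 V

/-! ### Rosenbrock strong linearizations -/

/-- The `(mn+r) × (mn+r)` matrix polynomial `L(λ)` is a Rosenbrock strong linearization of the
rational matrix `G(λ)` with system matrix `S(λ)`: it is an irreducible system matrix
`[𝒳 - λ𝒴, 𝒞; ℬ, H - λK]` with `K` nonsingular,
(a) `diag(U(λ), U₀) L(λ) diag(V(λ), V₀) = diag(I_{(m-1)n}, S(λ))` for some unimodular `U`, `V` and
some nonsingular constant `U₀`, `V₀`;
(b) `O_ℓ(λ) λ⁻¹ 𝔾(λ) O_r(λ) = diag(I_{(m-1)n}, λ^{-m} G(λ))` for some biproper `O_ℓ`, `O_r`, where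
`𝔾(λ)` is the transfer function of `L(λ)`. -/
def IsRosenbrockStrongLinearization {n m r : ℕ}
    (L : Matrix ((Fin m × Fin n) ⊕ Fin r) ((Fin m × Fin n) ⊕ Fin r) ℂ[X])
    (S : SystemMatrix (Fin n) (Fin r)) (G : Matrix (Fin n) (Fin n) (RatFunc ℂ)) : Prop :=
  ∃ T : SystemMatrix (Fin m × Fin n) (Fin r),
    T.toMatrix = L ∧
    (∃ 𝒳 𝒴 : Matrix (Fin m × Fin n) (Fin m × Fin n) ℂ, T.P = pencil (-𝒴) 𝒳) ∧
    T.E.det ≠ 0 ∧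
    T.IsIrreducible ∧
    (∃ (U V : Matrix (Fin m × Fin n) (Fin m × Fin n) ℂ[X]) (U₀ V₀ : Matrix (Fin r) (Fin r) ℂ),
      IsUnimodular U ∧ IsUnimodular V ∧ U₀.det ≠ 0 ∧ V₀.det ≠ 0 ∧
      blockDiag2 U (constPoly U₀) * L * blockDiag2 V (constPoly V₀) = idOplusSystem m S) ∧
    (∃ Ol Or : Matrix (Fin m × Fin n) (Fin m × Fin n) (RatFunc ℂ),
      IsBiproper Ol ∧ IsBiproper Or ∧
      Ol * ((RatFunc.X : RatFunc ℂ)⁻¹ • T.transfer) * Or =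
        idOplus m (((RatFunc.X : RatFunc ℂ) ^ m)⁻¹ • G))

/-! ### Fiedler matrices -/

/-- The Fiedler matrices `M^P_i` of `P(λ) = ∑ λ^j A_j`: `M_i(-A_i)` for `i ≥ 0` and
`M_i(A_{-i})` for `i < 0`. -/
def fiedlerP {R : Type} [Ring R] {n : ℕ} (m : ℕ) (Ac : ℕ → Matrix (Fin n) (Fin n) R) (i : ℤ) :
    Matrix (Fin m × Fin n) (Fin m × Fin n) R :=
  if 0 ≤ i then elemM m i (-Ac i.natAbs) else elemM m i (Ac i.natAbs)

/-- The matrices `𝕄^P_i = diag(M^P_i, I_r)`. -/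
def fiedlerPExt {R : Type} [Ring R] {n : ℕ} (m r : ℕ) (Ac : ℕ → Matrix (Fin n) (Fin n) R)
    (i : ℤ) : Matrix ((Fin m × Fin n) ⊕ Fin r) ((Fin m × Fin n) ⊕ Fin r) R :=
  blockDiag2 (fiedlerP m Ac i) 1

/-- The Fiedler matrices `𝕄^S_i`, `i ∈ {-m : m-1}`, of the system matrix `[P(λ), C; B, A - λE]`
with `P(λ) = ∑_{j=0}^m λ^j A_j`. For `1 ≤ i ≤ m-1` both `diag(M^P_i, I_r)` and its inverse
`diag(M^P_{-i}, I_r)` are of the last form. -/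
def fiedlerS {R : Type} [Ring R] {n r : ℕ} (m : ℕ) (Ac : ℕ → Matrix (Fin n) (Fin n) R)
    (C : Matrix (Fin n) (Fin r) R) (B : Matrix (Fin r) (Fin n) R) (A E : Matrix (Fin r) (Fin r) R)
    (i : ℤ) : Matrix ((Fin m × Fin n) ⊕ Fin r) ((Fin m × Fin n) ⊕ Fin r) R :=
  if i = 0 then
    Matrix.fromBlocks (fiedlerP m Ac 0) (-blockCol m m C) (-blockRow m m B) (-A)
  else if i = -(m : ℤ) then
    blockDiag2 (fiedlerP m Ac i) (-E)
  else
    blockDiag2 (fiedlerP m Ac i) 1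

/-- `M_𝐭 = M_{t_1} M_{t_2} ⋯ M_{t_k}` for an index tuple `𝐭 = (t_1, …, t_k)`. -/
def tupleProd {R κ : Type} [Ring R] [Fintype κ] [DecidableEq κ] (M : ℤ → Matrix κ κ R)
    (t : List ℤ) : Matrix κ κ R :=
  (t.map M).prod

/-! ### Index tuples -/

/-- The tuple `𝐭 + k`. -/
def shiftTuple (k : ℤ) (t : List ℤ) : List ℤ := t.map (· + k)

/-- The tuple `(h-1:h, h-3:h-2, …, p+1:p+2, 0:p)`. -/
def admissibleTuple (h p : ℕ) : List ℤ :=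
  ((List.range ((h - p) / 2)).flatMap fun l : ℕ =>
    [(h : ℤ) - 2 * (l : ℤ) - 1, (h : ℤ) - 2 * (l : ℤ)]) ++
  (List.range (p + 1)).map fun l : ℕ => (l : ℤ)

/-- `w` is the admissible tuple of `{0:h}` with index `Ind(w) = p`
(in column standard form). -/
def IsAdmissibleTuple (h p : ℕ) (w : List ℤ) : Prop :=
  p ≤ h ∧ Even (h - p) ∧ w = admissibleTuple h p

/-- The symmetric complement `(h-1, h-3, …, p+1, 0:p-1, 0:p-2, …, 0:1, 0)` of the admissible tuple
of `{0:h}` with index `p`; it is `(h-1, h-3, …, 1)` if `p = 0`, and empty if `h = 0`. -/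
def symmComplement (h p : ℕ) : List ℤ :=
  ((List.range ((h - p) / 2)).map fun l : ℕ => (h : ℤ) - 2 * (l : ℤ) - 1) ++
  (List.range p).flatMap fun l : ℕ => (List.range (p - l)).map fun j : ℕ => (j : ℤ)

/-- The number `i_t(α)` of consecutive inversions of the tuple `α` at `t`: the largest `s` such that
`(t+s, …, t+1, t)` is a subtuple of `α`, and `-1` if `t ∉ α`. -/
def inversionsAt (t : ℤ) (α : List ℤ) : ℤ :=
  if t ∈ α then
    (Nat.findGreatest
      (fun s => List.Sublist ((List.range (s + 1)).reverse.map fun j : ℕ => t + (j : ℤ)) α)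
      α.length : ℤ)
  else -1

/-! ### Quasi-identity matrices -/

/-- The quasi-identity matrix `ε_1 I_n ⊕ ⋯ ⊕ ε_m I_n` with parameters `ε_i ∈ {1, -1}`. -/
def quasiIdentity (n : ℕ) {m : ℕ} (ε : Fin m → ℤˣ) :
    Matrix (Fin m × Fin n) (Fin m × Fin n) ℂ :=
  Matrix.diagonal fun a => (((ε a.1 : ℤˣ) : ℤ) : ℂ)

/-! ### The pencils -/

/-- The pencil `L(λ) = (λ M^P_z - M^P_w) M^P_{c_w} M^P_{c_z}`. -/
noncomputable def gfprP {n : ℕ} (m : ℕ) (Ac : ℕ → Matrix (Fin n) (Fin n) ℂ)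
    (w cw z cz : List ℤ) : Matrix (Fin m × Fin n) (Fin m × Fin n) ℂ[X] :=
  pencil (tupleProd (fiedlerP m Ac) z) (-tupleProd (fiedlerP m Ac) w) *
    constPoly (tupleProd (fiedlerP m Ac) cw) * constPoly (tupleProd (fiedlerP m Ac) cz)

/-- The pencil `𝕃(λ) = (λ 𝕄^S_z - 𝕄^S_w) 𝕄^P_{c_w} 𝕄^P_{c_z}` associated with the system matrix
`[P(λ), C; B, A - λE]`, where `P(λ) = ∑_{j=0}^m λ^j A_j`. -/
noncomputable def gfprS {n r : ℕ} (m : ℕ) (Ac : ℕ → Matrix (Fin n) (Fin n) ℂ)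
    (C : Matrix (Fin n) (Fin r) ℂ) (B : Matrix (Fin r) (Fin n) ℂ) (A E : Matrix (Fin r) (Fin r) ℂ)
    (w cw z cz : List ℤ) :
    Matrix ((Fin m × Fin n) ⊕ Fin r) ((Fin m × Fin n) ⊕ Fin r) ℂ[X] :=
  pencil (tupleProd (fiedlerS m Ac C B A E) z) (-tupleProd (fiedlerS m Ac C B A E) w) *
    constPoly (tupleProd (fiedlerPExt m r Ac) cw) * constPoly (tupleProd (fiedlerPExt m r Ac) cz)

/-- The matrix `diag(δ Q, I_r)`, where `Q` is the quasi-identity matrix with parameters `ε` and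
`δ ∈ {1, -1}`. -/
noncomputable def extQuasiIdentity (n r : ℕ) {m : ℕ} (δ : ℤˣ) (ε : Fin m → ℤˣ) :
    Matrix ((Fin m × Fin n) ⊕ Fin r) ((Fin m × Fin n) ⊕ Fin r) ℂ :=
  blockDiag2 ((((δ : ℤˣ) : ℤ) : ℂ) • quasiIdentity n ε) 1

/-! Put h = 2H and g = m - h - 1, and reverse the coefficients: a_t = A_{m-t}. The Fiedler factor of
index ±(m - t) then acts on the block rows t - 1 and t (0-based), and factors whose positions t
differ by at least two commute. Hence the factors of each tuple can be sorted by parity, and the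
strings in c_z multiply out to a p × p block Hankel matrix extended by the identity. The outcome is
L(λ) = O(λX' - Y')O (`gfprP_eq`), where O (`outer`) is constant and invertible, and X' (`redX`) and
Y' (`redY`) are sparse: a Hankel corner followed by a block tridiagonal part. All of this is
computed over the ring of n × n blocks.

T-oddness: P being T-odd means A_dᵀ = (-1)^(d+1) A_d. There are diagonal signs D with DX' symmetric
and DY' skew, and signs Q with QO = OᵀD, so QL = Oᵀ(λDX' - DY')O is T-odd by congruence
(`isTOdd_outer`). If Q and Q' both work, Q'Q commutes with both coefficients of L. Some rows of
these coefficients are rows of O, which makes Q'Q commute with O, hence with X' and Y'. The entries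
1 and a_0 = A_m ≠ 0 of the latter link all block positions, so Q'Q is scalar (`intDiag_const`). In
the system pencil, e_m ⊗ Bᵀ and e_mᵀ ⊗ B become e_k ⊗ Bᵀ and e_kᵀ ⊗ B; matching their signs fixes
the remaining sign of Q, because minimality gives B ≠ 0 when r > 0.

Finite part of the linearization: there is a block column x(λ) with last block I and (λX' - Y')x =
e_m ⊗ P. So (λX' - Y')V = M diag(I, P), where V is the identity with last column x and M is the
pencil with its last column replaced by e_m. M is unimodular by a kernel computation
(`redPencil_kernel`), which needs A_m nonsingular unless p = 0. Since M fixes e_m and V fixes e_mᵀ,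
the reduction extends to the system matrix with constant lower blocks. It also exhibits G as a
polynomial multiple of the transfer function of the pencil, and such multiples keep the size of a
realization, whence irreducibility.

At infinity, with μ = 1/λ, the strictly proper part of G is absorbed into a_m. If A_m is
nonsingular, the scaled pencil and diag(I, λ⁻ᵐG) are both biproper; if p = 0, the column replacement
is repeated with the first block column (`exists_biproper_reduction`). -/

/-! ### Elementary block matrices -/

section BlockMatrices

variable {S : Type}

/-- The `m × m` matrix with entries `f s r`, `0 ≤ s, r < m`. -/
def blk (m : ℕ) (f : ℕ → ℕ → S) : Matrix (Fin m) (Fin m) S :=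
  Matrix.of fun s r => f s r

@[simp] lemma blk_apply (m : ℕ) (f : ℕ → ℕ → S) (s r : Fin m) : blk m f s r = f s r := rfl

lemma blk_congr {m : ℕ} {f f' : ℕ → ℕ → S} (h : ∀ s r, s < m → r < m → f s r = f' s r) :
    blk m f = blk m f' := by
  ext s r
  exact h s r s.2 r.2

variable [Ring S]

/-- The entries of the elementary matrix with the blocks `[u, 1; 1, v]` in the (0-based) rows and
columns `t - 1`, `t`. -/
def elemFun (t : ℕ) (u v : S) (s r : ℕ) : S :=
  if s + 1 = t then (if r = s then u else if r = s + 1 then 1 else 0)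
  else if s = t then (if r + 1 = s then 1 else if r = s then v else 0)
  else if r = s then 1 else 0

/-- The entries of the identity matrix. -/
def idFun (s r : ℕ) : S := if r = s then 1 else 0

lemma blk_idFun (m : ℕ) : blk m (idFun : ℕ → ℕ → S) = 1 := by
  ext s r
  simp [idFun, Matrix.one_apply, Fin.ext_iff, eq_comm]

lemma sum_fin_eq_ite {m : ℕ} (c : ℕ) (x : S) (f : ℕ → S) :
    ∑ k : Fin m, (if (k : ℕ) = c then x * f k else 0) = if c < m then x * f c else 0 := by
  rw [Fin.sum_univ_eq_sum_range (fun k => if k = c then x * f k else 0) m]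
  simp

/-- The guards account for the boundary factors: for t = m only the entry u in the last row survives
(the shape of M_0), for t = 0 only the entry v in row 0 (the shape of M_{-m}). -/
lemma blk_elem_mul (m t : ℕ) (u v : S) (f : ℕ → ℕ → S) :
    blk m (elemFun t u v) * blk m f = blk m (fun s r =>
      if s + 1 = t then u * f s r + (if t < m then f t r else 0)
      else if s = t then (if 0 < t then f (t - 1) r else 0) + v * f s r else f s r) := by
  ext s r
  have hs := s.2
  rw [Matrix.mul_apply]
  simp only [blk_apply, elemFun]
  split_ifs with h1 h2 h3 h4
  · have : ∀ k : Fin m, (if (k : ℕ) = s then u else if (k : ℕ) = s + 1 then 1 else 0) * f k r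
        = (if (k : ℕ) = s then u * f k r else 0) + (if (k : ℕ) = s + 1 then 1 * f k r else 0) := by
      intro k; split_ifs <;> first | omega | simp
    simp only [this, Finset.sum_add_distrib]
    rw [sum_fin_eq_ite _ u (fun k => f k r), sum_fin_eq_ite _ 1 (fun k => f k r), ← h1]
    simp [hs, show (s:ℕ) + 1 < m by omega]
  · have : ∀ k : Fin m, (if (k : ℕ) = s then u else if (k : ℕ) = s + 1 then 1 else 0) * f k r
        = (if (k : ℕ) = s then u * f k r else 0) := by
      intro k; split_ifs <;> first | omega | simp
    simp only [this]
    rw [sum_fin_eq_ite _ u (fun k => f k r)]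
    simp [hs]
  · have : ∀ k : Fin m, (if (k : ℕ) + 1 = s then 1 else if (k : ℕ) = s then v else 0) * f k r
        = (if (k : ℕ) = s - 1 then 1 * f k r else 0) + (if (k : ℕ) = s then v * f k r else 0) := by
      intro k; split_ifs <;> first | omega | simp
    simp only [this, Finset.sum_add_distrib]
    rw [sum_fin_eq_ite _ v (fun k => f k r), sum_fin_eq_ite _ 1 (fun k => f k r), ← h3]
    simp [hs, show (s:ℕ) - 1 < m by omega]
  · have : ∀ k : Fin m, (if (k : ℕ) + 1 = s then 1 else if (k : ℕ) = s then v else 0) * f k r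
        = (if (k : ℕ) = s then v * f k r else 0) := by
      intro k; split_ifs <;> first | omega | simp
    simp only [this]
    rw [sum_fin_eq_ite _ v (fun k => f k r)]
    simp [hs]
  · have : ∀ k : Fin m, (if (k : ℕ) = s then (1 : S) else 0) * f k r
        = (if (k : ℕ) = s then 1 * f k r else 0) := by
      intro k; split_ifs <;> simp
    simp only [this]
    rw [sum_fin_eq_ite _ 1 (fun k => f k r)]
    simp [hs]

/-- The two factors act on the disjoint pairs of rows t - 1, t and t' - 1, t'. -/
lemma blk_elem_commute (m : ℕ) {t t' : ℕ} (h : t + 2 ≤ t') (u v u' v' : S) :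
    Commute (blk m (elemFun t u v)) (blk m (elemFun t' u' v')) := by
  unfold Commute SemiconjBy
  rw [blk_elem_mul, blk_elem_mul]
  refine blk_congr fun s r hs hr => ?_
  simp only [elemFun]
  rcases Nat.lt_trichotomy (s + 1) t with h1 | h1 | h1
  · simp [show s + 1 ≠ t by omega, show s ≠ t by omega, show s + 1 ≠ t' by omega,
      show s ≠ t' by omega]
  · subst h1
    simp [show s + 1 ≠ t' by omega, show s ≠ t' by omega, show s + 1 + 1 ≠ t' by omega]
    split_ifs <;> first | omega | simp
  · by_cases h2 : s = t
    · subst h2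
      simp [show s + 1 ≠ t' by omega, show s ≠ t' by omega]
      split_ifs <;> first | omega | simp
    · by_cases h3 : s + 1 = t'
      · subst h3
        simp [h1.ne', h2, show s + 1 + 1 ≠ t by omega]
        split_ifs <;> first | omega | simp
      · by_cases h4 : s = t'
        · subst h4
          simp [h1.ne', h2, show s - 1 + 1 ≠ t by omega, show s - 1 ≠ t by omega]
          split_ifs <;> first | omega | simp
        · simp [h1.ne', h2, h3, h4]

/-- This is [u, 1; 1, 0][0, 1; 1, -u] = I; the bounds exclude the truncated factors t = 0 and t = m,
which need not be invertible. -/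
lemma blk_elem_mul_elem_neg (m : ℕ) {t : ℕ} (h0 : 0 < t) (ht : t < m) (u : S) :
    blk m (elemFun t u 0) * blk m (elemFun t 0 (-u)) = 1 := by
  rw [blk_elem_mul, ← blk_idFun]
  refine blk_congr fun s r hs hr => ?_
  simp only [elemFun, idFun]
  split_ifs <;> first | omega | simp

lemma blk_elem_neg_mul_elem (m : ℕ) {t : ℕ} (h0 : 0 < t) (ht : t < m) (u : S) :
    blk m (elemFun t 0 (-u)) * blk m (elemFun t u 0) = 1 := by
  rw [blk_elem_mul, ← blk_idFun]
  refine blk_congr fun s r hs hr => ?_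
  simp only [elemFun, idFun]
  split_ifs <;> first | omega | simp

end BlockMatrices

/-! ### Products of factors with indices of one parity -/

section Products

variable {M : Type} [Monoid M]

/-- The product `F (c + 2N - 2) ⋯ F (c + 2) F c`. -/
def stepProd (F : ℕ → M) (c : ℕ) : ℕ → M
  | 0 => 1
  | N + 1 => F (c + 2 * N) * stepProd F c N

lemma stepProd_congr {F F' : ℕ → M} {c N : ℕ} (h : ∀ l < N, F (c + 2 * l) = F' (c + 2 * l)) :
    stepProd F c N = stepProd F' c N := by
  induction N with
  | zero => rfl
  | succ N ih =>
    rw [stepProd, stepProd, h N (by omega), ih fun l hl => h l (by omega)]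

lemma commute_stepProd {F : ℕ → M} {x : M} {c N : ℕ}
    (h : ∀ l < N, Commute x (F (c + 2 * l))) : Commute x (stepProd F c N) := by
  induction N with
  | zero => exact Commute.one_right x
  | succ N ih => exact (h N (by omega)).mul_right (ih fun l hl => h l (by omega))

lemma stepProd_succ_eq_mul (F : ℕ → M) (c N : ℕ) :
    stepProd F c (N + 1) = stepProd F (c + 2) N * F c := by
  induction N with
  | zero => simp [stepProd]
  | succ N ih =>
    rw [stepProd, ih, stepProd, mul_assoc, show c + 2 * (N + 1) = c + 2 + 2 * N by ring]

/-- The reflection i ↦ m - i reverses the order of the factors, which is harmless because they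
commute pairwise. The bound keeps `m - i` from being truncated. -/
lemma stepProd_reflect {F : ℕ → M} (hF : ∀ i j, i + 2 ≤ j → Commute (F i) (F j))
    (m c N : ℕ) (h : c + 2 * N ≤ m + 2) :
    stepProd (fun i => F (m - i)) c N = stepProd F (m + 2 - c - 2 * N) N := by
  induction N with
  | zero => rfl
  | succ N ih =>
    rw [stepProd, ih (by omega), stepProd_succ_eq_mul,
      show m + 2 - c - 2 * (N + 1) + 2 = m + 2 - c - 2 * N by omega,
      show m - (c + 2 * N) = m + 2 - c - 2 * (N + 1) by omega]
    exact commute_stepProd fun l hl => hF _ _ (by omega)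

lemma isUnit_stepProd {F : ℕ → M} {c N : ℕ} (h : ∀ l < N, IsUnit (F (c + 2 * l))) :
    IsUnit (stepProd F c N) := by
  induction N with
  | zero => exact isUnit_one
  | succ N ih => exact (h N (by omega)).mul (ih fun l hl => h l (by omega))

end Products

/-! ### Closed forms of the products, and the Hankel matrix -/

section BlockFactorization

variable {S : Type} [Ring S]

/-- The factors act on the disjoint pairs of rows (c - 1, c), (c + 1, c + 2), …, so every row is
changed by at most one of them. -/
lemma stepProd_elem_mul (m : ℕ) (u v : ℕ → S) (c N : ℕ) (hc : 0 < c) (f : ℕ → ℕ → S) :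
    stepProd (fun t => blk m (elemFun t (u t) (v t))) c N * blk m f = blk m (fun s r =>
      if c ≤ s + 1 ∧ s + 1 < c + 2 * N then
        if (s + 1 - c) % 2 = 0 then u (s + 1) * f s r + (if s + 1 < m then f (s + 1) r else 0)
        else f (s - 1) r + v s * f s r
      else f s r) := by
  induction N with
  | zero =>
    rw [stepProd, one_mul]
    refine blk_congr fun s r hs hr => ?_
    rw [if_neg (by omega)]
  | succ N ih =>
    rw [stepProd, mul_assoc, ih, blk_elem_mul]
    refine blk_congr fun s r hs hr => ?_
    grind

lemma stepProd_elem (m : ℕ) (u v : ℕ → S) (c N : ℕ) (hc : 0 < c) :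
    stepProd (fun t => blk m (elemFun t (u t) (v t))) c N = blk m (fun s r =>
      if c ≤ s + 1 ∧ s + 1 < c + 2 * N then
        if (s + 1 - c) % 2 = 0 then
          u (s + 1) * idFun s r + (if s + 1 < m then idFun (s + 1) r else 0)
        else idFun (s - 1) r + v s * idFun s r
      else idFun s r) := by
  rw [← stepProd_elem_mul m u v c N hc, blk_idFun, mul_one]

variable (m : ℕ) (a : ℕ → S)

/-- The Fiedler factors of nonnegative index: `posFactor m a t = M_{m-t}`, where `a t = A_{m-t}`. -/
def posFactor (t : ℕ) : Matrix (Fin m) (Fin m) S := blk m (elemFun t (-a t) 0)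

/-- The Fiedler factors of negative index: `negFactor m a t = M_{-(m-t)}`, where
`a t = A_{m-t}`. -/
def negFactor (t : ℕ) : Matrix (Fin m) (Fin m) S := blk m (elemFun t 0 (a t))

/-- The product of the odd factors of the tuple `w`. -/
def posOdd (g H : ℕ) : Matrix (Fin m) (Fin m) S := stepProd (posFactor m a) (g + 2) H

/-- The product of the even factors of the tuple `w`. -/
def posEven (g H : ℕ) : Matrix (Fin m) (Fin m) S := stepProd (posFactor m a) (g + 1) (H + 1)

/-- The product of the factors of the tuple `z` that also occur in the first part of its symmetric
complement. -/
def negOdd (p Z : ℕ) : Matrix (Fin m) (Fin m) S := stepProd (negFactor m a) (p + 1) Z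

/-- The product of the complementary factors of the pairs in the tuple `z`. -/
def negEven (p Z : ℕ) : Matrix (Fin m) (Fin m) S := stepProd (negFactor m a) (p + 2) Z

/-- The entries of the block Hankel matrix of size `p` with `a 0` on the antidiagonal, extended by
the identity. -/
def hankelFun (p s r : ℕ) : S :=
  if s < p ∧ r < p then (if p ≤ s + r + 1 then a (s + r + 1 - p) else 0) else idFun s r

/-- The coefficient of `λ` in the reduced pencil. -/
def redX (p s r : ℕ) : S :=
  if s ≤ p ∧ r ≤ p then (if p ≤ s + r then a (s + r - p) else 0)
  else if s ≤ p ∨ r ≤ p then 0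
  else if (s - p) % 2 = 0 then (if r = s then a s else if r + 1 = s then 1 else 0)
  else if r = s + 1 then 1 else 0

/-- The negative of the constant coefficient in the reduced pencil. -/
def redY (p s r : ℕ) : S :=
  if s < p ∧ r < p then (if p ≤ s + r + 1 then a (s + r + 1 - p) else 0)
  else if s < p ∨ r < p then 0
  else if (s - p) % 2 = 0 then (if r = s then -a (s + 1) else if r = s + 1 then 1 else 0)
  else if r + 1 = s then 1 else 0

/-- `redX` is the product `posOdd`⁻¹ · `negEven` · Hankel written out by entries. The three act on
separate rows: from g + 1 on, from p + 1 to g, and from 0 to p. -/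
lemma posOdd_mul_redX {p Z H g : ℕ} (hg : g = p + 2 * Z) (hm : m = g + 1 + 2 * H) :
    posOdd m a g H * blk m (redX a p) = negEven m a p Z * blk m (hankelFun a (p + 1)) := by
  unfold posOdd negEven posFactor negFactor
  rw [stepProd_elem_mul _ _ _ _ _ (by omega), stepProd_elem_mul _ _ _ _ _ (by omega)]
  refine blk_congr fun s r hs hr => ?_
  simp only [redX, hankelFun, idFun, mul_ite, mul_zero, mul_one, zero_mul]
  grind

/-- Likewise `redY` is `negOdd`⁻¹ · `posEven` · Hankel, where the rows are p to g - 1, g to m - 1,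
and 0 to p - 1. -/
lemma negOdd_mul_redY {p Z H g : ℕ} (hg : g = p + 2 * Z) (hm : m = g + 1 + 2 * H) :
    negOdd m a p Z * blk m (redY a p) = posEven m a g H * blk m (hankelFun a p) := by
  unfold negOdd posEven posFactor negFactor
  rw [stepProd_elem_mul _ _ _ _ _ (by omega), stepProd_elem_mul _ _ _ _ _ (by omega)]
  refine blk_congr fun s r hs hr => ?_
  simp only [redY, hankelFun, idFun, mul_ite, mul_zero, mul_one, zero_mul]
  grind

lemma negFactor_commute {t t' : ℕ} (h : t + 2 ≤ t') :
    Commute (negFactor m a t) (negFactor m a t') := blk_elem_commute m h _ _ _ _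

lemma posFactor_commute {t t' : ℕ} (h : t + 2 ≤ t') :
    Commute (posFactor m a t) (posFactor m a t') := blk_elem_commute m h _ _ _ _

lemma negFactor_commute_posFactor {t t' : ℕ} (h : t + 2 ≤ t') :
    Commute (negFactor m a t) (posFactor m a t') := blk_elem_commute m h _ _ _ _

lemma isUnit_negFactor {t : ℕ} (h0 : 0 < t) (ht : t < m) : IsUnit (negFactor m a t) := by
  have h1 := blk_elem_neg_mul_elem m h0 ht (-a t)
  have h2 := blk_elem_mul_elem_neg m h0 ht (-a t)
  rw [neg_neg] at h1 h2
  exact ⟨⟨_, _, h1, h2⟩, rfl⟩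

lemma isUnit_posFactor {t : ℕ} (h0 : 0 < t) (ht : t < m) : IsUnit (posFactor m a t) :=
  ⟨⟨_, _, blk_elem_mul_elem_neg m h0 ht (-a t), blk_elem_neg_mul_elem m h0 ht (-a t)⟩, rfl⟩

/-- For c = 0 the product acts like a block companion matrix: it shifts rows 0 to p down by one and
adds a_s times row p to row s. General c is there for the induction. -/
lemma negFactor_mul_shift {c p : ℕ} (hp : p < m) (hc : c ≤ p) (f : ℕ → ℕ → S) :
    ((List.range' c (p + 1 - c)).map (negFactor m a)).prod * blk m f = blk m (fun s r =>
      if s + 1 < c ∨ p < s then f s r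
      else if s + 1 = c then f p r
      else (if 0 < s then f (s - 1) r else 0) + a s * f p r) := by
  obtain ⟨d, rfl⟩ := Nat.exists_eq_add_of_le hc
  induction d generalizing c with
  | zero =>
    simp only [show c + 0 + 1 - c = 1 by omega, List.range'_one, List.map_cons, List.map_nil,
      List.prod_cons, List.prod_nil, mul_one, negFactor]
    rw [blk_elem_mul]
    refine blk_congr fun s r hs hr => ?_
    simp only [add_zero]
    split_ifs <;> first | omega | simp_all
  | succ d ih =>
    rw [show c + (d + 1) + 1 - c = (c + 1 + d + 1 - (c + 1)) + 1 by omega, List.range'_succ,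
      List.map_cons, List.prod_cons, mul_assoc]
    rw [show c + (d + 1) = c + 1 + d by omega] at *
    rw [ih (by omega) (by omega), negFactor, blk_elem_mul]
    refine blk_congr fun s r hs hr => ?_
    split_ifs <;> first | omega | simp_all

/-- Row p of the extended Hankel matrix is an identity row, so the companion step writes a_0, …, a_p
into column p and moves the old corner down by one row. The result is the corner of size p + 1. -/
lemma prod_range_mul_hankel {p : ℕ} (hp : p < m) :
    ((List.range (p + 1)).map (negFactor m a)).prod * blk m (hankelFun a p) =
      blk m (hankelFun a (p + 1)) := by
  have := negFactor_mul_shift m a hp (Nat.zero_le p) (hankelFun a p)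
  rw [Nat.sub_zero, ← List.range_eq_range'] at this
  rw [this]
  refine blk_congr fun s r hs hr => ?_
  simp only [hankelFun, idFun, mul_ite, mul_zero, mul_one]
  grind

/-- The longest string stands first; peeling it off lowers the size by one. -/
lemma prod_strings {p : ℕ} (hp : p ≤ m) :
    (((List.range p).flatMap fun l => List.range (p - l)).map (negFactor m a)).prod =
      blk m (hankelFun a p) := by
  induction p with
  | zero =>
    rw [← show blk m (idFun : ℕ → ℕ → S) = _ from blk_congr fun s r _ _ => by simp [hankelFun],
      blk_idFun]
    simp
  | succ p ih =>
    rw [← prod_range_mul_hankel m a (by omega), ← ih (by omega), List.range_succ_eq_map,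
      List.flatMap_cons, List.map_append, List.prod_append, List.flatMap_map]
    simp [List.range_succ_eq_map]

end BlockFactorization

/-! ### Index tuples sorted by parity -/

section TupleProducts

/-- The first part `(h-1, h, h-3, h-2, …)` of an admissible tuple, consisting of `N` pairs. -/
def pairTuple (h : ℤ) (N : ℕ) : List ℤ :=
  (List.range N).flatMap fun l : ℕ => [h - 2 * (l : ℤ) - 1, h - 2 * (l : ℤ)]

lemma pairTuple_succ (h : ℤ) (N : ℕ) :
    pairTuple h (N + 1) = (h - 1) :: h :: pairTuple (h - 2) N := by
  simp only [pairTuple, List.range_succ_eq_map, List.flatMap_cons, List.flatMap_map]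
  simp
  congr 1
  funext l
  rw [show h - 2 * ((l : ℤ) + 1) = h - 2 - 2 * (l : ℤ) by ring]

lemma mem_pairTuple {h i : ℤ} {N : ℕ} (hi : i ∈ pairTuple h N) : h - 2 * N < i ∧ i ≤ h := by
  simp only [pairTuple, List.mem_flatMap, List.mem_range, List.mem_cons, List.not_mem_nil,
    or_false] at hi
  obtain ⟨l, hl, hi⟩ := hi
  omega

lemma admissibleTuple_eq (p N : ℕ) :
    admissibleTuple (p + 2 * N) p =
      pairTuple ((p + 2 * N : ℕ) : ℤ) N ++ (List.range (p + 1)).map fun l : ℕ => (l : ℤ) := by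
  rw [admissibleTuple, show (p + 2 * N - p) / 2 = N by omega]
  rfl

variable {M : Type} [Monoid M]

/-- The larger index of a pair exceeds the smaller indices of all later pairs by at least three, so
its factor can be moved past theirs. -/
lemma prod_map_pairTuple (F : ℤ → M) (p N : ℕ)
    (hF : ∀ i j : ℕ, i + 2 ≤ j → j ≤ p + 2 * N → Commute (F i) (F j)) :
    ((pairTuple ((p + 2 * N : ℕ) : ℤ) N).map F).prod =
      stepProd (fun i : ℕ => F i) (p + 1) N * stepProd (fun i : ℕ => F i) (p + 2) N := by
  induction N with
  | zero => simp [pairTuple, stepProd]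
  | succ N ih =>
    rw [pairTuple_succ, show ((p + 2 * (N + 1) : ℕ) : ℤ) - 2 = ((p + 2 * N : ℕ) : ℤ) by
      push_cast; ring, List.map_cons, List.map_cons, List.prod_cons, List.prod_cons,
      ih fun i j hij hj => hF i j hij (by omega)]
    have hc : Commute (F ((p + 2 * (N + 1) : ℕ) : ℤ)) (stepProd (fun i : ℕ => F i) (p + 1) N) :=
      commute_stepProd fun l hl => (hF _ _ (by omega) le_rfl).symm
    rw [stepProd, stepProd, ← mul_assoc (F ((p + 2 * (N + 1) : ℕ) : ℤ)), hc.eq,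
      show ((p + 2 * (N + 1) : ℕ) : ℤ) - 1 = ((p + 1 + 2 * N : ℕ) : ℤ) by push_cast; ring,
      show p + 2 * (N + 1) = p + 2 + 2 * N by ring]
    simp only [mul_assoc]

lemma prod_map_admissibleTuple (F : ℤ → M) (p N : ℕ)
    (hF : ∀ i j : ℕ, i + 2 ≤ j → j ≤ p + 2 * N → Commute (F i) (F j)) :
    ((admissibleTuple (p + 2 * N) p).map F).prod =
      stepProd (fun i : ℕ => F i) (p + 1) N * stepProd (fun i : ℕ => F i) (p + 2) N *
        ((List.range (p + 1)).map fun i : ℕ => F i).prod := by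
  rw [admissibleTuple_eq, List.map_append, List.prod_append, prod_map_pairTuple F p N hF,
    List.map_map]
  rfl

lemma prod_map_symmComplement (F : ℤ → M) (p N : ℕ) :
    ((symmComplement (p + 2 * N) p).map F).prod =
      stepProd (fun i : ℕ => F i) (p + 1) N *
        (((List.range p).flatMap fun l => List.range (p - l)).map fun i : ℕ => F i).prod := by
  rw [symmComplement, show (p + 2 * N - p) / 2 = N by omega, List.map_append, List.prod_append]
  congr 1
  · induction N with
    | zero => simp [stepProd]
    | succ N ih =>
      rw [List.range_succ_eq_map, List.map_cons, List.map_cons, List.prod_cons, stepProd, ← ih,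
        List.map_map, List.map_map]
      congr 1
      · congr 1; push_cast; ring
      · simp only [List.map_map]
        congr 2
        funext l
        simp only [Function.comp_apply]
        congr 1; push_cast; ring
  · simp [List.map_flatMap, Function.comp_def]

lemma map_stepProd {M' Φ : Type} [Monoid M'] [FunLike Φ M M'] [MonoidHomClass Φ M M'] (φ : Φ)
    (F : ℕ → M) (c N : ℕ) :
    φ (stepProd F c N) = stepProd (fun i => φ (F i)) c N := by
  induction N with
  | zero => simp [stepProd]
  | succ N ih => rw [stepProd, map_mul, ih, stepProd]

lemma admissibleTuple_zero (h N : ℕ) (hN : h = 2 * N) :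
    admissibleTuple h 0 = pairTuple h N ++ [0] := by
  have := admissibleTuple_eq 0 N
  rw [Nat.zero_add, ← hN] at this
  simpa using this

/-- For N > 0 the entries at most 2 occur in the order 1, 2, 0: this contains (1, 0) but not (2, 1,
0), and every longer descending string ends in (2, 1, 0). -/
lemma inversionsAt_admissibleTuple {h N : ℕ} (hN : h = 2 * N) :
    inversionsAt 0 (admissibleTuple h 0) = if N = 0 then 0 else 1 := by
  rw [admissibleTuple_zero h N hN, inversionsAt, if_pos (by simp)]
  rcases N with _ | N
  · simp [pairTuple]
    decide
  · rw [if_neg (Nat.succ_ne_zero N)]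
    have hpre : pairTuple h (N + 1) ++ [0] = pairTuple h N ++ [1, 2, 0] := by
      simp [pairTuple, List.range_succ, hN]
      refine ⟨?_, ?_⟩ <;> ring
    have hlow : ∀ i ∈ pairTuple h N, ¬ i ≤ 2 := fun i hi => by
      have := mem_pairTuple hi
      omega
    rw [hpre]
    norm_cast
    rw [Nat.findGreatest_eq_iff]
    refine ⟨by simp, fun _ => ?_, fun s hs _ hsub => ?_⟩
    · refine List.Sublist.trans ?_ (List.sublist_append_right _ _)
      decide
    · have h1 : [2, 1, 0].Sublist
          ((List.range (s + 1)).reverse.map fun j : ℕ => (0 : ℤ) + (j : ℤ)) := by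
        obtain ⟨d, rfl⟩ := Nat.exists_eq_add_of_le (show 2 ≤ s by omega)
        rw [show 2 + d + 1 = 3 + d by ring, List.range_add, List.reverse_append, List.map_append]
        exact List.sublist_append_right _ _
      have h2 := (h1.trans hsub).filter (fun i : ℤ => decide (i ≤ 2))
      have h3 : (pairTuple h N).filter (fun i : ℤ => decide (i ≤ 2)) = [] :=
        List.filter_eq_nil_iff.2 (by simpa using hlow)
      rw [List.filter_append, h3] at h2
      revert h2
      decide

end TupleProducts

/-! ### The Fiedler products of the four tuples -/

section FiedlerProducts

variable {R : Type} [Ring R] {n : ℕ} (m : ℕ) (Ac : ℕ → Matrix (Fin n) (Fin n) R)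

/-- The coefficients in reverse order. -/
def revCoeff (t : ℕ) : Matrix (Fin n) (Fin n) R := Ac (m - t)

/-- `compRingEquiv` identifies matrices of blocks with flat matrices, so products can be computed
over the ring of blocks. The index 0 is the truncated factor t = m. -/
lemma fiedlerP_nat {i : ℕ} (hi : i < m) :
    fiedlerP m Ac i =
      compRingEquiv (Fin m) (Fin n) R (posFactor m (revCoeff m Ac) (m - i)) := by
  ext ⟨s, x⟩ ⟨r, y⟩
  have hs := s.2
  have hr := r.2
  simp only [fiedlerP, Nat.cast_nonneg, if_true, elemM, of_apply, elemBlock, compRingEquiv_apply,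
    comp_apply, posFactor, blk_apply, elemFun, Int.natAbs_natCast, revCoeff]
  rw [show m - (m - i) = i by omega]
  split_ifs <;> first | rfl | omega

lemma fiedlerP_neg {t : ℕ} (ht : t < m) :
    fiedlerP m Ac ((t : ℤ) - m) =
      compRingEquiv (Fin m) (Fin n) R (negFactor m (revCoeff m Ac) t) := by
  ext ⟨s, x⟩ ⟨r, y⟩
  have hs := s.2
  have hr := r.2
  have hab : ((t : ℤ) - m).natAbs = m - t := by omega
  simp only [fiedlerP, elemM, of_apply, elemBlock, compRingEquiv_apply,
    comp_apply, negFactor, blk_apply, elemFun, revCoeff, hab, show m - (m - t) = t by omega,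
    show ¬ (0 : ℤ) ≤ t - m by omega, if_false]
  split_ifs <;> first | rfl | omega

variable {m}

lemma stepProd_fiedlerP {c N g : ℕ} (h : c + 2 * N ≤ m + 1) (hg : m + 2 - c - 2 * N = g) :
    stepProd (fun i : ℕ => fiedlerP m Ac i) c N =
      compRingEquiv (Fin m) (Fin n) R (stepProd (posFactor m (revCoeff m Ac)) g N) := by
  rw [← hg, ← stepProd_reflect (fun i j hij => posFactor_commute m _ hij) m c N (by omega)]
  refine Eq.trans ?_ (map_stepProd (compRingEquiv (Fin m) (Fin n) R) _ c N).symm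
  exact stepProd_congr fun l hl => fiedlerP_nat m Ac (by omega)

lemma stepProd_fiedlerP_neg {c N : ℕ} (h : c + 2 * N ≤ m + 1) :
    stepProd (fun i : ℕ => fiedlerP m Ac (i - m)) c N =
      compRingEquiv (Fin m) (Fin n) R (stepProd (negFactor m (revCoeff m Ac)) c N) := by
  refine Eq.trans ?_ (map_stepProd (compRingEquiv (Fin m) (Fin n) R) _ c N).symm
  exact stepProd_congr fun l hl => fiedlerP_neg m Ac (by omega)

lemma commute_fiedlerP {i j : ℕ} (hij : i + 2 ≤ j) (hj : j < m) :
    Commute (fiedlerP m Ac i) (fiedlerP m Ac j) := by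
  rw [fiedlerP_nat m Ac hj, fiedlerP_nat m Ac (show i < m by omega)]
  exact ((posFactor_commute m _ (by omega)).map (compRingEquiv (Fin m) (Fin n) R)).symm

lemma commute_fiedlerP_neg {i j : ℕ} (hij : i + 2 ≤ j) (hj : j < m) :
    Commute (fiedlerP m Ac ((i : ℤ) - m)) (fiedlerP m Ac ((j : ℤ) - m)) := by
  rw [fiedlerP_neg m Ac hj, fiedlerP_neg m Ac (show i < m by omega)]
  exact (negFactor_commute m _ (by omega)).map (compRingEquiv (Fin m) (Fin n) R)

lemma prod_fiedlerP_neg_range {k : ℕ} (l : List ℕ) (hl : ∀ i ∈ l, i < k) (hk : k ≤ m) :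
    (l.map fun i : ℕ => fiedlerP m Ac ((i : ℤ) - m)).prod =
      compRingEquiv (Fin m) (Fin n) R ((l.map (negFactor m (revCoeff m Ac))).prod) := by
  rw [map_list_prod, List.map_map]
  congr 1
  exact List.map_congr_left fun i hi => fiedlerP_neg m Ac ((hl i hi).trans_le hk)

/-- The index t - m corresponds to the factor at position t, so the shifted tuple lists the
positions themselves. -/
lemma tupleProd_eq_shift (M : ℤ → Matrix (Fin m × Fin n) (Fin m × Fin n) R) (z : List ℤ) :
    tupleProd M z = ((shiftTuple m z).map fun i => M (i - m)).prod := by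
  simp [tupleProd, shiftTuple, Function.comp_def]

section

variable {p Z H g : ℕ}

lemma tupleProd_pairTuple (hm : m = g + 1 + 2 * H) :
    tupleProd (fiedlerP m Ac) (pairTuple ((2 * H : ℕ) : ℤ) H) =
      compRingEquiv (Fin m) (Fin n) R (posOdd m (revCoeff m Ac) g H *
        stepProd (posFactor m (revCoeff m Ac)) (g + 1) H) := by
  have := prod_map_pairTuple (fiedlerP m Ac) 0 H
    fun i j hij hj => commute_fiedlerP Ac hij (by omega)
  rw [Nat.zero_add] at this
  rw [tupleProd, this, stepProd_fiedlerP Ac (by omega) (show _ = g + 2 by omega),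
    stepProd_fiedlerP Ac (by omega) (show _ = g + 1 by omega), map_mul]
  rfl

/-- The final index 0 supplies the factor t = m that `posEven` still lacks; it commutes with the
other factors of `posEven` and is moved in front of them. -/
lemma tupleProd_w (hm : m = g + 1 + 2 * H) :
    tupleProd (fiedlerP m Ac) (admissibleTuple (2 * H) 0) =
      compRingEquiv (Fin m) (Fin n) R
        (posOdd m (revCoeff m Ac) g H * posEven m (revCoeff m Ac) g H) := by
  have h0 := tupleProd_pairTuple Ac hm
  have hc : Commute (posFactor m (revCoeff m Ac) (g + 1 + 2 * H))
      (stepProd (posFactor m (revCoeff m Ac)) (g + 1) H) :=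
    commute_stepProd fun l hl => (posFactor_commute m _ (by omega)).symm
  rw [tupleProd] at h0 ⊢
  rw [admissibleTuple_zero _ H rfl, List.map_append, List.prod_append, h0, posEven, stepProd, hc.eq,
    ← mul_assoc, map_mul]
  have h1 := fiedlerP_nat m Ac (i := 0) (by omega)
  rw [Nat.cast_zero, Nat.sub_zero] at h1
  rw [List.map_singleton, List.prod_singleton, h1, ← hm, map_mul _ _ (posFactor _ _ _), map_mul]

lemma tupleProd_cw (hm : m = g + 1 + 2 * H) :
    tupleProd (fiedlerP m Ac) (symmComplement (2 * H) 0) =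
      compRingEquiv (Fin m) (Fin n) R (posOdd m (revCoeff m Ac) g H) := by
  have := prod_map_symmComplement (fiedlerP m Ac) 0 H
  rw [Nat.zero_add] at this
  rw [tupleProd, this, stepProd_fiedlerP Ac (by omega) (show _ = g + 2 by omega)]
  simp [posOdd]

lemma tupleProd_z (hm : m = g + 1 + 2 * H) (hg : g = p + 2 * Z) {z : List ℤ}
    (hz : shiftTuple m z = admissibleTuple g p) :
    tupleProd (fiedlerP m Ac) z = compRingEquiv (Fin m) (Fin n) R
      (negOdd m (revCoeff m Ac) p Z * negEven m (revCoeff m Ac) p Z *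
        ((List.range (p + 1)).map (negFactor m (revCoeff m Ac))).prod) := by
  rw [tupleProd_eq_shift, hz, hg, prod_map_admissibleTuple (fun i => fiedlerP m Ac (i - m)) p Z
    fun i j hij hj => commute_fiedlerP_neg Ac hij (by omega),
    stepProd_fiedlerP_neg Ac (by omega), stepProd_fiedlerP_neg Ac (by omega),
    prod_fiedlerP_neg_range Ac (k := p + 1) _ (by simp) (by omega), map_mul, map_mul]
  rfl

lemma tupleProd_cz (hm : m = g + 1 + 2 * H) (hg : g = p + 2 * Z) {cz : List ℤ}
    (hcz : shiftTuple m cz = symmComplement g p) :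
    tupleProd (fiedlerP m Ac) cz = compRingEquiv (Fin m) (Fin n) R
      (negOdd m (revCoeff m Ac) p Z * blk m (hankelFun (revCoeff m Ac) p)) := by
  rw [tupleProd_eq_shift, hcz, hg, prod_map_symmComplement (fun i => fiedlerP m Ac (i - m)) p Z,
    stepProd_fiedlerP_neg Ac (by omega),
    prod_fiedlerP_neg_range Ac (k := p) _ _ (by omega), map_mul,
    prod_strings m _ (by omega)]
  · rfl
  · intro i hi
    simp only [List.mem_flatMap, List.mem_range] at hi
    omega

end

end FiedlerProducts

/-! ### The factorization of the pencil through the reduced one -/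

section Congruence

variable {S : Type} [Ring S] {m : ℕ} (a : ℕ → S) {p Z H g : ℕ}

/-- The constant matrix that transforms the reduced pencil into the pencil of the tuples. -/
def outer (m : ℕ) (a : ℕ → S) (p Z g H : ℕ) : Matrix (Fin m) (Fin m) S :=
  negOdd m a p Z * posOdd m a g H

lemma commute_negOdd_posOdd (hg : g = p + 2 * Z) : Commute (negOdd m a p Z) (posOdd m a g H) :=
  commute_stepProd fun l hl => (commute_stepProd fun l' hl' =>
    (negFactor_commute_posFactor m a (by omega)).symm).symm

/-- By `prod_strings` the Hankel matrix is a product of factors at positions t < p. -/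
lemma commute_hankel {x : Matrix (Fin m) (Fin m) S} (hp : p ≤ m)
    (hx : ∀ t < p, Commute (negFactor m a t) x) : Commute (blk m (hankelFun a p)) x := by
  rw [← prod_strings m a hp]
  refine Commute.list_prod_left _ _ fun y hy => ?_
  simp only [List.mem_map, List.mem_flatMap, List.mem_range] at hy
  obtain ⟨i, ⟨l, hl, hi⟩, rfl⟩ := hy
  exact hx i (by omega)

lemma commute_hankel_posOdd (hp : p ≤ m) (hg : g = p + 2 * Z) :
    Commute (blk m (hankelFun a p)) (posOdd m a g H) :=
  commute_hankel a hp fun _ ht => commute_stepProd fun _ _ =>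
    negFactor_commute_posFactor m a (by omega)

lemma commute_hankel_negOdd (hp : p ≤ m) :
    Commute (blk m (hankelFun a p)) (negOdd m a p Z) :=
  commute_hankel a hp fun _ ht => commute_stepProd fun _ _ => negFactor_commute m a (by omega)

/-- Neither of the truncated positions 0 and m occurs in `outer`, so it is invertible whatever A_m
and A_0 are. -/
lemma isUnit_outer (hm : m = g + 1 + 2 * H) (hg : g = p + 2 * Z) : IsUnit (outer m a p Z g H) :=
  (isUnit_stepProd fun _ _ => isUnit_negFactor m a (by omega) (by omega)).mul
    (isUnit_stepProd fun _ _ => isUnit_posFactor m a (by omega) (by omega))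

/-- The Hankel matrix moves left past `negOdd` and `posOdd` and is absorbed by the string 0, …, p,
which raises its size to p + 1. Then `negEven` · Hankel is traded for `posOdd` · `redX`. -/
lemma outer_mul_redX_mul_outer (hm : m = g + 1 + 2 * H) (hg : g = p + 2 * Z) :
    (negOdd m a p Z * negEven m a p Z * ((List.range (p + 1)).map (negFactor m a)).prod) *
      posOdd m a g H * (negOdd m a p Z * blk m (hankelFun a p)) =
    outer m a p Z g H * blk m (redX a p) * outer m a p Z g H := by
  have h1 := (commute_hankel_posOdd (m := m) (H := H) a (by omega) hg).eq
  have h2 := (commute_hankel_negOdd (m := m) (Z := Z) a (p := p) (by omega)).eq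
  have h3 := (commute_negOdd_posOdd (m := m) (H := H) a hg).eq
  rw [outer, mul_assoc (negOdd m a p Z) (posOdd m a g H) (blk m _), posOdd_mul_redX m a hg hm,
    ← prod_range_mul_hankel m a (by omega), ← h2, mul_assoc _ (posOdd m a g H),
    ← mul_assoc (posOdd m a g H), ← h1]
  simp only [mul_assoc, h3]

/-- Here the Hankel matrix keeps the size p, and `posEven` · Hankel is traded for `negOdd` · `redY`.
-/
lemma outer_mul_redY_mul_outer (hm : m = g + 1 + 2 * H) (hg : g = p + 2 * Z) :
    (posOdd m a g H * posEven m a g H) *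
      posOdd m a g H * (negOdd m a p Z * blk m (hankelFun a p)) =
    outer m a p Z g H * blk m (redY a p) * outer m a p Z g H := by
  have h1 := (commute_hankel_posOdd (m := m) (H := H) a (by omega) hg).eq
  have h2 := (commute_hankel_negOdd (m := m) (Z := Z) a (p := p) (by omega)).eq
  have h3 := (commute_negOdd_posOdd (m := m) (H := H) a hg).eq
  rw [outer, h3, mul_assoc (posOdd m a g H) (negOdd m a p Z) (blk m _), negOdd_mul_redY m a hg hm,
    ← h2, mul_assoc _ (posOdd m a g H), ← mul_assoc (posOdd m a g H) (blk m _), ← h1]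
  simp only [mul_assoc]

end Congruence

/-! ### Row equations of the reduced pencil: kernels and explicit solutions -/

section Rows

variable {S : Type} [Ring S] {m p N : ℕ} (a : ℕ → S)

lemma sum_range_ite_eq (m c : ℕ) (x : S) (W : ℕ → S) :
    ∑ r ∈ Finset.range m, (if r = c then x else 0) * W r = if c < m then x * W c else 0 := by
  simp [ite_mul]

lemma sum_redX_of_le {s : ℕ} (hpm : p < m) (hs : s ≤ p) (W : ℕ → S) :
    ∑ r ∈ Finset.range m, redX a p s r * W r =
      ∑ u ∈ Finset.range (s + 1), a u * W (p - s + u) := by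
  have h := Finset.sum_Ico_eq_sum_range (fun r => redX a p s r * W r) (p - s) (p + 1)
  rw [show p + 1 - (p - s) = s + 1 by omega] at h
  rw [← Finset.sum_subset (s₁ := Finset.Ico (p - s) (p + 1)), h]
  · refine Finset.sum_congr rfl fun u hu => ?_
    rw [Finset.mem_range] at hu
    rw [redX, if_pos (by omega), if_pos (by omega), show s + (p - s + u) - p = u by omega]
  · intro r hr
    simp only [Finset.mem_Ico, Finset.mem_range] at hr ⊢
    omega
  · intro r _ hr
    simp only [Finset.mem_Ico] at hr
    rw [redX]
    split_ifs <;> first | omega | simp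

lemma sum_redY_of_lt {s : ℕ} (hpm : p < m) (hs : s < p) (W : ℕ → S) :
    ∑ r ∈ Finset.range m, redY a p s r * W r =
      ∑ u ∈ Finset.range (s + 1), a u * W (p - 1 - s + u) := by
  have h := Finset.sum_Ico_eq_sum_range (fun r => redY a p s r * W r) (p - 1 - s) p
  rw [show p - (p - 1 - s) = s + 1 by omega] at h
  rw [← Finset.sum_subset (s₁ := Finset.Ico (p - 1 - s) p), h]
  · refine Finset.sum_congr rfl fun u hu => ?_
    rw [Finset.mem_range] at hu
    rw [redY, if_pos (by omega), if_pos (by omega), show s + (p - 1 - s + u) + 1 - p = u by omega]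
  · intro r hr
    simp only [Finset.mem_Ico, Finset.mem_range] at hr ⊢
    omega
  · intro r _ hr
    simp only [Finset.mem_Ico] at hr
    rw [redY]
    split_ifs <;> first | omega | simp

lemma sum_redX_odd {s : ℕ} (hs : p < s) (hodd : (s - p) % 2 = 1) (hsm : s + 1 < m) (W : ℕ → S) :
    ∑ r ∈ Finset.range m, redX a p s r * W r = W (s + 1) := by
  have : ∀ r, redX a p s r = if r = s + 1 then 1 else 0 := fun r => by
    rw [redX]; split_ifs <;> first | omega | rfl
  simp only [this, sum_range_ite_eq, hsm, if_true, one_mul]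

lemma sum_redY_odd {s : ℕ} (hs : p < s) (hodd : (s - p) % 2 = 1) (hsm : s < m) (W : ℕ → S) :
    ∑ r ∈ Finset.range m, redY a p s r * W r = W (s - 1) := by
  have : ∀ r, redY a p s r = if r = s - 1 then 1 else 0 := fun r => by
    rw [redY]; split_ifs <;> first | omega | rfl
  simp only [this, sum_range_ite_eq, show s - 1 < m by omega, if_true, one_mul]

lemma sum_redX_even {s : ℕ} (hs : p < s) (heven : (s - p) % 2 = 0) (hsm : s < m) (W : ℕ → S) :
    ∑ r ∈ Finset.range m, redX a p s r * W r = W (s - 1) + a s * W s := by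
  have : ∀ r, redX a p s r = (if r = s - 1 then 1 else 0) + (if r = s then a s else 0) := fun r => by
    rw [redX]; split_ifs <;> first | omega | simp
  simp only [this, add_mul, Finset.sum_add_distrib, sum_range_ite_eq, hsm,
    show s - 1 < m by omega, if_true, one_mul]

lemma sum_redY_even {s : ℕ} (hs : p ≤ s) (heven : (s - p) % 2 = 0) (hsm : s < m) (W : ℕ → S) :
    ∑ r ∈ Finset.range m, redY a p s r * W r =
      -(a (s + 1) * W s) + if s + 1 < m then W (s + 1) else 0 := by
  have : ∀ r, redY a p s r = (if r = s then -a (s + 1) else 0) + (if r = s + 1 then 1 else 0) :=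
    fun r => by rw [redY]; split_ifs <;> first | omega | simp
  simp only [this, add_mul, Finset.sum_add_distrib, sum_range_ite_eq, hsm,
    if_true, one_mul, neg_mul]

/-- The rows of the reduced pencil, except the last one, have no kernel on the vectors whose last
entry vanishes. -/
lemma redPencil_kernel (hm : m = p + 2 * N + 1) (ℓ : S) (hℓ : ∀ x, Commute ℓ x)
    (ha : p ≠ 0 → ∀ x, a 0 * x = 0 → x = 0) (W : ℕ → S) (hlast : W (m - 1) = 0)
    (hrow : ∀ s, s + 1 < m → ℓ * ∑ r ∈ Finset.range m, redX a p s r * W r =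
      ∑ r ∈ Finset.range m, redY a p s r * W r) :
    ∀ t < m, W t = 0 := by
  -- The rows s > p with s - p odd read ℓ W(s+1) = W(s-1), so the zero at the last position descends
  -- to W(p) in steps of two.
  have hA : ∀ l ≤ N, W (m - 1 - 2 * l) = 0 := by
    intro l
    induction l with
    | zero => simpa using hlast
    | succ l ih =>
      intro hl
      have h := hrow (m - 2 - 2 * l) (by omega)
      rw [sum_redX_odd a (by omega) (by omega) (by omega),
        sum_redY_odd a (by omega) (by omega) (by omega),
        show m - 2 - 2 * l + 1 = m - 1 - 2 * l by omega, ih (by omega), mul_zero,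
        show m - 2 - 2 * l - 1 = m - 1 - 2 * (l + 1) by omega] at h
      exact h.symm
  -- In the Hankel rows the terms with u ≥ 1 cancel by induction, leaving a_0 (ℓ W(p-s) - W(p-1-s))
  -- = 0. This is the only place where a_0 is cancelled, and it is void for p = 0.
  have hd : ∀ s < p, ℓ * W (p - s) = W (p - 1 - s) := by
    intro s
    induction s using Nat.strong_induction_on with
    | _ s ih =>
      intro hs
      have h := hrow s (by omega)
      rw [sum_redX_of_le a (by omega) hs.le, sum_redY_of_lt a (by omega) hs, Finset.mul_sum,
        Finset.sum_range_succ', Finset.sum_range_succ'] at h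
      have h' : ∀ u ∈ Finset.range s, ℓ * (a (u + 1) * W (p - s + (u + 1))) =
          a (u + 1) * W (p - 1 - s + (u + 1)) := fun u hu => by
        rw [Finset.mem_range] at hu
        have := ih (s - (u + 1)) (by omega) (by omega)
        rw [← mul_assoc, (hℓ _).eq, mul_assoc, show p - s + (u + 1) = p - (s - (u + 1)) by omega,
          this, show p - 1 - (s - (u + 1)) = p - 1 - s + (u + 1) by omega]
      rw [Finset.sum_congr rfl h', add_right_inj, ← mul_assoc, (hℓ _).eq, mul_assoc, add_zero,
        add_zero, ← sub_eq_zero, ← mul_sub] at h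
      exact sub_eq_zero.1 (ha (by omega) _ h)
  have hB : ∀ s ≤ p, W (p - s) = 0 := by
    intro s
    induction s with
    | zero =>
      intro _
      have := hA N le_rfl
      rwa [show m - 1 - 2 * N = p by omega] at this
    | succ s ih =>
      intro hs
      have := hd s (by omega)
      rw [ih (by omega), mul_zero] at this
      rw [show p - (s + 1) = p - 1 - s by omega, ← this]
  have hE : ∀ l ≤ N, W (p + 2 * l) = 0 := fun l hl => by
    have := hA (N - l) (by omega)
    rwa [show m - 1 - 2 * (N - l) = p + 2 * l by omega] at this
  -- The rows with s - p even express W(s+1) through entries already known to vanish.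
  have hC : ∀ l, l < N → W (p + 2 * l + 1) = 0 := by
    intro l
    induction l with
    | zero =>
      intro hl
      have h := hrow p (by omega)
      rw [sum_redX_of_le a (by omega) le_rfl, sum_redY_even a le_rfl (by omega) (by omega),
        if_pos (by omega), Finset.sum_eq_zero fun u hu => ?_, show W p = 0 from hE 0 (by omega)] at h
      · simpa using h.symm
      · rw [Finset.mem_range] at hu
        have := hB (p - u) (by omega)
        rw [show p - p + u = p - (p - u) by omega, this, mul_zero]
    | succ l ih =>
      intro hl
      have h := hrow (p + 2 * (l + 1)) (by omega)
      rw [sum_redX_even a (by omega) (by omega) (by omega),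
        sum_redY_even a (by omega) (by omega) (by omega), if_pos (by omega),
        hE (l + 1) (by omega), show p + 2 * (l + 1) - 1 = p + 2 * l + 1 by omega,
        ih (by omega)] at h
      simpa using h.symm
  intro t ht
  rcases Nat.lt_or_ge t p with h | h
  · have := hB (p - t) (by omega)
    rwa [show p - (p - t) = t by omega] at this
  · rcases Nat.even_or_odd' (t - p) with ⟨l, hl | hl⟩
    · rw [show t = p + 2 * l by omega]
      exact hE l (by omega)
    · rw [show t = p + 2 * l + 1 by omega]
      exact hC l (by omega)

/-- The Hankel corner is anti-triangular with a_0 on the antidiagonal, and the other rows determine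
the other entries one at a time. This gives invertibility of the limit of the pencil at infinity. -/
lemma redX_kernel (hm : m = p + 2 * N + 1) (ha : ∀ x, a 0 * x = 0 → x = 0) (W : ℕ → S)
    (hrow : ∀ s < m, ∑ r ∈ Finset.range m, redX a p s r * W r = 0) :
    ∀ t < m, W t = 0 := by
  have hB : ∀ s ≤ p, W (p - s) = 0 := by
    intro s
    induction s using Nat.strong_induction_on with
    | _ s ih =>
      intro hs
      have h := hrow s (by omega)
      rw [sum_redX_of_le a (by omega) hs, Finset.sum_range_succ', Finset.sum_eq_zero, zero_add,
        add_zero] at h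
      · exact ha _ h
      · intro u hu
        rw [Finset.mem_range] at hu
        have := ih (s - (u + 1)) (by omega) (by omega)
        rw [show p - s + (u + 1) = p - (s - (u + 1)) by omega, this, mul_zero]
  have hE : ∀ t, p < t → t < m → (t - p) % 2 = 0 → W t = 0 := fun t h1 h2 h3 => by
    have h := hrow (t - 1) (by omega)
    rwa [sum_redX_odd a (by omega) (by omega) (by omega), show t - 1 + 1 = t by omega] at h
  intro t ht
  rcases Nat.lt_or_ge p t with h | h
  · rcases Nat.mod_two_eq_zero_or_one (t - p) with h' | h'
    · exact hE t h ht h'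
    · have h2 := hrow (t + 1) (by omega)
      rwa [sum_redX_even a (by omega) (by omega) (by omega), hE (t + 1) (by omega) (by omega)
        (by omega), mul_zero, add_zero, show t + 1 - 1 = t by omega] at h2
  · have := hB (p - t) (by omega)
    rwa [show p - (p - t) = t by omega] at this

/-- The Horner shifts of the polynomial with coefficients `a 0, a 1, …` in decreasing order. -/
def horner (ℓ : S) (t : ℕ) : S := ∑ u ∈ Finset.range (t + 1), ℓ ^ (t - u) * a u

lemma horner_succ (ℓ : S) (t : ℕ) : horner a ℓ (t + 1) = ℓ * horner a ℓ t + a (t + 1) := by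
  rw [horner, Finset.sum_range_succ, horner, Finset.mul_sum]
  congr 1
  · refine Finset.sum_congr rfl fun u hu => ?_
    rw [Finset.mem_range] at hu
    rw [show t + 1 - u = t - u + 1 by omega, pow_succ', mul_assoc]
  · simp

/-- The last column of the right transformation of the reduced pencil. -/
def lastCol (p N : ℕ) (ℓ : S) (t : ℕ) : S :=
  if t ≤ p then ℓ ^ (p - t + N)
  else if (t - p) % 2 = 0 then ℓ ^ (N - (t - p) / 2)
  else horner a ℓ t * ℓ ^ (N - (t - p) / 2)

/-- Powers of ℓ solve the Hankel rows and the rows ℓ W(s+1) = W(s-1). From s = p on, the rows with s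
- p even become Horner's recursion h_{s+1} = ℓ h_s + a_{s+1}; only the last row leaves a remainder,
the full polynomial h_m. -/
lemma redPencil_lastCol (hm : m = p + 2 * N + 1) (ℓ : S) (hℓ : ∀ x, Commute ℓ x) {s : ℕ}
    (hs : s < m) :
    ℓ * ∑ r ∈ Finset.range m, redX a p s r * lastCol a p N ℓ r -
      ∑ r ∈ Finset.range m, redY a p s r * lastCol a p N ℓ r =
      if s + 1 = m then horner a ℓ m else 0 := by
  rcases Nat.lt_trichotomy s p with h | h | h
  · rw [sum_redX_of_le a (by omega) h.le, sum_redY_of_lt a (by omega) h, if_neg (by omega),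
      Finset.mul_sum, sub_eq_zero]
    refine Finset.sum_congr rfl fun u hu => ?_
    rw [Finset.mem_range] at hu
    rw [lastCol, lastCol, if_pos (by omega), if_pos (by omega), ← mul_assoc, (hℓ _).eq, mul_assoc,
      ← pow_succ']
    congr 2
    omega
  · subst h
    have h1 : ∑ u ∈ Finset.range (s + 1), a u * lastCol a s N ℓ (s - s + u) =
        horner a ℓ s * ℓ ^ N := by
      rw [horner, Finset.sum_mul]
      refine Finset.sum_congr rfl fun u hu => ?_
      rw [Finset.mem_range] at hu
      rw [lastCol, if_pos (by omega), show s - (s - s + u) + N = s - u + N by omega, pow_add,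
        ← mul_assoc, ((hℓ (a u)).pow_left _).eq]
    have h2 : lastCol a s N ℓ s = ℓ ^ N := by simp [lastCol]
    rw [sum_redX_of_le a (by omega) le_rfl, sum_redY_even a le_rfl (by omega) (by omega), h1, h2]
    rcases Nat.eq_zero_or_pos N with hN | hN
    · rw [if_neg (by omega), if_pos (by omega), hm, hN]
      simp [horner_succ]
    · rw [if_pos (by omega), if_neg (by omega), lastCol, if_neg (by omega), if_neg (by omega),
        show N - (s + 1 - s) / 2 = N by omega, horner_succ]
      noncomm_ring
  · rcases Nat.mod_two_eq_zero_or_one (s - p) with h' | h'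
    · obtain ⟨l, hl⟩ : ∃ l, s = p + 2 * (l + 1) := ⟨(s - p) / 2 - 1, by omega⟩
      have e1 : lastCol a p N ℓ (s - 1) = horner a ℓ (s - 1) * (ℓ * ℓ ^ (N - (l + 1))) := by
        rw [lastCol, if_neg (by omega), if_neg (by omega),
          show N - (s - 1 - p) / 2 = N - (l + 1) + 1 by omega, pow_succ']
      have e2 : lastCol a p N ℓ s = ℓ ^ (N - (l + 1)) := by
        rw [lastCol, if_neg (by omega), if_pos (by omega), show (s - p) / 2 = l + 1 by omega]
      have e3 : horner a ℓ (s + 1) * ℓ ^ (N - (l + 1)) =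
          ℓ * (horner a ℓ (s - 1) * (ℓ * ℓ ^ (N - (l + 1))) + a s * ℓ ^ (N - (l + 1))) +
          a (s + 1) * ℓ ^ (N - (l + 1)) := by
        have := horner_succ a ℓ (s - 1)
        rw [show s - 1 + 1 = s by omega] at this
        rw [horner_succ, this, ← mul_assoc (horner a ℓ (s - 1)) ℓ, ← (hℓ (horner a ℓ (s - 1))).eq]
        noncomm_ring
      rw [sum_redX_even a h h' hs, sum_redY_even a h.le h' hs, e1, e2, sub_add_eq_sub_sub,
        sub_neg_eq_add, ← e3]
      by_cases hsm : s + 1 = m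
      · rw [if_neg (by omega), if_pos hsm, hsm, show N - (l + 1) = 0 by omega]
        simp
      · rw [if_pos (by omega), if_neg hsm, lastCol, if_neg (by omega), if_neg (by omega),
          show (s + 1 - p) / 2 = l + 1 by omega, sub_self]
    · rw [sum_redX_odd a h h' (by omega), sum_redY_odd a h h' hs, if_neg (by omega), sub_eq_zero,
        lastCol, if_neg (by omega), if_pos (by omega), ← pow_succ', lastCol]
      split_ifs <;> first | omega | (congr 1; omega)

/-- The reversed Horner shifts. -/
def tail (m : ℕ) (μ : S) (j : ℕ) : S := ∑ i ∈ Finset.range (m + 1 - j), μ ^ i * a (j + i)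

/-- Two steps of tail_j = a_j + μ tail_{j+1} at once, since an even row of the pencil involves both
a_j and a_{j+1}; for j + 1 = m the recursion stops. -/
lemma tail_step (μ : S) {j : ℕ} (hj : j + 1 ≤ m) :
    tail a m μ j = a j + μ * a (j + 1) + if j + 1 < m then μ * (μ * tail a m μ (j + 2)) else 0 := by
  rw [tail, show m + 1 - j = m - 1 - j + 1 + 1 by omega, Finset.sum_range_succ',
    Finset.sum_range_succ']
  simp only [pow_zero, one_mul, add_zero, zero_add, pow_one]
  have : ∑ k ∈ Finset.range (m - 1 - j), μ ^ (k + 1 + 1) * a (j + (k + 1 + 1)) =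
      if j + 1 < m then μ * (μ * tail a m μ (j + 2)) else 0 := by
    split_ifs with h
    · rw [tail, Finset.mul_sum, Finset.mul_sum, show m + 1 - (j + 2) = m - 1 - j by omega]
      refine Finset.sum_congr rfl fun k hk => ?_
      rw [pow_succ', pow_succ', mul_assoc, mul_assoc]
      congr 4; omega
    · rw [show m - 1 - j = 0 by omega, Finset.sum_range_zero]
  rw [this]
  abel

/-- The first column of the right transformation at infinity of the block tridiagonal pencil. -/
def firstCol (m : ℕ) (μ : S) (t : ℕ) : S :=
  if t % 2 = 0 then μ ^ (t / 2) else -(tail a m μ (t + 1) * μ ^ (t / 2 + 1))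

/-- The counterpart at infinity, with μ = 1/λ: powers of μ solve the odd rows, and `tail_step`
solves the even ones. The remainder lands in row 0 and is the reversed polynomial ∑ μ^i a_i. -/
lemma redPencil_firstCol (hm : m = 2 * N + 1) (μ : S) (hμ : ∀ x, Commute μ x) {s : ℕ}
    (hs : s < m) :
    ∑ r ∈ Finset.range m, redX a 0 s r * firstCol a m μ r -
      μ * ∑ r ∈ Finset.range m, redY a 0 s r * firstCol a m μ r =
      if s = 0 then tail a m μ 0 else 0 := by
  rcases Nat.mod_two_eq_zero_or_one s with h' | h'
  · have hx : firstCol a m μ s = μ ^ (s / 2) := by rw [firstCol, if_pos h']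
    have hy : (if s + 1 < m then firstCol a m μ (s + 1) else 0) =
        -((if s + 1 < m then μ * tail a m μ (s + 2) else 0) * μ ^ (s / 2)) := by
      split_ifs with h
      · rw [firstCol, if_neg (by omega), show (s + 1) / 2 = s / 2 by omega, pow_succ',
          ← mul_assoc, ← (hμ (tail a m μ (s + 1 + 1))).eq]
      · simp
    have ht := tail_step a μ (j := s) (m := m) (by omega)
    have hmul : (if s + 1 < m then μ * (μ * tail a m μ (s + 2)) else 0) =
        μ * (if s + 1 < m then μ * tail a m μ (s + 2) else 0) := by
      rw [mul_ite, mul_zero]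
    rw [hmul] at ht
    have key : a s * μ ^ (s / 2) - μ * (-(a (s + 1) * μ ^ (s / 2)) +
        -((if s + 1 < m then μ * tail a m μ (s + 2) else 0) * μ ^ (s / 2))) =
        tail a m μ s * μ ^ (s / 2) := by
      rw [ht]
      noncomm_ring
    rw [sum_redY_even a (Nat.zero_le s) (by omega) hs, hx, hy]
    rcases Nat.eq_zero_or_pos s with rfl | h0
    · rw [sum_redX_of_le a (by omega) le_rfl]
      simp only [Nat.zero_div, pow_zero, mul_one, zero_add, Finset.sum_range_one, if_true] at key hx ⊢
      simpa [hx] using key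
    · rw [sum_redX_even a h0 (by omega) hs, hx, add_sub_assoc, key, if_neg (by omega), firstCol,
        if_neg (by omega), show s - 1 + 1 = s by omega, show (s - 1) / 2 + 1 = s / 2 by omega,
        neg_add_cancel]
  · rw [sum_redX_odd a (by omega) (by omega) (by omega), sum_redY_odd a (by omega) (by omega) hs,
      if_neg (by omega), sub_eq_zero, firstCol, if_pos (by omega), firstCol, if_pos (by omega),
      ← pow_succ']
    congr 1
    omega

end Rows

/-! ### Entries of `outer`, and rigidity of the signs -/

section OuterEntries

variable {S : Type} [Ring S] {m p Z H g : ℕ} (a : ℕ → S)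

/-- The entries of the matrix `outer`. -/
def outerFun (p g s r : ℕ) : S :=
  if p ≤ s ∧ s < g then
    if (s - p) % 2 = 0 then (if r = s + 1 then 1 else 0)
    else (if r + 1 = s then 1 else if r = s then a s else 0)
  else if g < s then
    if (s - g) % 2 = 1 then (if r = s then -a (s + 1) else if r = s + 1 then 1 else 0)
    else (if r + 1 = s then 1 else 0)
  else if r = s then 1 else 0

lemma outer_eq (hm : m = g + 1 + 2 * H) (hg : g = p + 2 * Z) :
    outer m a p Z g H = blk m (outerFun a p g) := by
  unfold outer negOdd posOdd posFactor negFactor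
  rw [stepProd_elem _ _ _ (g + 2) _ (by omega), stepProd_elem_mul _ _ _ _ _ (by omega)]
  refine blk_congr fun s r hs hr => ?_
  simp only [outerFun, idFun, mul_ite, mul_zero, mul_one]
  grind

/-- If H > 0, the factor at position m - 1, with blocks [-a, 1; 1, 0], carries e_m to e_{m-1}; if H
= 0, the last column is an identity column. The image is thus e_k with k = m - i_0(w). -/
lemma outerFun_last_col {s : ℕ} (hm : m = g + 1 + 2 * H) (hg : g = p + 2 * Z) (hs : s < m) :
    outerFun a p g s (m - 1) = if s + 1 + (if H = 0 then 0 else 1) = m then 1 else 0 := by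
  unfold outerFun
  grind

lemma outerFun_last_row {r : ℕ} (hm : m = g + 1 + 2 * H) (hr : r < m) :
    outerFun a p g (m - 1) r = if r + 1 + (if H = 0 then 0 else 1) = m then 1 else 0 := by
  unfold outerFun
  grind

lemma mul_apply_of_row_eq {A N : Matrix (Fin m) (Fin m) S} {s : Fin m}
    (h : ∀ k : Fin m, A s k = if (k : ℕ) = s then 1 else 0) (r : Fin m) : (A * N) s r = N s r := by
  rw [Matrix.mul_apply, Finset.sum_eq_single s]
  · simp [h]
  · intro k _ hk
    rw [h, if_neg (fun h' => hk (Fin.ext h')), zero_mul]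
  · simp

lemma stepProd_elem_row (u v : ℕ → S) (c N : ℕ) (hc : 0 < c) {s : Fin m}
    (hs : (s : ℕ) + 1 < c ∨ c + 2 * N ≤ s + 1) (k : Fin m) :
    stepProd (fun t => blk m (elemFun t (u t) (v t))) c N s k = if (k : ℕ) = s then 1 else 0 := by
  rw [stepProd_elem m u v c N hc, blk_apply, if_neg (by omega), idFun]

lemma posOdd_row {s : Fin m} (hs : (s : ℕ) ≤ g) (k : Fin m) :
    posOdd m a g H s k = if (k : ℕ) = s then 1 else 0 :=
  stepProd_elem_row _ _ _ _ (by omega) (by omega) k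

lemma posEven_row {s : Fin m} (hs : (s : ℕ) < g) (k : Fin m) :
    posEven m a g H s k = if (k : ℕ) = s then 1 else 0 :=
  stepProd_elem_row _ _ _ _ (by omega) (by omega) k

lemma negOdd_row (hg : g = p + 2 * Z) {s : Fin m} (hs : g ≤ s) (k : Fin m) :
    negOdd m a p Z s k = if (k : ℕ) = s then 1 else 0 :=
  stepProd_elem_row _ _ _ _ (by omega) (by omega) k

lemma negEven_row (hg : g = p + 2 * Z) {s : Fin m} (hs : g < s) (k : Fin m) :
    negEven m a p Z s k = if (k : ℕ) = s then 1 else 0 :=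
  stepProd_elem_row _ _ _ _ (by omega) (by omega) k

lemma hankel_row {s : Fin m} (hs : p ≤ s) (k : Fin m) :
    blk m (hankelFun a p) s k = if (k : ℕ) = s then 1 else 0 := by
  rw [blk_apply, hankelFun, if_neg (by omega), idFun]

/-- The lower rows of the leading coefficient of the pencil. -/
lemma redX_outer_row (hm : m = g + 1 + 2 * H) (hg : g = p + 2 * Z) {s : Fin m} (hs : g < s)
    (r : Fin m) :
    (outer m a p Z g H * blk m (redX a p) * outer m a p Z g H) s r = outerFun a p g s r := by
  -- In this form every factor to the left of the last one has identity rows beyond g.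
  have h : outer m a p Z g H * blk m (redX a p) * outer m a p Z g H = negOdd m a p Z *
      (negEven m a p Z * (blk m (hankelFun a (p + 1)) * blk m (outerFun a p g))) := by
    rw [← outer_eq a hm hg, ← mul_assoc (negEven m a p Z), ← posOdd_mul_redX m a hg hm, outer]
    simp only [mul_assoc]
  rw [h, mul_apply_of_row_eq (negOdd_row a hg hs.le), mul_apply_of_row_eq (negEven_row a hg hs),
    mul_apply_of_row_eq (hankel_row a (by omega)), blk_apply]

/-- The middle rows of the constant coefficient of the pencil. -/
lemma redY_outer_row (hm : m = g + 1 + 2 * H) (hg : g = p + 2 * Z) {s : Fin m} (hs : p ≤ s)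
    (hs' : s < g) (r : Fin m) :
    (outer m a p Z g H * blk m (redY a p) * outer m a p Z g H) s r = outerFun a p g s r := by
  -- In this form all factors but `negOdd` have identity rows between p and g, and there `negOdd`
  -- has the rows of `outer`.
  have h : outer m a p Z g H * blk m (redY a p) * outer m a p Z g H = posOdd m a g H *
      (posEven m a g H * (posOdd m a g H * (blk m (hankelFun a p) * negOdd m a p Z))) := by
    rw [← outer_mul_redY_mul_outer a hm hg,
      (commute_hankel_negOdd (m := m) (Z := Z) a (p := p) (by omega)).eq]
    simp only [mul_assoc]
  have h' := outer_eq a hm hg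
  rw [outer, (commute_negOdd_posOdd (m := m) (H := H) a hg).eq] at h'
  rw [h, mul_apply_of_row_eq (posOdd_row a hs'.le), mul_apply_of_row_eq (posEven_row a hs'),
    mul_apply_of_row_eq (posOdd_row a hs'.le), mul_apply_of_row_eq (hankel_row a hs),
    ← blk_apply m (outerFun a p g), ← h', mul_apply_of_row_eq (posOdd_row a hs'.le)]

/-- The diagonal matrix with integer diagonal entries. -/
def intDiag (m : ℕ) (δ : ℕ → ℤ) : Matrix (Fin m) (Fin m) S :=
  Matrix.diagonal fun s => ((δ s : ℤ) : S)

lemma commute_intDiag_iff {δ : ℕ → ℤ} {M : Matrix (Fin m) (Fin m) S} :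
    Commute (intDiag m δ) M ↔ ∀ s r : Fin m, ((δ s - δ r : ℤ) : S) * M s r = 0 := by
  rw [Commute, SemiconjBy, ← Matrix.ext_iff]
  refine forall₂_congr fun s r => ?_
  rw [intDiag, Matrix.diagonal_mul, Matrix.mul_diagonal, ← ((δ r).cast_commute _).eq, Int.cast_sub,
    sub_mul, sub_eq_zero]

/-- An integer diagonal matrix that commutes with both coefficients of the pencil is scalar. -/
lemma intDiag_const (hS : ∀ (k : ℤ) (x : S), (k : S) * x = 0 → k = 0 ∨ x = 0)
    (ha : a 0 ≠ 0) (hm : m = g + 1 + 2 * H) (hg : g = p + 2 * Z) {δ : ℕ → ℤ}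
    (hX : Commute (intDiag m δ) (outer m a p Z g H * blk m (redX a p) * outer m a p Z g H))
    (hY : Commute (intDiag m δ) (outer m a p Z g H * blk m (redY a p) * outer m a p Z g H))
    {s : ℕ} (hs : s < m) : δ s = δ 0 := by
  have h1 : (1 : S) ≠ 0 := fun h => ha (by rw [← one_mul (a 0), h, zero_mul])
  -- The off-diagonal ones of O are visible in the coefficients themselves: beyond g in the leading
  -- one, between p and g in the constant one. They equate δ on the two indices of each 2 × 2 block
  -- of O.
  have hlow : ∀ s, g < s → s + 1 < m → (s - g) % 2 = 1 → δ s = δ (s + 1) := fun s h2 h3 h4 => by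
    have := commute_intDiag_iff.1 hX ⟨s, by omega⟩ ⟨s + 1, h3⟩
    rw [redX_outer_row a hm hg h2, outerFun, if_neg (by simp; omega), if_pos h2, if_pos h4,
      if_neg (by simp), if_pos rfl] at this
    exact sub_eq_zero.1 ((hS _ _ this).resolve_right h1)
  have hmid : ∀ s, p ≤ s → s < g → (s - p) % 2 = 0 → δ s = δ (s + 1) := fun s h2 h3 h4 => by
    have := commute_intDiag_iff.1 hY ⟨s, by omega⟩ ⟨s + 1, by omega⟩
    rw [redY_outer_row a hm hg h2 h3, outerFun, if_pos ⟨h2, h3⟩, if_pos h4, if_pos rfl] at this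
    exact sub_eq_zero.1 ((hS _ _ this).resolve_right h1)
  -- O has nonzero off-diagonal entries only inside those 2 × 2 blocks, on which δ is constant.
  -- Being invertible, O can afterwards be cancelled from both sides.
  have hO : Commute (intDiag m δ) (outer m a p Z g H) := by
    rw [commute_intDiag_iff, outer_eq a hm hg]
    rintro ⟨s, hs⟩ ⟨r, hr⟩
    rw [blk_apply]
    suffices h : δ s = δ r ∨ outerFun a p g s r = 0 by
      rcases h with h | h
      · simp [h]
      · simp [h]
    have hlink : ∀ s, s + 1 < m → δ s = δ (s + 1) ∨
        (outerFun a p g s (s + 1) = 0 ∧ outerFun a p g (s + 1) s = 0) := fun s hs => by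
      by_cases h2 : p ≤ s ∧ s < g ∧ (s - p) % 2 = 0
      · exact Or.inl (hmid s h2.1 h2.2.1 h2.2.2)
      by_cases h3 : g < s ∧ (s - g) % 2 = 1
      · exact Or.inl (hlow s h3.1 hs h3.2)
      refine Or.inr ⟨?_, ?_⟩ <;> unfold outerFun <;> split_ifs <;> first | omega | rfl
    rcases Nat.lt_trichotomy r s with h | h | h
    · by_cases h4 : r + 1 = s
      · subst h4
        exact (hlink r hs).imp Eq.symm And.right
      · right; unfold outerFun; split_ifs <;> first | omega | rfl
    · exact Or.inl (by rw [h])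
    · by_cases h4 : s + 1 = r
      · subst h4
        exact (hlink s hr).imp_right And.left
      · right; unfold outerFun; split_ifs <;> first | omega | rfl
  have hcancel : ∀ M : Matrix (Fin m) (Fin m) S, Commute (intDiag m δ)
      (outer m a p Z g H * M * outer m a p Z g H) → Commute (intDiag m δ) M := fun M hM => by
    have hu := isUnit_outer a hm hg
    have h := hM.eq
    rw [mul_assoc, mul_assoc, ← mul_assoc (intDiag m δ), hO.eq, mul_assoc, mul_assoc M, ← hO.eq] at h
    have h' := hu.mul_left_cancel h
    rw [← mul_assoc, ← mul_assoc] at h'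
    exact hu.mul_right_cancel h'
  have hX' := hcancel _ hX
  have hY' := hcancel _ hY
  rw [commute_intDiag_iff] at hX' hY'
  have step : ∀ s, s + 1 < m → δ s = δ (s + 1) := by
    intro s hs
    rcases Nat.lt_or_ge s p with h | h
    -- The antidiagonal of Y' links s to p - 1 - s, and that of X' links p - 1 - s to s + 1. Since δ
    -- is an integer, a_0 ≠ 0 suffices; a_0 may be singular.
    · have e1 := hY' ⟨s, by omega⟩ ⟨p - 1 - s, by omega⟩
      have e2 := hX' ⟨p - 1 - s, by omega⟩ ⟨s + 1, hs⟩
      simp only [blk_apply, redX, redY] at e1 e2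
      rw [if_pos (by omega), if_pos (by omega), show s + (p - 1 - s) + 1 - p = 0 by omega] at e1
      rw [if_pos (by omega), if_pos (by omega), show p - 1 - s + (s + 1) - p = 0 by omega] at e2
      exact (sub_eq_zero.1 ((hS _ _ e1).resolve_right ha)).trans
        (sub_eq_zero.1 ((hS _ _ e2).resolve_right ha))
    · rcases Nat.mod_two_eq_zero_or_one (s - p) with h' | h'
      · have e1 := hY' ⟨s, by omega⟩ ⟨s + 1, hs⟩
        simp only [blk_apply, redY] at e1
        rw [if_neg (by omega), if_neg (by omega), if_pos h', if_neg (by omega), if_pos trivial] at e1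
        exact sub_eq_zero.1 ((hS _ _ e1).resolve_right h1)
      · have e1 := hX' ⟨s, by omega⟩ ⟨s + 1, hs⟩
        simp only [blk_apply, redX] at e1
        rw [if_neg (by omega), if_neg (by omega), if_neg (by omega), if_pos trivial] at e1
        exact sub_eq_zero.1 ((hS _ _ e1).resolve_right h1)
  induction s with
  | zero => rfl
  | succ s ih => rw [← step s hs, ih (by omega)]

end OuterEntries

/-! ### Symmetry of X', Y' and O up to signs -/

section Signs

/-- The signs that make the reduced pencil `T`-odd. -/
def signRed (p s : ℕ) : ℤˣ := if s ≤ p then (-1) ^ s else (-1) ^ (p + (s - p + 1) / 2)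

/-- The signs that make the pencil of the tuples `T`-odd. -/
def signOuter (p g s : ℕ) : ℤˣ := if p ≤ s ∧ s < g then -signRed p s else signRed p s

lemma signRed_succ_of_even {p s : ℕ} (h : p ≤ s) (h' : (s - p) % 2 = 0) :
    signRed p (s + 1) = -signRed p s := by
  unfold signRed
  rw [if_neg (by omega)]
  split_ifs with h1
  · obtain rfl : s = p := by omega
    rw [show s + (s + 1 - s + 1) / 2 = s + 1 by omega, pow_succ, mul_neg_one]
  · rw [show p + (s + 1 - p + 1) / 2 = p + (s - p + 1) / 2 + 1 by omega, pow_succ, mul_neg_one]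

lemma signRed_succ_of_odd {p s : ℕ} (h : p < s) (h' : (s - p) % 2 = 1) :
    signRed p (s + 1) = signRed p s := by
  unfold signRed
  rw [if_neg (by omega), if_neg (by omega)]
  congr 1
  omega

variable {n m p Z H N g : ℕ} {a : ℕ → Matrix (Fin n) (Fin n) ℂ}

/-- Since m - p is odd, transposing the corner entry a_{s+r-p} costs (-1)^(s+r), which the
alternating signs absorb. Outside the corner the diagonal entries a_s have s - p even, so they are
symmetric, and the ones join positions of equal sign. -/
lemma redX_signs (hm : m = p + 2 * N + 1)
    (ha : ∀ t ≤ m, (a t)ᵀ = (-1 : ℤˣ) ^ (m + t + 1) • a t) {s r : ℕ} (hs : s < m) (hr : r < m) :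
    signRed p s • redX a p s r = signRed p r • (redX a p r s)ᵀ := by
  unfold redX
  by_cases h1 : s ≤ p ∧ r ≤ p
  · rw [if_pos h1, if_pos h1.symm]
    by_cases h2 : p ≤ s + r
    · rw [if_pos h2, if_pos (by omega), show r + s = s + r by ring, ha _ (by omega), smul_smul,
        signRed, signRed, if_pos h1.1, if_pos h1.2, ← pow_add]
      congr 1
      rw [show r + (m + (s + r - p) + 1) = s + 2 * (r + N + 1) by omega, pow_add _ s, pow_mul]
      simp
    · rw [if_neg h2, if_neg (by omega)]
      simp
  · rw [if_neg h1, if_neg (show ¬ (r ≤ p ∧ s ≤ p) from fun h => h1 h.symm)]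
    by_cases h2 : s ≤ p ∨ r ≤ p
    · rw [if_pos h2, if_pos h2.symm]
      simp
    · rw [if_neg h2, if_neg (show ¬ (r ≤ p ∨ s ≤ p) from fun h => h2 h.symm)]
      rcases Nat.lt_trichotomy r s with h | h | h
      · by_cases h4 : r + 1 = s
        · subst h4
          have := @signRed_succ_of_odd p r (by omega)
          grind [Matrix.transpose_zero, Matrix.transpose_one, smul_zero, neg_neg]
        · grind [Matrix.transpose_zero, Matrix.transpose_one, smul_zero, neg_neg]
      · subst h
        by_cases h3 : (r - p) % 2 = 0
        · rw [if_pos h3, if_pos rfl, ha r hr.le, Even.neg_one_pow (by grind), one_smul]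
        · rw [if_neg h3, if_neg (by omega), transpose_zero]
      · by_cases h4 : s + 1 = r
        · subst h4
          have := @signRed_succ_of_odd p s (by omega)
          grind [Matrix.transpose_zero, Matrix.transpose_one, smul_zero, neg_neg]
        · grind [Matrix.transpose_zero, Matrix.transpose_one, smul_zero, neg_neg]

/-- All parities shift by one against `redX`: the corner entries are a_{s+r+1-p}, the diagonal ones
a_{s+1} are skew, and the ones join positions of opposite sign. -/
lemma redY_signs (hm : m = p + 2 * N + 1)
    (ha : ∀ t ≤ m, (a t)ᵀ = (-1 : ℤˣ) ^ (m + t + 1) • a t) {s r : ℕ} (hs : s < m) (hr : r < m) :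
    signRed p s • redY a p s r = (-signRed p r) • (redY a p r s)ᵀ := by
  unfold redY
  by_cases h1 : s < p ∧ r < p
  · rw [if_pos h1, if_pos h1.symm]
    by_cases h2 : p ≤ s + r + 1
    · rw [if_pos h2, if_pos (by omega), show r + s = s + r by ring, ha _ (by omega), smul_smul,
        signRed, signRed, if_pos (by omega), if_pos (by omega), neg_mul, ← pow_add]
      congr 1
      rw [← mul_neg_one (_ ^ (r + _)), ← pow_succ,
          show r + (m + (s + r + 1 - p) + 1) + 1 = s + 2 * (r + N + 2) by omega, pow_add _ s,
        pow_mul]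
      simp
    · rw [if_neg h2, if_neg (by omega)]
      simp
  · rw [if_neg h1, if_neg (show ¬ (r < p ∧ s < p) from fun h => h1 h.symm)]
    by_cases h2 : s < p ∨ r < p
    · rw [if_pos h2, if_pos h2.symm]
      simp
    · rw [if_neg h2, if_neg (show ¬ (r < p ∨ s < p) from fun h => h2 h.symm)]
      rcases Nat.lt_trichotomy r s with h | h | h
      · by_cases h4 : r + 1 = s
        · subst h4
          have := @signRed_succ_of_even p r (by omega)
          grind [Matrix.transpose_zero, Matrix.transpose_one, smul_zero, neg_neg]
        · grind [Matrix.transpose_zero, Matrix.transpose_one, smul_zero, neg_neg]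
      · subst h
        by_cases h3 : (r - p) % 2 = 0
        · rw [if_pos h3, if_pos rfl, transpose_neg, ha (r + 1) hr, Odd.neg_one_pow (by grind)]
          simp [Units.smul_def]
        · rw [if_neg h3, if_neg (by omega), transpose_zero]
          simp
      · by_cases h4 : s + 1 = r
        · subst h4
          have := @signRed_succ_of_even p s (by omega)
          grind [Matrix.transpose_zero, Matrix.transpose_one, smul_zero, neg_neg]
        · grind [Matrix.transpose_zero, Matrix.transpose_one, smul_zero, neg_neg]

/-- Blockwise form of QO = OᵀD. Between p and g the diagonal entries of O are skew and its ones join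
opposite signs of D, so Q must be -D there; beyond g they are symmetric and the ones join equal
signs. -/
lemma outerFun_signs (hm : m = g + 1 + 2 * H) (hg : g = p + 2 * Z)
    (ha : ∀ t ≤ m, (a t)ᵀ = (-1 : ℤˣ) ^ (m + t + 1) • a t) {s r : ℕ} (hs : s < m) (hr : r < m) :
    signOuter p g s • outerFun a p g s r = signRed p r • (outerFun a p g r s)ᵀ := by
  unfold outerFun signOuter
  rcases Nat.lt_trichotomy r s with h | h | h
  · by_cases h4 : r + 1 = s
    · subst h4
      have := @signRed_succ_of_even p r
      have := @signRed_succ_of_odd p r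
      grind [Matrix.transpose_zero, Matrix.transpose_one, smul_zero, neg_neg]
    · grind [Matrix.transpose_zero, Matrix.transpose_one, smul_zero, neg_neg]
  · subst h
    by_cases h1 : p ≤ r ∧ r < g
    · rw [if_pos h1, if_pos h1]
      by_cases h3 : (r - p) % 2 = 0
      · rw [if_pos h3, if_neg (by omega), transpose_zero]
        simp
      · rw [if_neg h3, if_neg (by omega), if_pos rfl, ha r hr.le, Odd.neg_one_pow (by grind)]
        simp [Units.smul_def]
    · rw [if_neg h1, if_neg h1]
      by_cases h2 : g < r
      · rw [if_pos h2]
        by_cases h3 : (r - g) % 2 = 1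
        · rw [if_pos h3, if_pos rfl, transpose_neg, ha (r + 1) hr, Even.neg_one_pow (by grind),
            one_smul]
        · rw [if_neg h3, if_neg (by omega), transpose_zero]
      · rw [if_neg h2, if_pos rfl, transpose_one]
  · by_cases h4 : s + 1 = r
    · subst h4
      have := @signRed_succ_of_even p s
      have := @signRed_succ_of_odd p s
      grind [Matrix.transpose_zero, Matrix.transpose_one, smul_zero, neg_neg]
    · grind [Matrix.transpose_zero, Matrix.transpose_one, smul_zero, neg_neg]

end Signs

/-! ### Replacing one block column of the pencil -/

section GeneralBlockMatrices

variable {S : Type} [Ring S] {m : ℕ}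

/-- The pencil `α X' - β Y'` of the reduced coefficients. -/
def redPencil (m : ℕ) (a : ℕ → S) (p : ℕ) (α β : S) : Matrix (Fin m) (Fin m) S :=
  blk m fun s r => α * redX a p s r - β * redY a p s r

lemma redPencil_mulVec (a : ℕ → S) (p : ℕ) (α β : S) (W : ℕ → S) (s : Fin m) :
    (redPencil m a p α β *ᵥ fun r : Fin m => W r) s =
      α * ∑ r ∈ Finset.range m, redX a p s r * W r -
        β * ∑ r ∈ Finset.range m, redY a p s r * W r := by
  rw [Finset.mul_sum, Finset.mul_sum, ← Finset.sum_sub_distrib, Matrix.mulVec, dotProduct,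
    ← Fin.sum_univ_eq_sum_range (fun r => α * (redX a p s r * W r) - β * (redY a p s r * W r)) m]
  refine Finset.sum_congr rfl fun r _ => ?_
  simp only [redPencil, blk_apply, sub_mul, mul_assoc]

lemma mul_one_updateCol (T : Matrix (Fin m) (Fin m) S) (c : Fin m) (x : Fin m → S) :
    T * (1 : Matrix (Fin m) (Fin m) S).updateCol c x = T.updateCol c (T *ᵥ x) := by
  ext s r
  by_cases h : r = c
  · subst h
    simp [Matrix.mul_apply, Matrix.mulVec, dotProduct]
  · simp [Matrix.mul_apply, Matrix.updateCol_ne h, Matrix.one_apply]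

lemma updateCol_mul_diagonal (T : Matrix (Fin m) (Fin m) S) (c : Fin m) (x : S) :
    T.updateCol c (Pi.single c 1) * Matrix.diagonal (Function.update 1 c x) =
      T.updateCol c (Pi.single c x) := by
  ext s r
  rw [Matrix.mul_diagonal]
  by_cases h : r = c
  · subst h
    by_cases hs : s = r
    · subst hs; simp
    · simp [hs]
  · simp [h]

/-- For the inverse, negate the off-diagonal entries of column c. -/
lemma isUnit_one_updateCol (c : Fin m) (x : Fin m → S) (hx : x c = 1) :
    IsUnit ((1 : Matrix (Fin m) (Fin m) S).updateCol c x) := by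
  have key : ∀ x y : Fin m → S, x c = 1 → y c = 1 → (∀ s, s ≠ c → x s + y s = 0) →
      (1 : Matrix (Fin m) (Fin m) S).updateCol c x * (1 : Matrix (Fin m) (Fin m) S).updateCol c y
        = 1 := by
    intro x y hx hy hxy
    rw [mul_one_updateCol]
    ext s r
    by_cases h : r = c
    · subst h
      rw [Matrix.updateCol_self, Matrix.mulVec, dotProduct]
      by_cases hs : s = r
      · subst hs
        rw [Finset.sum_eq_single s]
        · simp [hx, hy]
        · intro k _ hk; simp [Matrix.updateCol_ne hk, hk.symm]
        · simp
      · rw [Matrix.one_apply_ne hs, Finset.sum_eq_add (a := s) (b := r) hs]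
        · simp [Matrix.updateCol_ne hs, hy, add_comm, hxy s hs]
        · rintro k _ ⟨h1, h2⟩; simp [Matrix.updateCol_ne h2, h1.symm]
        · simp
        · simp
    · rw [Matrix.updateCol_ne h, Matrix.updateCol_ne h]
  refine ⟨⟨_, _, key x (fun s => if s = c then 1 else -x s) hx (by simp) ?_,
    key (fun s => if s = c then 1 else -x s) x (by simp) hx ?_⟩, rfl⟩
  · intro s hs; simp [hs]
  · intro s hs; simp [hs]

/-- Once column c is e_c, the rows other than c see only the entries of W off c; when these vanish,
row c reads W c = 0. -/
lemma updateCol_kernel (T : Matrix (Fin m) (Fin m) S) (c : Fin m)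
    (hT : ∀ W : Fin m → S, W c = 0 → (∀ s, s ≠ c → (T *ᵥ W) s = 0) → W = 0) (W : Fin m → S)
    (hW : T.updateCol c (Pi.single c 1) *ᵥ W = 0) : W = 0 := by
  have h1 : ∀ s, (T.updateCol c (Pi.single c 1) *ᵥ W) s =
      (T *ᵥ Function.update W c 0) s + Pi.single (M := fun _ => S) c (W c) s := by
    intro s
    rw [Matrix.mulVec, Matrix.mulVec, dotProduct, dotProduct,
      ← Finset.add_sum_erase _ _ (Finset.mem_univ c), add_comm,
      ← Finset.add_sum_erase _ (fun i => T s i * Function.update W c 0 i) (Finset.mem_univ c)]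
    rw [Function.update_self, mul_zero, zero_add]
    congr 1
    · refine Finset.sum_congr rfl fun r hr => ?_
      rw [Matrix.updateCol_ne (Finset.ne_of_mem_erase hr),
        Function.update_of_ne (Finset.ne_of_mem_erase hr)]
    · rw [Matrix.updateCol_self]
      by_cases hs : s = c
      · subst hs; simp
      · simp [hs]
  have h2 : Function.update W c 0 = 0 := by
    refine hT _ (Function.update_self ..) fun s hs => ?_
    have := h1 s
    rw [hW, Pi.single_eq_of_ne hs, add_zero] at this
    exact this.symm
  have h3 : W c = 0 := by
    have := h1 c
    rw [hW, h2, Matrix.mulVec_zero, Pi.single_eq_same] at this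
    simpa using this.symm
  rw [← h2, ← h3, Function.update_eq_self]

lemma redPencil_updateCol_kernel {p N : ℕ} (a : ℕ → S) (hm : m = p + 2 * N + 1) (ℓ : S)
    (hℓ : ∀ x, Commute ℓ x) (ha : p ≠ 0 → ∀ x, a 0 * x = 0 → x = 0) (c : Fin m)
    (hc : (c : ℕ) + 1 = m) (W : Fin m → S)
    (hW : (redPencil m a p ℓ 1).updateCol c (Pi.single c 1) *ᵥ W = 0) : W = 0 := by
  refine updateCol_kernel _ c (fun W hWc hrow => ?_) W hW
  set W' : ℕ → S := fun t => if h : t < m then W ⟨t, h⟩ else 0 with hW'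
  have hWW : W = fun r : Fin m => W' r := by
    funext r; simp [hW']
  have hlast : W' (m - 1) = 0 := by
    rw [hW']
    simp only [show m - 1 < m by omega, dif_pos]
    rw [← hWc]; congr 1; ext; simp; omega
  have := redPencil_kernel a hm ℓ hℓ ha W' hlast fun s hs => by
    have := hrow ⟨s, by omega⟩ (fun h => by rw [← h] at hc; simp at hc; omega)
    rw [hWW, redPencil_mulVec, one_mul, sub_eq_zero] at this
    exact this
  funext r
  rw [hWW]
  exact this r r.2

lemma redX_blk_kernel {p N : ℕ} (a : ℕ → S) (hm : m = p + 2 * N + 1)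
    (ha : ∀ x, a 0 * x = 0 → x = 0) (W : Fin m → S)
    (hW : blk m (redX a p) *ᵥ W = 0) : W = 0 := by
  set W' : ℕ → S := fun t => if h : t < m then W ⟨t, h⟩ else 0 with hW'
  have hWW : W = fun r : Fin m => W' r := by
    funext r; simp [hW']
  have := redX_kernel a hm ha W' fun s hs => by
    have := congrFun hW ⟨s, hs⟩
    rw [Matrix.mulVec, dotProduct, hWW] at this
    rw [← Fin.sum_univ_eq_sum_range (fun r => redX a p s r * W' r) m]
    exact this
  funext r
  rw [hWW]
  exact this r r.2

lemma map_redX {S' : Type} [Ring S'] (ψ : S →+* S') (a : ℕ → S) (p s r : ℕ) :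
    ψ (redX a p s r) = redX (fun t => ψ (a t)) p s r := by
  unfold redX
  split_ifs <;> simp

lemma map_redY {S' : Type} [Ring S'] (ψ : S →+* S') (a : ℕ → S) (p s r : ℕ) :
    ψ (redY a p s r) = redY (fun t => ψ (a t)) p s r := by
  unfold redY
  split_ifs <;> simp

/-- Matrix form of T x = e_c P: the column T x factors through the unit column e_c, and the other
columns of T are unchanged. -/
lemma redPencil_mul_lastCol {p N : ℕ} (a : ℕ → S) (hm : m = p + 2 * N + 1) (ℓ : S)
    (hℓ : ∀ x, Commute ℓ x) (c : Fin m) (hc : (c : ℕ) + 1 = m) :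
    redPencil m a p ℓ 1 * (1 : Matrix (Fin m) (Fin m) S).updateCol c
        (fun r => lastCol a p N ℓ r) =
      (redPencil m a p ℓ 1).updateCol c (Pi.single c 1) *
        Matrix.diagonal (Function.update 1 c (horner a ℓ m)) := by
  rw [mul_one_updateCol, updateCol_mul_diagonal]
  congr 1
  funext s
  rw [redPencil_mulVec, one_mul, redPencil_lastCol a hm ℓ hℓ s.2]
  by_cases h : s = c
  · subst h; rw [if_pos hc, Pi.single_eq_same]
  · rw [if_neg (fun h' => h (Fin.ext (by omega))), Pi.single_eq_of_ne h]

lemma lastCol_last {p N : ℕ} (a : ℕ → S) (hm : m = p + 2 * N + 1) (ℓ : S) {c : ℕ}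
    (hc : c + 1 = m) : lastCol a p N ℓ c = 1 := by
  unfold lastCol
  split_ifs with h1 h2
  · rw [show p - c + N = 0 by omega, pow_zero]
  · rw [show N - (c - p) / 2 = 0 by omega, pow_zero]
  · omega

lemma redPencil_mul_firstCol {N : ℕ} (a : ℕ → S) (hm : m = 2 * N + 1) (μ : S)
    (hμ : ∀ x, Commute μ x) (c : Fin m) (hc : (c : ℕ) = 0) :
    redPencil m a 0 1 μ * (1 : Matrix (Fin m) (Fin m) S).updateCol c
        (fun r => firstCol a m μ r) =
      (redPencil m a 0 1 μ).updateCol c (Pi.single c 1) *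
        Matrix.diagonal (Function.update 1 c (tail a m μ 0)) := by
  rw [mul_one_updateCol, updateCol_mul_diagonal]
  congr 1
  funext s
  rw [redPencil_mulVec, one_mul, redPencil_firstCol a hm μ hμ s.2]
  by_cases h : s = c
  · subst h; rw [if_pos hc, Pi.single_eq_same]
  · rw [if_neg (fun h' => h (Fin.ext (by omega))), Pi.single_eq_of_ne h]

end GeneralBlockMatrices

/-! ### Passage between block and flat matrices -/

section Flat

variable {m n : ℕ}

/-- The kernel computations run over vectors of n × n blocks. A flat kernel vector becomes one of
these by using it as every column of the blocks. -/
lemma det_comp_ne_zero {K : Type} [Field K] (M : Matrix (Fin m) (Fin m) (Matrix (Fin n) (Fin n) K))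
    (hM : ∀ W, M *ᵥ W = 0 → W = 0) : (compRingEquiv (Fin m) (Fin n) K M).det ≠ 0 := by
  intro h
  obtain ⟨v, hv0, hv⟩ := Matrix.exists_mulVec_eq_zero_iff.2 h
  refine hv0 ?_
  have := hM (fun s => Matrix.of fun x _ => v (s, x)) ?_
  · funext ⟨s, x⟩
    have h1 := congrFun (congrFun (congrFun this s) x) x
    simpa using h1
  · funext s
    ext x y
    have h1 := congrFun hv (s, x)
    simp only [Matrix.mulVec, dotProduct, compRingEquiv_apply, comp_apply,
      Fintype.sum_prod_type, Pi.zero_apply] at h1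
    simp only [Matrix.mulVec, dotProduct, Matrix.sum_apply, Matrix.mul_apply, of_apply,
      Pi.zero_apply, Matrix.zero_apply]
    exact h1

variable {R : Type} [CommRing R] {r : ℕ}

lemma comp_mul_blockCol (N : Matrix (Fin m) (Fin m) (Matrix (Fin n) (Fin n) R)) {c k : Fin m}
    (h : ∀ s, N s c = if s = k then 1 else 0) (C : Matrix (Fin n) (Fin r) R) {c' k' : ℤ}
    (hc : c' = (c : ℕ) + 1) (hk : k' = (k : ℕ) + 1) :
    compRingEquiv (Fin m) (Fin n) R N * blockCol m c' C = blockCol m k' C := by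
  subst hc hk
  ext ⟨s, x⟩ y
  simp only [Matrix.mul_apply, Fintype.sum_prod_type, compRingEquiv_apply, comp_apply, blockCol,
    of_apply]
  rw [Finset.sum_eq_single c]
  · by_cases hs : s = k
    · simp [h, hs, Matrix.one_apply]
    · have : (s : ℕ) ≠ k := fun h' => hs (Fin.ext h')
      simp [h, hs, this]
  · intro b _ hb
    have : (b : ℕ) ≠ c := fun h' => hb (Fin.ext h')
    simp [this]
  · simp

lemma blockRow_mul_comp (N : Matrix (Fin m) (Fin m) (Matrix (Fin n) (Fin n) R)) {c k : Fin m}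
    (h : ∀ s, N c s = if s = k then 1 else 0) (B : Matrix (Fin r) (Fin n) R) {c' k' : ℤ}
    (hc : c' = (c : ℕ) + 1) (hk : k' = (k : ℕ) + 1) :
    blockRow m c' B * compRingEquiv (Fin m) (Fin n) R N = blockRow m k' B := by
  subst hc hk
  ext y ⟨s, x⟩
  simp only [Matrix.mul_apply, Fintype.sum_prod_type, compRingEquiv_apply, comp_apply, blockRow,
    of_apply]
  rw [Finset.sum_eq_single c]
  · by_cases hs : s = k
    · simp [h, hs, Matrix.one_apply]
    · have : (s : ℕ) ≠ k := fun h' => hs (Fin.ext h')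
      simp [h, hs, this]
  · intro b _ hb
    have : (b : ℕ) ≠ c := fun h' => hb (Fin.ext h')
    simp [this]
  · simp

lemma idOplus_eq {c : Fin m} (hc : (c : ℕ) + 1 = m) (P : Matrix (Fin n) (Fin n) R) :
    idOplus m P = compRingEquiv (Fin m) (Fin n) R (Matrix.diagonal (Function.update 1 c P)) := by
  ext ⟨s, x⟩ ⟨t, y⟩
  simp only [idOplus, of_apply, compRingEquiv_apply, comp_apply, Matrix.diagonal_apply]
  by_cases hst : s = t
  · subst hst
    by_cases hs : s = c
    · subst hs; simp [hc]
    · have : (s : ℕ) + 1 ≠ m := fun h => hs (Fin.ext (by omega))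
      simp [hs, this]
  · simp [hst]

end Flat

/-! ### Polynomial pencils -/

section Pencils

variable {ι κ τ : Type}

lemma constPoly_mul [Fintype κ] (M : Matrix ι κ ℂ) (N : Matrix κ τ ℂ) :
    constPoly (M * N) = constPoly M * constPoly N := by
  simp [constPoly, Matrix.map_mul]

lemma constPoly_one [DecidableEq ι] : constPoly (1 : Matrix ι ι ℂ) = 1 := by
  simp [constPoly]

lemma constPoly_neg (M : Matrix ι κ ℂ) : constPoly (-M) = -constPoly M := by
  ext; simp [constPoly]

lemma constPoly_add (M N : Matrix ι κ ℂ) : constPoly (M + N) = constPoly M + constPoly N := by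
  ext; simp [constPoly]

lemma constPoly_injective : Function.Injective (constPoly : Matrix ι κ ℂ → _) :=
  Matrix.map_injective Polynomial.C_injective

lemma constPoly_mul_pencil [Fintype κ] (M : Matrix ι κ ℂ) (Y Z : Matrix κ τ ℂ) :
    constPoly M * pencil Y Z = pencil (M * Y) (M * Z) := by
  simp only [pencil, Matrix.mul_add, Matrix.mul_smul, constPoly_mul]

lemma pencil_mul_constPoly [Fintype κ] (M : Matrix κ τ ℂ) (Y Z : Matrix ι κ ℂ) :
    pencil Y Z * constPoly M = pencil (Y * M) (Z * M) := by
  simp only [pencil, Matrix.add_mul, Matrix.smul_mul, constPoly_mul]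

lemma pencil_inj {Y Z Y' Z' : Matrix ι κ ℂ} : pencil Y Z = pencil Y' Z' ↔ Y = Y' ∧ Z = Z' := by
  constructor
  · intro h
    have hc : ∀ i j (d : ℕ), (pencil Y Z i j).coeff d = (pencil Y' Z' i j).coeff d := by simp [h]
    refine ⟨Matrix.ext fun i j => ?_, Matrix.ext fun i j => ?_⟩
    · have h1 : ∀ c d : ℂ, (X * Polynomial.C c + Polynomial.C d).coeff 1 = c := fun c d => by
        rw [Polynomial.coeff_add, mul_comm, Polynomial.coeff_C_mul, Polynomial.coeff_X_one,
          Polynomial.coeff_C_succ, mul_one, add_zero]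
      have h2 := hc i j 1
      simp only [pencil, constPoly, Matrix.add_apply, Matrix.smul_apply, Matrix.map_apply,
        smul_eq_mul, h1] at h2
      exact h2
    · simpa [pencil, constPoly] using hc i j 0
  · rintro ⟨rfl, rfl⟩; rfl

lemma isTOddPoly_pencil {Y Z : Matrix ι ι ℂ} :
    IsTOddPoly (pencil Y Z) ↔ Yᵀ = Y ∧ Zᵀ = -Z := by
  have h1 : (pencil Y Z)ᵀ.map (fun f => f.comp (-X)) = pencil (-Yᵀ) Zᵀ := by
    ext1 i j
    simp [pencil, constPoly]
  have h2 : -pencil Y Z = pencil (-Y) (-Z) := by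
    ext1 i j
    simp [pencil, constPoly]
    ring
  rw [IsTOddPoly, h1, h2, pencil_inj, neg_inj]

lemma isUnimodular_of_isUnit [Fintype ι] [DecidableEq ι] {U : Matrix ι ι ℂ[X]} (h : IsUnit U) :
    IsUnimodular U := by
  rw [Matrix.isUnit_iff_isUnit_det, Polynomial.isUnit_iff] at h
  obtain ⟨c, hc, h⟩ := h
  exact ⟨c, hc.ne_zero, h.symm⟩

/-- Over ℂ a polynomial without roots is a nonzero constant, so unimodularity can be tested one
point at a time by a kernel computation. -/
lemma isUnit_of_eval_det_ne_zero [Fintype ι] [DecidableEq ι] {U : Matrix ι ι ℂ[X]}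
    (h : ∀ z : ℂ, (U.map (Polynomial.eval z)).det ≠ 0) : IsUnit U := by
  rw [Matrix.isUnit_iff_isUnit_det]
  by_contra hu
  have hdeg : U.det.degree ≠ 0 := fun hd => hu (Polynomial.isUnit_iff_degree_eq_zero.2 hd)
  obtain ⟨z, hz⟩ := IsAlgClosed.exists_root _ hdeg
  refine h z ?_
  have := RingHom.map_det (Polynomial.evalRingHom z) U
  rw [Polynomial.coe_evalRingHom, hz.eq_zero] at this
  exact this.symm

end Pencils

/-! ### Unimodular reduction of the reduced pencil -/

section Reduction

variable {m n p N : ℕ}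

lemma map_redPencil {S S' : Type} [Ring S] [Ring S'] (ψ : S →+* S') (a : ℕ → S) (α β : S) :
    (redPencil m a p α β).map ψ = redPencil m (fun t => ψ (a t)) p (ψ α) (ψ β) := by
  ext1 s r
  simp [redPencil, map_redX, map_redY]

lemma map_updateCol_single {S S' : Type} [Ring S] [Ring S'] (ψ : S →+* S')
    (T : Matrix (Fin m) (Fin m) S) (c : Fin m) :
    (T.updateCol c (Pi.single c 1)).map ψ = (T.map ψ).updateCol c (Pi.single c 1) := by
  ext1 s r
  by_cases h : r = c
  · subst h
    by_cases hs : s = r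
    · subst hs; simp
    · simp [hs]
  · simp [h]

lemma comp_map_ringHom {R R' : Type} [Ring R] [Ring R'] (f : R →+* R')
    (M : Matrix (Fin m) (Fin m) (Matrix (Fin n) (Fin n) R)) :
    (compRingEquiv (Fin m) (Fin n) R M).map f =
      compRingEquiv (Fin m) (Fin n) R' (M.map f.mapMatrix) := rfl

lemma commute_scalar {R : Type} [CommRing R] (x : R) (M : Matrix (Fin n) (Fin n) R) :
    Commute (Matrix.scalar (Fin n) x) M :=
  Matrix.scalar_commute x (fun _ => Commute.all _ _) M

lemma mul_eq_zero_of_det_ne_zero {K : Type} [Field K] {M : Matrix (Fin n) (Fin n) K}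
    (h : M.det ≠ 0) (x : Matrix (Fin n) (Fin n) K) (hx : M * x = 0) : x = 0 := by
  have hu : IsUnit M := (Matrix.isUnit_iff_isUnit_det M).2 h.isUnit
  exact hu.mul_left_cancel (hx.trans (mul_zero M).symm)

variable (Ac : ℕ → Matrix (Fin n) (Fin n) ℂ)

lemma comp_redPencil_eq_pencil :
    compRingEquiv (Fin m) (Fin n) ℂ[X] (redPencil m (fun t => constPoly (revCoeff m Ac t)) p
      (Matrix.scalar (Fin n) X) 1) =
    pencil (compRingEquiv (Fin m) (Fin n) ℂ (blk m (redX (revCoeff m Ac) p)))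
      (-compRingEquiv (Fin m) (Fin n) ℂ (blk m (redY (revCoeff m Ac) p))) := by
  let φ : Matrix (Fin n) (Fin n) ℂ →+* Matrix (Fin n) (Fin n) ℂ[X] := Polynomial.C.mapMatrix
  have hX : ∀ s r, redX (fun t => constPoly (revCoeff m Ac t)) p s r =
      constPoly (redX (revCoeff m Ac) p s r) :=
    fun s r => (map_redX φ (revCoeff m Ac) p s r).symm
  have hY : ∀ s r, redY (fun t => constPoly (revCoeff m Ac t)) p s r =
      constPoly (redY (revCoeff m Ac) p s r) :=
    fun s r => (map_redY φ (revCoeff m Ac) p s r).symm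
  ext1 ⟨s, x⟩ ⟨r, y⟩
  simp only [compRingEquiv_apply, comp_apply, redPencil, blk_apply, hX, hY, pencil, one_mul,
    Matrix.add_apply, Matrix.sub_apply, Matrix.smul_apply]
  simp [constPoly, sub_eq_add_neg]

lemma horner_eq_matPoly :
    horner (fun t => constPoly (revCoeff m Ac t)) (Matrix.scalar (Fin n) (X : ℂ[X])) m =
      matPoly m Ac := by
  rw [horner, matPoly, ← Finset.sum_range_reflect]
  refine Finset.sum_congr rfl fun u hu => ?_
  rw [Finset.mem_range] at hu
  rw [revCoeff, ← map_pow, show m - (m + 1 - 1 - u) = u by omega]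
  ext1 x y
  simp [Matrix.scalar_apply, Matrix.diagonal_mul]

/-- The reduced pencil is unimodularly equivalent to `diag(I, P(λ))`, by transformations that
preserve the last block row and column. -/
lemma exists_reduction (hm : m = p + 2 * N + 1) (ha : p ≠ 0 → (Ac m).det ≠ 0) :
    ∃ M V : Matrix (Fin m × Fin n) (Fin m × Fin n) ℂ[X], IsUnit M ∧ IsUnit V ∧
      pencil (compRingEquiv (Fin m) (Fin n) ℂ (blk m (redX (revCoeff m Ac) p)))
        (-compRingEquiv (Fin m) (Fin n) ℂ (blk m (redY (revCoeff m Ac) p))) * V =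
        M * idOplus m (matPoly m Ac) ∧
      (∀ (r : ℕ) (C : Matrix (Fin n) (Fin r) ℂ[X]), M * blockCol m m C = blockCol m m C) ∧
      (∀ (r : ℕ) (B : Matrix (Fin r) (Fin n) ℂ[X]), blockRow m m B * V = blockRow m m B) := by
  obtain ⟨c, hc⟩ : ∃ c : Fin m, (c : ℕ) + 1 = m := ⟨⟨m - 1, by omega⟩, by simp; omega⟩
  have hc' : (m : ℤ) = (c : ℕ) + 1 := by omega
  set aP : ℕ → Matrix (Fin n) (Fin n) ℂ[X] := fun t => constPoly (revCoeff m Ac t) with haP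
  set ℓ : Matrix (Fin n) (Fin n) ℂ[X] := Matrix.scalar (Fin n) X with hℓ
  -- The left matrix has last column e_m and the right one has last row e_mᵀ; hence they fix the
  -- block column and block row of the system matrix.
  refine ⟨compRingEquiv (Fin m) (Fin n) ℂ[X]
      ((redPencil m aP p ℓ 1).updateCol c (Pi.single c 1)),
    compRingEquiv (Fin m) (Fin n) ℂ[X] ((1 : Matrix (Fin m) (Fin m) _).updateCol c
      (fun r => lastCol aP p N ℓ r)), ?_, ?_, ?_, ?_, ?_⟩
  · refine isUnit_of_eval_det_ne_zero fun z => ?_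
    have h1 := comp_map_ringHom (Polynomial.evalRingHom z)
      ((redPencil m aP p ℓ 1).updateCol c (Pi.single c 1))
    rw [Polynomial.coe_evalRingHom] at h1
    rw [h1, map_updateCol_single, map_redPencil, map_one]
    have h2 : (Polynomial.evalRingHom z).mapMatrix ℓ = Matrix.scalar (Fin n) z := by
      ext x y
      by_cases hxy : x = y <;> simp [hℓ, Matrix.scalar_apply, hxy]
    have h3 : (fun t => (Polynomial.evalRingHom z).mapMatrix (aP t)) = revCoeff m Ac := by
      funext t
      ext x y
      simp [haP, constPoly]
    rw [h2, h3]
    refine det_comp_ne_zero _ fun W hW =>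
      redPencil_updateCol_kernel (revCoeff m Ac) hm (Matrix.scalar (Fin n) z) (commute_scalar z)
        (fun hp => mul_eq_zero_of_det_ne_zero ?_) c hc W hW
    exact ha hp
  · exact (isUnit_one_updateCol c _ (lastCol_last aP hm ℓ hc)).map (compRingEquiv (Fin m) (Fin n) _)
  · rw [← comp_redPencil_eq_pencil, ← map_mul,
      redPencil_mul_lastCol aP hm ℓ (commute_scalar X) c hc, horner_eq_matPoly, map_mul,
      idOplus_eq hc]
  · intro r C
    refine comp_mul_blockCol _ (fun s => ?_) C hc' hc'
    rw [Matrix.updateCol_self, Pi.single_apply]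
  · intro r B
    refine blockRow_mul_comp _ (fun s => ?_) B hc' hc'
    by_cases hs : s = c
    · subst hs
      rw [Matrix.updateCol_self, lastCol_last aP hm ℓ hc, if_pos rfl]
    · rw [Matrix.updateCol_ne hs, Matrix.one_apply, if_neg (Ne.symm hs), if_neg hs]

end Reduction

/-! ### T-oddness and uniqueness of the quasi-identity matrix -/

section FlatSigns

variable {m n p Z H N g : ℕ}

lemma quasiIdentity_mul_comp (ε : Fin m → ℤˣ)
    (M : Matrix (Fin m) (Fin m) (Matrix (Fin n) (Fin n) ℂ)) (s r : Fin m) (x y : Fin n) :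
    (quasiIdentity n ε * compRingEquiv (Fin m) (Fin n) ℂ M) (s, x) (r, y) =
      (ε s • M s r) x y := by
  rw [quasiIdentity, Matrix.diagonal_mul]
  simp [Units.smul_def]

lemma quasiIdentity_mul_comp_eq (ε ε' : Fin m → ℤˣ)
    (M : Matrix (Fin m) (Fin m) (Matrix (Fin n) (Fin n) ℂ))
    (h : ∀ s r, ε s • M s r = ε' r • (M r s)ᵀ) :
    quasiIdentity n ε * compRingEquiv (Fin m) (Fin n) ℂ M =
      (compRingEquiv (Fin m) (Fin n) ℂ M)ᵀ * quasiIdentity n ε' := by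
  ext ⟨s, x⟩ ⟨r, y⟩
  rw [quasiIdentity_mul_comp, h, quasiIdentity, Matrix.mul_diagonal]
  simp [Units.smul_def, mul_comm]

lemma quasiIdentity_transpose (ε : Fin m → ℤˣ) : (quasiIdentity n ε)ᵀ = quasiIdentity n ε :=
  Matrix.diagonal_transpose _

lemma quasiIdentity_mul_self (ε : Fin m → ℤˣ) : quasiIdentity n ε * quasiIdentity n ε = 1 := by
  rw [quasiIdentity, Matrix.diagonal_mul_diagonal, ← Matrix.diagonal_one]
  congr 1
  funext a
  rw [← Int.cast_mul, ← Units.val_mul, Int.units_mul_self]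
  simp

lemma quasiIdentity_neg (ε : Fin m → ℤˣ) :
    quasiIdentity n (fun s => -ε s) = -quasiIdentity n ε := by
  rw [quasiIdentity, quasiIdentity, Matrix.diagonal_neg]
  congr 1
  funext a
  simp

lemma smul_quasiIdentity (δ : ℤˣ) (ε : Fin m → ℤˣ) :
    (((δ : ℤˣ) : ℤ) : ℂ) • quasiIdentity n ε = quasiIdentity n (fun s => δ * ε s) := by
  rw [quasiIdentity, quasiIdentity, ← Matrix.diagonal_smul]
  congr 1
  funext a
  simp

variable {a : ℕ → Matrix (Fin n) (Fin n) ℂ}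

/-- The pencil `φ(O X' O) λ - φ(O Y' O)` is `T`-odd after multiplication by the signs. -/
lemma isTOdd_outer (hm : m = g + 1 + 2 * H) (hg : g = p + 2 * Z)
    (ha : ∀ t ≤ m, (a t)ᵀ = (-1 : ℤˣ) ^ (m + t + 1) • a t) :
    IsTOddPoly (constPoly (quasiIdentity n fun s : Fin m => signOuter p g s) *
      pencil (compRingEquiv (Fin m) (Fin n) ℂ
          (outer m a p Z g H * blk m (redX a p) * outer m a p Z g H))
        (-compRingEquiv (Fin m) (Fin n) ℂ
          (outer m a p Z g H * blk m (redY a p) * outer m a p Z g H))) := by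
  have hm' : m = p + 2 * (Z + H) + 1 := by omega
  have hO := quasiIdentity_mul_comp_eq (fun s : Fin m => signOuter p g s)
    (fun s : Fin m => signRed p s) (outer m a p Z g H) fun s r => by
      rw [outer_eq a hm hg]
      exact outerFun_signs hm hg ha s.2 r.2
  have hX := quasiIdentity_mul_comp_eq (fun s : Fin m => signRed p s)
    (fun s : Fin m => signRed p s) (blk m (redX a p)) fun s r => redX_signs hm' ha s.2 r.2
  have hY := quasiIdentity_mul_comp_eq (fun s : Fin m => signRed p s)
    (fun s : Fin m => -signRed p s) (blk m (redY a p)) fun s r => redY_signs hm' ha s.2 r.2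
  rw [quasiIdentity_neg] at hY
  rw [constPoly_mul_pencil, isTOddPoly_pencil, map_mul, map_mul, map_mul, map_mul]
  generalize compRingEquiv (Fin m) (Fin n) ℂ (outer m a p Z g H) = O at *
  generalize compRingEquiv (Fin m) (Fin n) ℂ (blk m (redX a p)) = X' at *
  generalize compRingEquiv (Fin m) (Fin n) ℂ (blk m (redY a p)) = Y' at *
  have hX' := congrArg Matrix.transpose hX
  have hY' := congrArg Matrix.transpose hY
  simp only [transpose_mul, transpose_transpose, transpose_neg, quasiIdentity_transpose] at hX' hY'
  -- Q O X' O = Oᵀ(DX')O is a congruence of a symmetric matrix; in the constant coefficient DY' is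
  -- skew.
  constructor
  · rw [← mul_assoc, ← mul_assoc, hO]
    simp only [transpose_mul, transpose_transpose, quasiIdentity_transpose, mul_assoc]
    rw [← mul_assoc X'ᵀ, hX', mul_assoc]
  · rw [mul_neg, transpose_neg, neg_neg, ← mul_assoc, ← mul_assoc, hO]
    simp only [transpose_mul, transpose_transpose, quasiIdentity_transpose, mul_assoc]
    rw [← mul_assoc Y'ᵀ, hY']
    simp only [neg_mul, mul_neg, neg_neg, mul_assoc]

lemma quasiIdentity_mul_eq_comp (ε ε' : Fin m → ℤˣ) (δ : ℕ → ℤ)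
    (hδ : ∀ s : Fin m, δ s = ε s * ε' s) :
    quasiIdentity n ε * quasiIdentity n ε' = compRingEquiv (Fin m) (Fin n) ℂ (intDiag m δ) := by
  ext ⟨s, x⟩ ⟨r, y⟩
  rw [quasiIdentity, quasiIdentity, Matrix.diagonal_mul_diagonal, Matrix.diagonal_apply,
    compRingEquiv_apply, comp_apply, intDiag, Matrix.diagonal_apply]
  by_cases hs : s = r
  · subst hs
    rw [if_pos rfl, hδ]
    by_cases hxy : x = y
    · subst hxy
      simp [Matrix.intCast_apply]
    · simp [hxy, Matrix.intCast_apply]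
  · simp [hs]

/-- Two quasi-identity matrices that make the pencil `T`-odd agree up to sign. -/
lemma quasiIdentity_unique (hm : m = g + 1 + 2 * H) (hg : g = p + 2 * Z) (h0 : a 0 ≠ 0)
    {ε ε' : Fin m → ℤˣ}
    (h : ∀ e : Fin m → ℤˣ, e = ε ∨ e = ε' → IsTOddPoly (constPoly (quasiIdentity n e) *
      pencil (compRingEquiv (Fin m) (Fin n) ℂ
          (outer m a p Z g H * blk m (redX a p) * outer m a p Z g H))
        (-compRingEquiv (Fin m) (Fin n) ℂ
          (outer m a p Z g H * blk m (redY a p) * outer m a p Z g H)))) :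
    ∃ δ : ℤˣ, ∀ s, ε' s = δ * ε s := by
  set δ : ℕ → ℤ := fun t => if ht : t < m then (ε' ⟨t, ht⟩ * ε ⟨t, ht⟩ : ℤˣ) else 1 with hδ
  have hδ' : ∀ s : Fin m, δ s = ε' s * ε s := fun s => by simp [hδ]
  have hD := quasiIdentity_mul_eq_comp (n := n) ε' ε δ hδ'
  -- If QM and Q'M are both symmetric (σ = 1) or both skew (σ = -1), then QMQ = σMᵀ = Q'MQ', so Q'Q
  -- commutes with M.
  have comm : ∀ W : Matrix (Fin m) (Fin m) (Matrix (Fin n) (Fin n) ℂ),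
      (∀ σ : ℂ, σ * σ = 1 → (∀ e : Fin m → ℤˣ, e = ε ∨ e = ε' →
        (quasiIdentity n e * compRingEquiv (Fin m) (Fin n) ℂ W)ᵀ =
          σ • (quasiIdentity n e * compRingEquiv (Fin m) (Fin n) ℂ W)) →
      Commute (intDiag m δ) W) := by
    intro W σ hσ hW
    have h1 := hW ε (Or.inl rfl)
    have h2 := hW ε' (Or.inr rfl)
    rw [transpose_mul, quasiIdentity_transpose] at h1 h2
    refine (compRingEquiv (Fin m) (Fin n) ℂ).injective ?_
    rw [map_mul, map_mul, ← hD]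
    generalize compRingEquiv (Fin m) (Fin n) ℂ W = w at *
    have h3 : quasiIdentity n ε * w = σ • (wᵀ * quasiIdentity n ε) := by
      rw [h1, smul_smul, hσ, one_smul]
    have h4 : wᵀ = σ • (quasiIdentity n ε' * w * quasiIdentity n ε') := by
      rw [← smul_mul_assoc, ← h2, mul_assoc, quasiIdentity_mul_self, mul_one]
    rw [mul_assoc, h3, h4, smul_mul_assoc, smul_smul, hσ, one_smul, mul_assoc, mul_assoc,
      ← mul_assoc, quasiIdentity_mul_self, one_mul]
  have hX := comm _ 1 (by norm_num) fun e he => by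
    have := h e he
    rw [constPoly_mul_pencil, isTOddPoly_pencil] at this
    rw [this.1, one_smul]
  have hY := comm _ (-1) (by norm_num) fun e he => by
    have := h e he
    rw [constPoly_mul_pencil, isTOddPoly_pencil, mul_neg, transpose_neg, neg_neg, neg_eq_iff_eq_neg]
      at this
    rw [this.2, neg_one_smul]
  have hS : ∀ (k : ℤ) (x : Matrix (Fin n) (Fin n) ℂ), (k : Matrix (Fin n) (Fin n) ℂ) * x = 0 →
      k = 0 ∨ x = 0 := by
    intro k x hx
    rw [← zsmul_eq_mul] at hx
    by_contra hne
    push Not at hne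
    refine hne.2 (Matrix.ext fun i j => ?_)
    have h1 := congrFun (congrFun hx i) j
    simpa [hne.1] using h1
  have hconst := fun s hs => intDiag_const a hS h0 hm hg hX hY (s := s) hs
  refine ⟨ε' ⟨0, by omega⟩ * ε ⟨0, by omega⟩, fun s => ?_⟩
  have h1 := hconst s s.2
  rw [hδ', show (0 : ℕ) = ((⟨0, by omega⟩ : Fin m) : ℕ) from rfl, hδ', ← Units.val_mul,
    ← Units.val_mul, Units.val_inj] at h1
  rw [← h1, mul_assoc, Int.units_mul_self, mul_one]

end FlatSigns

/-! ### Limits of rational matrices at infinity -/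

section LimitsAtInfinity

/-- The rational function `f` tends to `c` at infinity. -/
def TendsInf (f : RatFunc ℂ) (c : ℂ) : Prop :=
  Filter.Tendsto (fun x : ℂ => RatFunc.eval (RingHom.id ℂ) x f) (Bornology.cobounded ℂ) (nhds c)

/-- `RatFunc.eval` respects sums and products away from the poles; these are finitely many, so they
do not matter for limits at infinity. -/
lemma eventually_denom_ne_zero (f : RatFunc ℂ) :
    ∀ᶠ x in Bornology.cobounded ℂ, Polynomial.eval₂ (RingHom.id ℂ) x f.denom ≠ 0 := by
  have hfin : {x : ℂ | f.denom.IsRoot x}.Finite :=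
    Polynomial.finite_setOfPred_isRoot (RatFunc.denom_ne_zero f)
  exact Bornology.isBounded_def.1 hfin.isBounded

lemma TendsInf.add {f g : RatFunc ℂ} {c d : ℂ} (hf : TendsInf f c) (hg : TendsInf g d) :
    TendsInf (f + g) (c + d) := by
  refine (Filter.Tendsto.add hf hg).congr' ?_
  filter_upwards [eventually_denom_ne_zero f, eventually_denom_ne_zero g] with x h1 h2
  exact (RatFunc.eval_add _ _ h1 h2).symm

lemma TendsInf.mul {f g : RatFunc ℂ} {c d : ℂ} (hf : TendsInf f c) (hg : TendsInf g d) :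
    TendsInf (f * g) (c * d) := by
  refine (Filter.Tendsto.mul hf hg).congr' ?_
  filter_upwards [eventually_denom_ne_zero f, eventually_denom_ne_zero g] with x h1 h2
  exact (RatFunc.eval_mul _ _ h1 h2).symm

lemma tendsInf_C (c : ℂ) : TendsInf (RatFunc.C c) c := by
  simp [TendsInf, RatFunc.eval_C]

lemma tendsInf_zero : TendsInf 0 0 := by simpa using tendsInf_C 0

lemma tendsInf_one : TendsInf 1 1 := by simpa using tendsInf_C 1

lemma TendsInf.neg {f : RatFunc ℂ} {c : ℂ} (hf : TendsInf f c) : TendsInf (-f) (-c) := by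
  simpa using (tendsInf_C (-1)).mul hf

lemma TendsInf.sum {ι : Type} {s : Finset ι} {f : ι → RatFunc ℂ} {c : ι → ℂ}
    (h : ∀ i ∈ s, TendsInf (f i) (c i)) : TendsInf (∑ i ∈ s, f i) (∑ i ∈ s, c i) := by
  classical
  induction s using Finset.induction_on with
  | empty => simpa using tendsInf_zero
  | insert i s hi ih =>
    rw [Finset.sum_insert hi, Finset.sum_insert hi]
    exact (h i (by simp)).add (ih fun j hj => h j (by simp [hj]))

lemma TendsInf.prod {ι : Type} {s : Finset ι} {f : ι → RatFunc ℂ} {c : ι → ℂ}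
    (h : ∀ i ∈ s, TendsInf (f i) (c i)) : TendsInf (∏ i ∈ s, f i) (∏ i ∈ s, c i) := by
  classical
  induction s using Finset.induction_on with
  | empty => simpa using tendsInf_one
  | insert i s hi ih =>
    rw [Finset.prod_insert hi, Finset.prod_insert hi]
    exact (h i (by simp)).mul (ih fun j hj => h j (by simp [hj]))

lemma eval_inv_eventually {f : RatFunc ℂ} (hf : f ≠ 0) :
    ∀ᶠ x in Bornology.cobounded ℂ, (RatFunc.eval (RingHom.id ℂ) x f)⁻¹ =
      RatFunc.eval (RingHom.id ℂ) x f⁻¹ := by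
  filter_upwards [eventually_denom_ne_zero f, eventually_denom_ne_zero f⁻¹] with x h1 h2
  have := RatFunc.eval_mul _ _ h1 h2
  rw [mul_inv_cancel₀ hf, RatFunc.eval_one] at this
  exact (eq_inv_of_mul_eq_one_right this.symm).symm

lemma TendsInf.ne_zero {f : RatFunc ℂ} {c : ℂ} (hf : TendsInf f c) (hc : c ≠ 0) : f ≠ 0 := by
  rintro rfl
  exact hc (tendsto_nhds_unique hf tendsInf_zero)

lemma TendsInf.inv {f : RatFunc ℂ} {c : ℂ} (hf : TendsInf f c) (hc : c ≠ 0) :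
    TendsInf f⁻¹ c⁻¹ :=
  (Filter.Tendsto.inv₀ hf hc).congr' (eval_inv_eventually (hf.ne_zero hc))

lemma tendsInf_X_inv : TendsInf (RatFunc.X : RatFunc ℂ)⁻¹ 0 := by
  refine (Filter.tendsto_inv₀_cobounded (α := ℂ)).congr' ?_
  have := eval_inv_eventually (RatFunc.X_ne_zero (K := ℂ))
  simp only [RatFunc.eval_X] at this
  exact this

variable {ι κ τ : Type}

/-- The rational matrix `F` tends to `D` at infinity. -/
def MatTendsInf (F : Matrix ι κ (RatFunc ℂ)) (D : Matrix ι κ ℂ) : Prop :=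
  ∀ i j, TendsInf (F i j) (D i j)

lemma MatTendsInf.add {F F' : Matrix ι κ (RatFunc ℂ)} {D D' : Matrix ι κ ℂ}
    (h : MatTendsInf F D) (h' : MatTendsInf F' D') : MatTendsInf (F + F') (D + D') :=
  fun i j => (h i j).add (h' i j)

lemma MatTendsInf.neg {F : Matrix ι κ (RatFunc ℂ)} {D : Matrix ι κ ℂ}
    (h : MatTendsInf F D) : MatTendsInf (-F) (-D) :=
  fun i j => (h i j).neg

lemma MatTendsInf.sub {F F' : Matrix ι κ (RatFunc ℂ)} {D D' : Matrix ι κ ℂ}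
    (h : MatTendsInf F D) (h' : MatTendsInf F' D') : MatTendsInf (F - F') (D - D') := by
  rw [sub_eq_add_neg, sub_eq_add_neg]
  exact h.add h'.neg

lemma MatTendsInf.mul [Fintype κ] {F : Matrix ι κ (RatFunc ℂ)} {F' : Matrix κ τ (RatFunc ℂ)}
    {D : Matrix ι κ ℂ} {D' : Matrix κ τ ℂ} (h : MatTendsInf F D) (h' : MatTendsInf F' D') :
    MatTendsInf (F * F') (D * D') := fun i j => by
  rw [Matrix.mul_apply, Matrix.mul_apply]
  exact TendsInf.sum fun k _ => (h i k).mul (h' k j)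

lemma matTendsInf_constRat (D : Matrix ι κ ℂ) : MatTendsInf (constRat D) D :=
  fun _ _ => tendsInf_C _

lemma matTendsInf_zero : MatTendsInf (0 : Matrix ι κ (RatFunc ℂ)) 0 := fun _ _ => tendsInf_zero

lemma matTendsInf_one [DecidableEq ι] : MatTendsInf (1 : Matrix ι ι (RatFunc ℂ)) 1 := fun i j => by
  by_cases h : i = j
  · subst h; simpa using tendsInf_one
  · simpa [h] using tendsInf_zero

lemma MatTendsInf.pow [Fintype ι] [DecidableEq ι] {F : Matrix ι ι (RatFunc ℂ)} {D : Matrix ι ι ℂ}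
    (h : MatTendsInf F D) (k : ℕ) : MatTendsInf (F ^ k) (D ^ k) := by
  induction k with
  | zero => simpa using matTendsInf_one
  | succ k ih => rw [pow_succ, pow_succ]; exact ih.mul h

lemma MatTendsInf.sum {σ : Type} {s : Finset σ} {F : σ → Matrix ι κ (RatFunc ℂ)}
    {D : σ → Matrix ι κ ℂ} (h : ∀ i ∈ s, MatTendsInf (F i) (D i)) :
    MatTendsInf (∑ i ∈ s, F i) (∑ i ∈ s, D i) := fun i j => by
  rw [Matrix.sum_apply, Matrix.sum_apply]
  exact TendsInf.sum fun k hk => h k hk i j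

lemma MatTendsInf.det [Fintype ι] [DecidableEq ι] {F : Matrix ι ι (RatFunc ℂ)} {D : Matrix ι ι ℂ}
    (h : MatTendsInf F D) : TendsInf F.det D.det := by
  rw [Matrix.det_apply', Matrix.det_apply']
  refine TendsInf.sum fun σ _ => TendsInf.mul ?_ (TendsInf.prod fun i _ => h _ _)
  have := tendsInf_C (((Equiv.Perm.sign σ : ℤˣ) : ℤ) : ℂ)
  rwa [map_intCast] at this

lemma MatTendsInf.inv [Fintype ι] [DecidableEq ι] {F : Matrix ι ι (RatFunc ℂ)} {D : Matrix ι ι ℂ}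
    (h : MatTendsInf F D) (hD : D.det ≠ 0) : MatTendsInf F⁻¹ D⁻¹ := by
  intro i j
  rw [Matrix.inv_def, Matrix.inv_def, Ring.inverse_eq_inv', Ring.inverse_eq_inv',
    Matrix.smul_apply, Matrix.smul_apply, smul_eq_mul, smul_eq_mul, Matrix.adjugate_apply,
    Matrix.adjugate_apply]
  refine (h.det.inv hD).mul (MatTendsInf.det fun k l => ?_)
  by_cases hk : k = j
  · subst hk
    rw [Matrix.updateRow_self, Matrix.updateRow_self]
    by_cases hl : l = i
    · subst hl; simpa using tendsInf_one
    · simpa [hl] using tendsInf_zero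
  · rw [Matrix.updateRow_ne hk, Matrix.updateRow_ne hk]
    exact h k l

lemma MatTendsInf.isBiproper [Fintype ι] [DecidableEq ι] {F : Matrix ι ι (RatFunc ℂ)}
    {D : Matrix ι ι ℂ} (h : MatTendsInf F D) (hD : D.det ≠ 0) : IsBiproper F := ⟨D, hD, h⟩

lemma IsBiproper.mul [Fintype ι] [DecidableEq ι] {F F' : Matrix ι ι (RatFunc ℂ)}
    (h : IsBiproper F) (h' : IsBiproper F') : IsBiproper (F * F') := by
  obtain ⟨D, hD, h⟩ := h
  obtain ⟨D', hD', h'⟩ := h'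
  refine ⟨D * D', ?_, MatTendsInf.mul h h'⟩
  rw [Matrix.det_mul]
  exact mul_ne_zero hD hD'

lemma IsBiproper.inv [Fintype ι] [DecidableEq ι] {F : Matrix ι ι (RatFunc ℂ)}
    (h : IsBiproper F) : IsBiproper F⁻¹ := by
  obtain ⟨D, hD, h⟩ := h
  refine ⟨D⁻¹, ?_, MatTendsInf.inv h hD⟩
  rw [Matrix.det_nonsing_inv, Ring.inverse_eq_inv']
  exact inv_ne_zero hD

lemma IsBiproper.isUnit_det [Fintype ι] [DecidableEq ι] {F : Matrix ι ι (RatFunc ℂ)}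
    (h : IsBiproper F) : IsUnit F.det := by
  obtain ⟨D, hD, h⟩ := h
  exact (TendsInf.ne_zero (MatTendsInf.det h) hD).isUnit

lemma isBiproper_constRat [Fintype ι] [DecidableEq ι] {D : Matrix ι ι ℂ} (h : IsUnit D) :
    IsBiproper (constRat D) :=
  (matTendsInf_constRat D).isBiproper ((Matrix.isUnit_iff_isUnit_det D).1 h).ne_zero

end LimitsAtInfinity

/-! ### Biproper reduction at infinity -/

section BlockLimits

variable {m n p N : ℕ} {aR : ℕ → Matrix (Fin n) (Fin n) (RatFunc ℂ)}
  {b : ℕ → Matrix (Fin n) (Fin n) ℂ}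

lemma MatTendsInf.ite {ι κ : Type} {P : Prop} [Decidable P] {F F' : Matrix ι κ (RatFunc ℂ)}
    {D D' : Matrix ι κ ℂ} (h : MatTendsInf F D) (h' : MatTendsInf F' D') :
    MatTendsInf (if P then F else F') (if P then D else D') := by
  by_cases hP : P
  · rwa [if_pos hP, if_pos hP]
  · rwa [if_neg hP, if_neg hP]

lemma matTendsInf_redX (h : ∀ t, MatTendsInf (aR t) (b t)) (p s r : ℕ) :
    MatTendsInf (redX aR p s r) (redX b p s r) := by
  unfold redX
  have h0 := matTendsInf_zero (ι := Fin n) (κ := Fin n)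
  have h1 := matTendsInf_one (ι := Fin n)
  exact .ite (.ite (h _) h0) (.ite h0 (.ite (.ite (h _) (.ite h1 h0)) (.ite h1 h0)))

lemma matTendsInf_redY (h : ∀ t, MatTendsInf (aR t) (b t)) (p s r : ℕ) :
    MatTendsInf (redY aR p s r) (redY b p s r) := by
  unfold redY
  have h0 := matTendsInf_zero (ι := Fin n) (κ := Fin n)
  have h1 := matTendsInf_one (ι := Fin n)
  exact .ite (.ite (h _) h0) (.ite h0 (.ite (.ite (h _).neg (.ite h1 h0)) (.ite h1 h0)))

lemma matTendsInf_tail (h : ∀ t, MatTendsInf (aR t) (b t))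
    {μ : Matrix (Fin n) (Fin n) (RatFunc ℂ)} {ν : Matrix (Fin n) (Fin n) ℂ} (hμ : MatTendsInf μ ν)
    (j : ℕ) : MatTendsInf (tail aR m μ j) (tail b m ν j) :=
  MatTendsInf.sum fun i _ => (hμ.pow i).mul (h _)

lemma matTendsInf_firstCol (h : ∀ t, MatTendsInf (aR t) (b t))
    {μ : Matrix (Fin n) (Fin n) (RatFunc ℂ)} {ν : Matrix (Fin n) (Fin n) ℂ} (hμ : MatTendsInf μ ν)
    (t : ℕ) : MatTendsInf (firstCol aR m μ t) (firstCol b m ν t) := by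
  unfold firstCol
  split_ifs
  · exact hμ.pow _
  · exact ((matTendsInf_tail h hμ _).mul (hμ.pow _)).neg

lemma matTendsInf_redPencil (h : ∀ t, MatTendsInf (aR t) (b t))
    {μ : Matrix (Fin n) (Fin n) (RatFunc ℂ)} (hμ : MatTendsInf μ 0) (s r : Fin m) :
    MatTendsInf (redPencil m aR p 1 μ s r) (redX b p s r) := by
  have := (matTendsInf_redX h p s r).sub (hμ.mul (matTendsInf_redY h p s r))
  rw [zero_mul, sub_zero] at this
  simpa [redPencil] using this

lemma MatTendsInf.comp {M : Matrix (Fin m) (Fin m) (Matrix (Fin n) (Fin n) (RatFunc ℂ))}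
    {D : Matrix (Fin m) (Fin m) (Matrix (Fin n) (Fin n) ℂ)}
    (h : ∀ s r, MatTendsInf (M s r) (D s r)) :
    MatTendsInf (compRingEquiv (Fin m) (Fin n) _ M) (compRingEquiv (Fin m) (Fin n) _ D) :=
  fun i j => h i.1 j.1 i.2 j.2

/-- The permutation matrix of a transposition. -/
def swapMat {S : Type} [Ring S] (c d : Fin m) : Matrix (Fin m) (Fin m) S :=
  Matrix.of fun s r => if s = Equiv.swap c d r then 1 else 0

lemma swapMat_mul_self {S : Type} [Ring S] (c d : Fin m) :
    (swapMat c d : Matrix (Fin m) (Fin m) S) * swapMat c d = 1 := by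
  ext s r
  simp [swapMat, Matrix.mul_apply, Matrix.one_apply]

lemma diagonal_mul_swapMat {S : Type} [Ring S] (c d : Fin m) (x : S) :
    Matrix.diagonal (Function.update 1 c x) * swapMat c d =
      swapMat c d * Matrix.diagonal (Function.update 1 d x) := by
  ext s r
  rw [Matrix.diagonal_mul, Matrix.mul_diagonal, swapMat, of_apply]
  split_ifs with h
  · subst h
    rw [mul_one, one_mul, Function.update_apply, Function.update_apply]
    congr 1
    rw [Equiv.swap_apply_eq_iff, Equiv.swap_apply_left]
  · simp

lemma isBiproper_swapMat (c d : Fin m) :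
    IsBiproper (compRingEquiv (Fin m) (Fin n) (RatFunc ℂ) (swapMat c d)) := by
  refine MatTendsInf.isBiproper (MatTendsInf.comp (D := swapMat c d) fun s r => ?_) ?_
  · simp only [swapMat, of_apply]
    split_ifs
    · exact matTendsInf_one
    · exact matTendsInf_zero
  · have : IsUnit (compRingEquiv (Fin m) (Fin n) ℂ (swapMat c d)) :=
      IsUnit.map _ ⟨⟨_, _, swapMat_mul_self c d, swapMat_mul_self c d⟩, rfl⟩
    exact ((Matrix.isUnit_iff_isUnit_det _).1 this).ne_zero

/-- The reduced pencil divided by `λ` is equivalent to `diag(I, λ⁻ᵐ G)` by biproper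
transformations. -/
lemma exists_biproper_reduction (hm : m = p + 2 * N + 1) (h : ∀ t, MatTendsInf (aR t) (b t))
    (hb : p = 0 ∨ (b 0).det ≠ 0) {μ : RatFunc ℂ} (hμ : TendsInf μ 0) :
    ∃ Ol Or : Matrix (Fin m × Fin n) (Fin m × Fin n) (RatFunc ℂ),
      IsBiproper Ol ∧ IsBiproper Or ∧
      Ol * compRingEquiv (Fin m) (Fin n) _ (redPencil m aR p 1 (Matrix.scalar (Fin n) μ)) * Or =
        idOplus m (tail aR m (Matrix.scalar (Fin n) μ) 0) := by
  have hμ' : MatTendsInf (Matrix.scalar (Fin n) μ) (0 : Matrix (Fin n) (Fin n) ℂ) := fun i j => by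
    by_cases hij : i = j
    · subst hij; simpa using hμ
    · simpa [hij] using tendsInf_zero
  obtain ⟨c, hc⟩ : ∃ c : Fin m, (c : ℕ) + 1 = m := ⟨⟨m - 1, by omega⟩, by simp; omega⟩
  obtain ⟨c₀, hc₀⟩ : ∃ c : Fin m, (c : ℕ) = 0 := ⟨⟨0, by omega⟩, rfl⟩
  rcases hb with rfl | hb
  -- After replacing the first column by e_1, the limit is X' with a_0 changed to 1, which is
  -- invertible even if a_0 is singular.
  · have hM : IsBiproper (compRingEquiv (Fin m) (Fin n) _
        ((redPencil m aR 0 1 (Matrix.scalar (Fin n) μ)).updateCol c₀ (Pi.single c₀ 1))) := by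
      refine MatTendsInf.isBiproper
        (MatTendsInf.comp (D := blk m (redX (Function.update b 0 1) 0)) fun s r => ?_)
        (det_comp_ne_zero _ fun W hW => redX_blk_kernel (Function.update b 0 1) hm (by simp) W hW)
      by_cases hr : r = c₀
      · subst hr
        rw [Matrix.updateCol_self, Pi.single_apply, blk_apply, redX, hc₀]
        by_cases hs : s = r
        · subst hs
          rw [if_pos rfl, hc₀]
          simpa using matTendsInf_one
        · have : (s : ℕ) ≠ 0 := fun h => hs (Fin.ext (by omega))
          rw [if_neg hs, if_neg (by omega), if_pos (by omega)]
          exact matTendsInf_zero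
      · have hr' : (r : ℕ) ≠ 0 := fun h => hr (Fin.ext (by omega))
        rw [Matrix.updateCol_ne hr]
        have h1 : redX (Function.update b 0 1) 0 s r = redX b 0 s r := by
          unfold redX
          split_ifs <;> first | omega | rfl | (rw [Function.update_of_ne (by omega)])
        rw [blk_apply, h1]
        exact matTendsInf_redPencil h hμ' s r
    have hV : IsBiproper (compRingEquiv (Fin m) (Fin n) _
        ((1 : Matrix (Fin m) (Fin m) _).updateCol c₀
          (fun r => firstCol aR m (Matrix.scalar (Fin n) μ) r))) := by
      refine MatTendsInf.isBiproper
        (MatTendsInf.comp (D := (1 : Matrix (Fin m) (Fin m) _).updateCol c₀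
          (fun r => firstCol b m 0 r)) fun s r => ?_) ?_
      · by_cases hr : r = c₀
        · subst hr
          rw [Matrix.updateCol_self, Matrix.updateCol_self]
          exact matTendsInf_firstCol h hμ' _
        · rw [Matrix.updateCol_ne hr, Matrix.updateCol_ne hr, Matrix.one_apply, Matrix.one_apply]
          split_ifs
          · exact matTendsInf_one
          · exact matTendsInf_zero
      · have hu : IsUnit (compRingEquiv (Fin m) (Fin n) _
            ((1 : Matrix (Fin m) (Fin m) _).updateCol c₀ (fun r => firstCol b m 0 r))) :=
          (isUnit_one_updateCol c₀ _ (by simp [firstCol, hc₀])).map _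
        exact ((Matrix.isUnit_iff_isUnit_det _).1 hu).ne_zero
    -- The reversed polynomial sits in the first diagonal block and has to be moved to the last one.
    have hP := isBiproper_swapMat (n := n) c₀ c
    refine ⟨_, _, hP.mul hM.inv, hV.mul hP, ?_⟩
    have key := congrArg (compRingEquiv (Fin m) (Fin n) (RatFunc ℂ)) (redPencil_mul_firstCol aR
      (show m = 2 * N + 1 by omega) (Matrix.scalar (Fin n) μ) (commute_scalar μ) c₀ hc₀)
    rw [map_mul, map_mul] at key
    rw [idOplus_eq hc, mul_assoc, mul_assoc, ← mul_assoc _ _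
      (compRingEquiv (Fin m) (Fin n) (RatFunc ℂ) (swapMat c₀ c)), key, mul_assoc,
      ← mul_assoc _⁻¹, Matrix.nonsing_inv_mul _ hM.isUnit_det, one_mul, ← map_mul, ← map_mul,
      diagonal_mul_swapMat, ← mul_assoc, swapMat_mul_self, one_mul]
  -- With a_0 nonsingular, both the pencil and its target have nonsingular limits, so their quotient
  -- serves as the left factor.
  · have hF : IsBiproper (compRingEquiv (Fin m) (Fin n) _
        (redPencil m aR p 1 (Matrix.scalar (Fin n) μ))) :=
      MatTendsInf.isBiproper (MatTendsInf.comp (D := blk m (redX b p))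
        fun s r => matTendsInf_redPencil h hμ' s r)
        (det_comp_ne_zero _ fun W hW =>
          redX_blk_kernel b hm (mul_eq_zero_of_det_ne_zero hb) W hW)
    have hE : IsBiproper (idOplus m (tail aR m (Matrix.scalar (Fin n) μ) 0)) := by
      rw [idOplus_eq hc]
      have ht : tail b m 0 0 = b 0 := by
        rw [tail, Finset.sum_eq_single 0]
        · simp
        · intro i _ hi; simp [zero_pow hi]
        · simp
      refine MatTendsInf.isBiproper (MatTendsInf.comp
        (D := Matrix.diagonal (Function.update 1 c (tail b m 0 0))) fun s r => ?_) ?_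
      · by_cases hsr : s = r
        · subst hsr
          rw [Matrix.diagonal_apply_eq, Matrix.diagonal_apply_eq]
          by_cases hs : s = c
          · subst hs
            rw [Function.update_self, Function.update_self]
            exact matTendsInf_tail h hμ' 0
          · rw [Function.update_of_ne hs, Function.update_of_ne hs]
            exact matTendsInf_one
        · rw [Matrix.diagonal_apply_ne _ hsr, Matrix.diagonal_apply_ne _ hsr]
          exact matTendsInf_zero
      · rw [ht]
        refine det_comp_ne_zero _ fun W hW => ?_
        funext s
        have h1 := congrFun hW s
        rw [Matrix.mulVec_diagonal] at h1
        by_cases hs : s = c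
        · subst hs
          rw [Function.update_self] at h1
          exact mul_eq_zero_of_det_ne_zero hb _ h1
        · rw [Function.update_of_ne hs] at h1
          simpa using h1
    refine ⟨_, 1, hE.mul hF.inv, matTendsInf_one.isBiproper (by simp), ?_⟩
    rw [mul_one, mul_assoc, Matrix.nonsing_inv_mul _ hF.isUnit_det, mul_one]

end BlockLimits

/-! ### Realizations of polynomial multiples of a transfer function -/

section Realizations

variable {ι κ τ : Type}

lemma polyRat_mul [Fintype κ] (M : Matrix ι κ ℂ[X]) (M' : Matrix κ τ ℂ[X]) :
    polyRat (M * M') = polyRat M * polyRat M' := by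
  simp [polyRat, Matrix.map_mul]

lemma polyRat_add (M M' : Matrix ι κ ℂ[X]) : polyRat (M + M') = polyRat M + polyRat M' := by
  ext; simp [polyRat]

lemma polyRat_constPoly (M : Matrix ι κ ℂ) : polyRat (constPoly M) = constRat M := by
  ext; simp [polyRat, constPoly, constRat]

lemma constRat_mul [Fintype κ] (M : Matrix ι κ ℂ) (M' : Matrix κ τ ℂ) :
    constRat (M * M') = constRat M * constRat M' := by
  simp [constRat, Matrix.map_mul]

lemma polyRat_pencil_eq (E A : Matrix κ κ ℂ) :
    polyRat (pencil E A) = (RatFunc.X : RatFunc ℂ) • constRat E + constRat A := by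
  ext i j
  simp only [polyRat, pencil, constPoly, constRat, Matrix.map_apply, Matrix.add_apply,
    Matrix.smul_apply, smul_eq_mul, map_add, map_mul, RatFunc.algebraMap_X, RatFunc.algebraMap_C]

lemma eq_sum_X_pow_smul_constPoly [Finite ι] [Fintype κ] (W : Matrix ι κ ℂ[X]) :
    ∃ (D : ℕ) (w : ℕ → Matrix ι κ ℂ),
      W = ∑ d ∈ Finset.range D, (X ^ d : ℂ[X]) • constPoly (w d) := by
  have := Fintype.ofFinite ι
  refine ⟨(Finset.univ.sup fun i => Finset.univ.sup fun j => (W i j).natDegree) + 1,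
    fun d => Matrix.of fun i j => (W i j).coeff d, ?_⟩
  ext1 i j
  rw [Matrix.sum_apply]
  conv_lhs => rw [(W i j).as_sum_range' ((Finset.univ.sup fun i => Finset.univ.sup fun j =>
    (W i j).natDegree) + 1) (Nat.lt_succ_of_le ((Finset.le_sup (f := fun j => (W i j).natDegree)
    (Finset.mem_univ j)).trans (Finset.le_sup (f := fun i => Finset.univ.sup fun j =>
    (W i j).natDegree) (Finset.mem_univ i))))]
  refine Finset.sum_congr rfl fun d _ => ?_
  rw [← Polynomial.C_mul_X_pow_eq_monomial, mul_comm]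
  simp [constPoly]

lemma induction_matrix_poly [Finite ι] [Fintype κ] {p : Matrix ι κ ℂ[X] → Prop}
    (h0 : ∀ M, p (constPoly M)) (hadd : ∀ M M', p M → p M' → p (M + M'))
    (hX : ∀ M, p M → p ((X : ℂ[X]) • M)) (W : Matrix ι κ ℂ[X]) : p W := by
  obtain ⟨D, w, rfl⟩ := eq_sum_X_pow_smul_constPoly W
  refine Finset.sum_induction _ p hadd ?_ fun d _ => ?_
  · have := h0 0
    simpa [constPoly] using this
  · generalize w d = M
    clear * - h0 hX
    induction d with
    | zero => simpa using h0 M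
    | succ d ih => rw [pow_succ', mul_smul]; exact hX _ ih

variable [Fintype κ] [DecidableEq κ]

lemma isBiproper_smul_pencil {E : Matrix κ κ ℂ} (hE : E.det ≠ 0) (A : Matrix κ κ ℂ) :
    IsBiproper ((RatFunc.X : RatFunc ℂ)⁻¹ • polyRat (pencil E A)) := by
  refine MatTendsInf.isBiproper (D := E) (fun i j => ?_) hE
  rw [polyRat_pencil_eq, smul_add, smul_smul, inv_mul_cancel₀ RatFunc.X_ne_zero, one_smul]
  have := (matTendsInf_constRat E i j).add (tendsInf_X_inv.mul (matTendsInf_constRat A i j))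
  rw [zero_mul, add_zero] at this
  exact this

lemma isUnit_det_polyRat_pencil {E : Matrix κ κ ℂ} (hE : E.det ≠ 0) (A : Matrix κ κ ℂ) :
    IsUnit (polyRat (pencil E A)).det := by
  have h := (isBiproper_smul_pencil hE A).isUnit_det
  rw [Matrix.det_smul] at h
  exact isUnit_of_mul_isUnit_right h

lemma matTendsInf_pencil_inv {E : Matrix κ κ ℂ} (hE : E.det ≠ 0) (A : Matrix κ κ ℂ) :
    MatTendsInf (polyRat (pencil E A))⁻¹ 0 := by
  have h := isBiproper_smul_pencil hE A
  have h1 : (polyRat (pencil E A))⁻¹ =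
      (RatFunc.X : RatFunc ℂ)⁻¹ • ((RatFunc.X : RatFunc ℂ)⁻¹ • polyRat (pencil E A))⁻¹ := by
    refine Matrix.inv_eq_right_inv ?_
    rw [mul_smul_comm, ← smul_mul_assoc, Matrix.mul_nonsing_inv _ h.isUnit_det]
  obtain ⟨D, hD, h⟩ := h
  intro i j
  rw [h1]
  have := tendsInf_X_inv.mul (MatTendsInf.inv h hD i j)
  rw [zero_mul] at this
  exact this

lemma exists_right_division [Finite ι] {E : Matrix κ κ ℂ} (hE : E.det ≠ 0) (A : Matrix κ κ ℂ)
    (W : Matrix ι κ ℂ[X]) : ∃ (Q : Matrix ι κ ℂ[X]) (R : Matrix ι κ ℂ),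
      W = Q * pencil E (-A) + constPoly R := by
  induction W using induction_matrix_poly with
  | h0 M => exact ⟨0, M, by simp⟩
  | hadd M M' h h' =>
    obtain ⟨Q, R, rfl⟩ := h
    obtain ⟨Q', R', rfl⟩ := h'
    exact ⟨Q + Q', R + R', by rw [constPoly_add, Matrix.add_mul]; abel⟩
  | hX M h =>
    obtain ⟨Q, R, rfl⟩ := h
    -- The division step is λR = R E⁻¹ (λE - A) + R E⁻¹ A.
    refine ⟨(X : ℂ[X]) • Q + constPoly (R * E⁻¹), R * E⁻¹ * A, ?_⟩
    rw [Matrix.add_mul, constPoly_mul_pencil, Matrix.mul_assoc R E⁻¹ E,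
      Matrix.nonsing_inv_mul _ hE.isUnit, Matrix.mul_one, smul_add, Matrix.smul_mul,
      Matrix.mul_neg]
    have : pencil R (-(R * E⁻¹ * A)) = (X : ℂ[X]) • constPoly R - constPoly (R * E⁻¹ * A) := by
      rw [pencil, constPoly_neg, sub_eq_add_neg]
    rw [this]
    abel

lemma exists_left_division [Finite ι] {E : Matrix κ κ ℂ} (hE : E.det ≠ 0) (A : Matrix κ κ ℂ)
    (W : Matrix κ ι ℂ[X]) : ∃ (Q : Matrix κ ι ℂ[X]) (R : Matrix κ ι ℂ),
      W = pencil E (-A) * Q + constPoly R := by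
  obtain ⟨Q, R, h⟩ := exists_right_division (E := Eᵀ) (by rwa [Matrix.det_transpose]) Aᵀ Wᵀ
  refine ⟨Qᵀ, Rᵀ, ?_⟩
  have h' := congrArg Matrix.transpose h
  rw [Matrix.transpose_transpose, Matrix.transpose_add, Matrix.transpose_mul] at h'
  exact h'

/-- Polynomial left and right multiples of a transfer function have realizations of the same
size. -/
lemma exists_realization_mul [Fintype ι] [Finite τ] (T : SystemMatrix ι κ) (hE : T.E.det ≠ 0)
    (u : Matrix τ ι ℂ[X]) (v : Matrix ι τ ℂ[X]) :
    ∃ T' : SystemMatrix τ κ, T'.IsRealization (polyRat u * T.transfer * polyRat v) := by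
  -- The remainders modulo λE - A are the new constant matrices C and B; the quotients contribute
  -- only to the polynomial part.
  obtain ⟨Q₁, R₁, h₁⟩ := exists_right_division hE T.A (u * constPoly T.C)
  obtain ⟨Q₂, R₂, h₂⟩ := exists_left_division hE T.A (constPoly T.B * v)
  refine ⟨⟨u * T.P * v + Q₁ * (constPoly T.B * v) + constPoly R₁ * Q₂, R₁, R₂, T.A, T.E⟩, hE, ?_⟩
  have hu := isUnit_det_polyRat_pencil hE (-T.A)
  have e₁ := congrArg polyRat h₁
  have e₂ := congrArg polyRat h₂
  rw [polyRat_mul, polyRat_add, polyRat_mul, polyRat_constPoly, polyRat_constPoly] at e₁ e₂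
  simp only [SystemMatrix.transfer, polyRat_add, polyRat_mul, polyRat_constPoly]
  set Λ := polyRat (pencil T.E (-T.A))
  have : polyRat u * (polyRat T.P + constRat T.C * Λ⁻¹ * constRat T.B) * polyRat v =
      polyRat u * polyRat T.P * polyRat v +
        (polyRat u * constRat T.C) * Λ⁻¹ * (constRat T.B * polyRat v) := by
    simp only [Matrix.mul_add, Matrix.add_mul, Matrix.mul_assoc]
  rw [this, e₁, Matrix.add_mul, Matrix.add_mul, Matrix.mul_assoc (polyRat Q₁),
    Matrix.mul_nonsing_inv _ hu, Matrix.mul_one, e₂, Matrix.mul_add (constRat R₁ * Λ⁻¹),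
    Matrix.mul_assoc (constRat R₁) Λ⁻¹ (Λ * _), ← Matrix.mul_assoc Λ⁻¹ Λ,
    Matrix.nonsing_inv_mul _ hu, Matrix.one_mul]
  abel

end Realizations

/-! ### T-odd rational matrices -/

section TOddRational

variable {ι κ : Type}

lemma negSubst_algebraMap (p : ℂ[X]) :
    negSubst (algebraMap ℂ[X] (RatFunc ℂ) p) = algebraMap ℂ[X] (RatFunc ℂ) (p.comp (-X)) := by
  have : algebraMap ℂ[X] (RatFunc ℂ) p =
      algebraMap ℂ[X] (RatFunc ℂ) p / algebraMap ℂ[X] (RatFunc ℂ) 1 := by simp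
  rw [this, negSubst, RatFunc.coe_mapRingHom_eq_coe_map, RatFunc.map_apply_div, map_one, map_one,
    div_one]
  rfl

lemma negSubst_C (c : ℂ) : negSubst (RatFunc.C c) = RatFunc.C c := by
  have := negSubst_algebraMap (Polynomial.C c)
  simpa using this

lemma IsTOddPoly.polyRat {M : Matrix ι ι ℂ[X]} (h : IsTOddPoly M) : IsTOddRat (polyRat M) := by
  ext i j
  have := congrFun (congrFun h i) j
  simp only [Matrix.map_apply, Matrix.transpose_apply, Matrix.neg_apply] at this
  simp [_root_.polyRat, negSubst_algebraMap, this]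

lemma IsTOddRat.add {M N : Matrix ι ι (RatFunc ℂ)} (hM : IsTOddRat M) (hN : IsTOddRat N) :
    IsTOddRat (M + N) := by
  rw [IsTOddRat] at *
  rw [neg_add, ← hM, ← hN]
  ext
  simp

lemma IsTOddRat.inv [Fintype κ] [DecidableEq κ] {M : Matrix κ κ (RatFunc ℂ)} (h : IsTOddRat M)
    (hM : IsUnit M.det) : IsTOddRat M⁻¹ := by
  have h1 : (M⁻¹)ᵀ.map negSubst * Mᵀ.map negSubst = 1 := by
    rw [← Matrix.map_mul, ← Matrix.transpose_mul, Matrix.mul_nonsing_inv _ hM]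
    simp
  rw [h, Matrix.mul_neg, ← Matrix.neg_mul] at h1
  exact neg_eq_iff_eq_neg.mp (Matrix.inv_eq_left_inv h1).symm

lemma IsTOddRat.congr [Fintype κ] [DecidableEq κ] {M : Matrix κ κ (RatFunc ℂ)} (h : IsTOddRat M)
    (B : Matrix κ ι ℂ) : IsTOddRat (constRat Bᵀ * M * constRat B) := by
  have hB : ∀ (ι κ : Type) (B : Matrix κ ι ℂ), (constRat B).map negSubst = constRat B := by
    intro ι κ B
    ext
    simp [constRat, negSubst_C]
  have hT : (constRat B)ᵀ = constRat Bᵀ := rfl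
  have hT' : (constRat Bᵀ)ᵀ = constRat B := rfl
  rw [IsTOddRat, Matrix.transpose_mul, Matrix.transpose_mul, hT, hT', Matrix.map_mul,
    Matrix.map_mul, h, hB, hB, Matrix.mul_assoc]
  simp

end TOddRational

/-! ### Action on the block unit vectors -/

section BlockUnitVectors

variable {m n p Z H g r : ℕ}

/-- The right factor acts on rows up to m - 2 only, so it fixes e_m; for H > 0, `posOdd` moves e_m
to e_{m-1}. -/
lemma pairProd_last_col {S : Type} [Ring S] (a : ℕ → S) (hm : m = g + 1 + 2 * H) (s : Fin m)
    {c : Fin m} (hc : (c : ℕ) + 1 = m) :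
    (posOdd m a g H * stepProd (posFactor m a) (g + 1) H) s c =
      if (s : ℕ) + 1 + (if H = 0 then 0 else 1) = m then 1 else 0 := by
  unfold posOdd posFactor
  rw [stepProd_elem m _ _ (g + 1) _ (by omega), stepProd_elem_mul _ _ _ _ _ (by omega), blk_apply]
  have := s.2
  simp only [idFun, mul_ite, mul_zero, mul_one]
  grind

lemma posOdd_last_row {S : Type} [Ring S] (a : ℕ → S) (hm : m = g + 1 + 2 * H) {c : Fin m}
    (hc : (c : ℕ) + 1 = m) (s : Fin m) :
    posOdd m a g H c s = if (s : ℕ) + 1 + (if H = 0 then 0 else 1) = m then 1 else 0 := by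
  unfold posOdd posFactor
  rw [stepProd_elem m _ _ (g + 2) _ (by omega), blk_apply]
  have := s.2
  simp only [idFun, mul_ite, mul_zero, mul_one]
  grind

lemma quasiIdentity_mul_blockCol (ε : Fin m → ℤˣ) {k : Fin m} {k' : ℤ} (hk : k' = (k : ℕ) + 1)
    (C : Matrix (Fin n) (Fin r) ℂ) :
    quasiIdentity n ε * blockCol m k' C = (((ε k : ℤˣ) : ℤ) : ℂ) • blockCol m k' C := by
  subst hk
  ext ⟨s, x⟩ y
  rw [quasiIdentity, Matrix.diagonal_mul, Matrix.smul_apply, smul_eq_mul, blockCol, of_apply]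
  split_ifs with h
  · rw [show s = k from Fin.ext (by simpa using h)]
  · simp

variable {R : Type} [CommRing R]

lemma blockRow_mul_blockCol (B : Matrix (Fin r) (Fin n) R) {τ : ℕ} (C : Matrix (Fin n) (Fin τ) R)
    {k : Fin m} {k' : ℤ} (hk : k' = (k : ℕ) + 1) : blockRow m k' B * blockCol m k' C = B * C := by
  subst hk
  ext x y
  simp only [Matrix.mul_apply, Fintype.sum_prod_type, blockRow, blockCol, of_apply]
  rw [Finset.sum_eq_single k]
  · simp
  · intro b _ hb
    have : (b : ℕ) ≠ k := fun h => hb (Fin.ext h)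
    simp [this]
  · simp

lemma idOplus_mul_blockCol (P : Matrix (Fin n) (Fin n) R) (C : Matrix (Fin n) (Fin r) R) :
    idOplus m P * blockCol m m C = blockCol m m (P * C) := by
  ext ⟨s, x⟩ y
  simp only [Matrix.mul_apply, Fintype.sum_prod_type, idOplus, blockCol, of_apply]
  rw [Finset.sum_eq_single s]
  · by_cases hs : (s : ℕ) + 1 = m
    · have : ((s : ℕ) : ℤ) + 1 = m := by omega
      simp [hs, this]
    · have : ((s : ℕ) : ℤ) + 1 ≠ m := by omega
      simp [this]
  · intro b _ hb
    simp [hb.symm]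
  · simp

lemma blockCol_transpose (k' : ℤ) (B : Matrix (Fin r) (Fin n) R) :
    (blockRow m k' B)ᵀ = blockCol m k' Bᵀ := rfl

lemma blockCol_neg (k' : ℤ) (C : Matrix (Fin n) (Fin r) R) :
    blockCol m k' (-C) = -blockCol m k' C := by
  ext a b
  simp only [blockCol, of_apply, Matrix.neg_apply]
  split_ifs <;> simp

lemma constPoly_blockCol (k' : ℤ) (C : Matrix (Fin n) (Fin r) ℂ) :
    constPoly (blockCol m k' C) = blockCol m k' (constPoly C) := by
  ext1 a b
  simp only [constPoly, blockCol, of_apply, Matrix.map_apply]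
  split_ifs <;> simp

lemma constPoly_blockRow (k' : ℤ) (B : Matrix (Fin r) (Fin n) ℂ) :
    constPoly (blockRow m k' B) = blockRow m k' (constPoly B) := by
  ext1 a b
  simp only [constPoly, blockRow, of_apply, Matrix.map_apply]
  split_ifs <;> simp

lemma blockCol_injective {k : Fin m} {k' : ℤ} (hk : k' = (k : ℕ) + 1)
    {C C' : Matrix (Fin n) (Fin r) R} (h : blockCol m k' C = blockCol m k' C') : C = C' := by
  subst hk
  ext x y
  have := congrFun (congrFun h (k, x)) y
  simpa [blockCol] using this

end BlockUnitVectors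

/-! ### Block form of system pencils -/

section BlockForm

variable {m n r : ℕ}

lemma blockDiag2_mul {R ι ρ : Type} [Ring R] [Fintype ι] [Fintype ρ] (U U' : Matrix ι ι R)
    (V V' : Matrix ρ ρ R) : blockDiag2 U V * blockDiag2 U' V' = blockDiag2 (U * U') (V * V') := by
  simp [blockDiag2, Matrix.fromBlocks_multiply]

lemma tupleProd_eq_blockDiag2 {R ι ρ : Type} [Ring R] [Fintype ι] [Fintype ρ] [DecidableEq ι]
    [DecidableEq ρ] (F : ℤ → Matrix (ι ⊕ ρ) (ι ⊕ ρ) R) (F' : ℤ → Matrix ι ι R) (t : List ℤ)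
    (h : ∀ i ∈ t, F i = blockDiag2 (F' i) 1) :
    tupleProd F t = blockDiag2 (tupleProd F' t) 1 := by
  induction t with
  | nil => simp [tupleProd, blockDiag2]
  | cons i t ih =>
    have := ih fun j hj => h j (List.mem_cons_of_mem _ hj)
    rw [tupleProd] at this ⊢
    rw [List.map_cons, List.prod_cons, this, h i List.mem_cons_self, blockDiag2_mul, one_mul]
    rfl

/-- With E = -1 the lower corner at index -m is the identity too, so index 0 is the only exception.
-/
lemma fiedlerS_of_ne (Ac : ℕ → Matrix (Fin n) (Fin n) ℂ) (C : Matrix (Fin n) (Fin r) ℂ)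
    (B : Matrix (Fin r) (Fin n) ℂ) (A : Matrix (Fin r) (Fin r) ℂ) {i : ℤ} (hi : i ≠ 0) :
    fiedlerS m Ac C B A (-1) i = blockDiag2 (fiedlerP m Ac i) 1 := by
  rw [fiedlerS, if_neg hi, neg_neg, ite_self]

lemma constPoly_fromBlocks {ι ρ : Type} (M₁ : Matrix ι ι ℂ) (M₂ : Matrix ι ρ ℂ)
    (M₃ : Matrix ρ ι ℂ) (M₄ : Matrix ρ ρ ℂ) :
    constPoly (Matrix.fromBlocks M₁ M₂ M₃ M₄) =
      Matrix.fromBlocks (constPoly M₁) (constPoly M₂) (constPoly M₃) (constPoly M₄) :=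
  Matrix.fromBlocks_map _ _ _ _ _

lemma constPoly_blockDiag2 {ι ρ : Type} (M : Matrix ι ι ℂ) (N : Matrix ρ ρ ℂ) :
    constPoly (blockDiag2 M N) = blockDiag2 (constPoly M) (constPoly N) := by
  rw [blockDiag2, constPoly_fromBlocks, blockDiag2]
  congr 1 <;> (ext1; simp [constPoly])

/-- The block form of a pencil of the shape `(λ diag(M_z, I) - diag(M_w, I) M_0) diag(M_c, I)`. -/
lemma pencil_blockDiag2_mul {ι ρ : Type} [Fintype ι] [Fintype ρ] [DecidableEq ι] [DecidableEq ρ]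
    (Mz W F D : Matrix ι ι ℂ) (C : Matrix ι ρ ℂ) (B : Matrix ρ ι ℂ) (A : Matrix ρ ρ ℂ) :
    pencil (blockDiag2 Mz (1 : Matrix ρ ρ ℂ)) (-(blockDiag2 W 1 * Matrix.fromBlocks F C (-B) A)) *
        constPoly (blockDiag2 D 1) =
      Matrix.fromBlocks (pencil (Mz * D) (-(W * F) * D)) (constPoly (-(W * C)))
        (constPoly (B * D)) (pencil 1 (-A)) := by
  rw [pencil_mul_constPoly, blockDiag2, blockDiag2, blockDiag2, pencil, Matrix.fromBlocks_multiply,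
    Matrix.fromBlocks_multiply, Matrix.fromBlocks_neg, Matrix.fromBlocks_multiply,
    constPoly_fromBlocks, constPoly_fromBlocks, Matrix.fromBlocks_smul, Matrix.fromBlocks_add]
  have h0 : ∀ ι κ : Type, constPoly (0 : Matrix ι κ ℂ) = 0 := fun ι κ => by ext1; simp [constPoly]
  congr 1 <;> simp [pencil, h0]

lemma isTOddPoly_fromBlocks {ι ρ : Type} (P : Matrix ι ι ℂ[X]) (C : Matrix ι ρ ℂ)
    (B : Matrix ρ ι ℂ) (D : Matrix ρ ρ ℂ[X]) :
    IsTOddPoly (Matrix.fromBlocks P (constPoly C) (constPoly B) D) ↔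
      IsTOddPoly P ∧ IsTOddPoly D ∧ C = -Bᵀ := by
  have hc : ∀ (κ τ : Type) (M : Matrix κ τ ℂ),
      (constPoly M)ᵀ.map (fun f => f.comp (-X)) = constPoly Mᵀ := fun κ τ M => by
    ext1
    simp [constPoly]
  rw [IsTOddPoly, Matrix.fromBlocks_transpose, Matrix.fromBlocks_map, Matrix.fromBlocks_neg,
    Matrix.fromBlocks_inj, hc, hc, ← constPoly_neg, ← constPoly_neg, constPoly_injective.eq_iff,
    constPoly_injective.eq_iff, IsTOddPoly, IsTOddPoly]
  constructor
  · rintro ⟨h1, h2, h3, h4⟩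
    exact ⟨h1, h4, by rw [h2, neg_neg]⟩
  · rintro ⟨h1, h4, rfl⟩
    exact ⟨h1, by simp, by simp, h4⟩

end BlockForm

/-! ### Symmetry of the coefficients of P -/

section Coefficients

variable {n : ℕ}

lemma coeff_matPoly (m : ℕ) (Ac : ℕ → Matrix (Fin n) (Fin n) ℂ) (i j : Fin n) {d : ℕ}
    (hd : d ≤ m) : (matPoly m Ac i j).coeff d = Ac d i j := by
  rw [matPoly, Matrix.sum_apply, Polynomial.finsetSum_coeff, Finset.sum_eq_single d]
  · simp [constPoly]
  · intro b _ hb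
    simp [constPoly, Polynomial.coeff_X_pow, hb.symm]
  · intro h
    exact absurd (Finset.mem_range.2 (by omega)) h

lemma transpose_coeff_of_isTOddPoly {m : ℕ} {Ac : ℕ → Matrix (Fin n) (Fin n) ℂ}
    (h : IsTOddPoly (matPoly m Ac)) {d : ℕ} (hd : d ≤ m) :
    (Ac d)ᵀ = (-1 : ℤˣ) ^ (d + 1) • Ac d := by
  ext i j
  have h1 := congrArg (fun f => f.coeff d) (congrFun (congrFun h i) j)
  simp only [Matrix.map_apply, Matrix.transpose_apply, Matrix.neg_apply, Polynomial.coeff_neg,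
    coeff_matPoly m Ac _ _ hd] at h1
  rw [show (-X : ℂ[X]) = Polynomial.C (-1) * X by simp, Polynomial.comp_C_mul_X_coeff,
    coeff_matPoly m Ac _ _ hd, mul_comm] at h1
  rcases Nat.even_or_odd d with he | ho
  · rw [he.neg_one_pow, one_mul] at h1
    rw [pow_succ, he.neg_one_pow]
    simpa [Units.smul_def] using h1
  · rw [ho.neg_one_pow] at h1
    rw [pow_succ, ho.neg_one_pow]
    simpa [Units.smul_def] using h1

lemma transpose_revCoeff {m : ℕ} {Ac : ℕ → Matrix (Fin n) (Fin n) ℂ}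
    (h : IsTOddPoly (matPoly m Ac)) (t : ℕ) (ht : t ≤ m) :
    (revCoeff m Ac t)ᵀ = (-1 : ℤˣ) ^ (m + t + 1) • revCoeff m Ac t := by
  rw [revCoeff, transpose_coeff_of_isTOddPoly h (Nat.sub_le m t)]
  congr 1
  rw [show m + t + 1 = m - t + 1 + 2 * t by omega, pow_add _ (m - t + 1), pow_mul]
  simp

end Coefficients

/-! ### The pencils attached to the tuples -/

section TuplePencils

variable {m n r p Z H g : ℕ} (Ac : ℕ → Matrix (Fin n) (Fin n) ℂ)

/-- The pencil of the tuples is the reduced pencil, multiplied by `outer` from both sides. -/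
lemma gfprP_eq (hm : m = g + 1 + 2 * H) (hg : g = p + 2 * Z) {z cz : List ℤ}
    (hz : shiftTuple m z = admissibleTuple g p) (hcz : shiftTuple m cz = symmComplement g p) :
    gfprP m Ac (admissibleTuple (2 * H) 0) (symmComplement (2 * H) 0) z cz =
      pencil (compRingEquiv (Fin m) (Fin n) ℂ (outer m (revCoeff m Ac) p Z g H *
          blk m (redX (revCoeff m Ac) p) * outer m (revCoeff m Ac) p Z g H))
        (-compRingEquiv (Fin m) (Fin n) ℂ (outer m (revCoeff m Ac) p Z g H *
          blk m (redY (revCoeff m Ac) p) * outer m (revCoeff m Ac) p Z g H)) := by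
  rw [gfprP, pencil_mul_constPoly, pencil_mul_constPoly, tupleProd_w Ac hm, tupleProd_cw Ac hm,
    tupleProd_z Ac hm hg hz, tupleProd_cz Ac hm hg hcz, neg_mul, neg_mul, ← map_mul, ← map_mul,
    ← map_mul, ← map_mul, outer_mul_redX_mul_outer _ hm hg, outer_mul_redY_mul_outer _ hm hg]

/-- The indices of z are at most g - m < 0; hence the system factor of index 0, which involves B and
A, does not occur in M_z. -/
lemma ne_zero_of_mem_shift (hg : g = p + 2 * Z) (hgm : g < m) {z : List ℤ}
    (hz : shiftTuple m z = admissibleTuple g p) {i : ℤ} (hi : i ∈ z) : i ≠ 0 := by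
  have h1 : i + m ∈ admissibleTuple g p := by
    rw [← hz]
    exact List.mem_map_of_mem hi
  rw [hg, admissibleTuple_eq, List.mem_append, List.mem_map] at h1
  rcases h1 with h1 | ⟨l, hl, h1⟩
  · have := (mem_pairTuple h1).2
    omega
  · rw [List.mem_range] at hl
    omega

lemma fiedlerS_zero (C : Matrix (Fin n) (Fin r) ℂ) (B : Matrix (Fin r) (Fin n) ℂ)
    (A E : Matrix (Fin r) (Fin r) ℂ) : fiedlerS m Ac C B A E 0 =
      Matrix.fromBlocks (fiedlerP m Ac 0) (-blockCol m m C) (-blockRow m m B) (-A) :=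
  if_pos rfl

/-- The block form of the pencil of the system matrix. -/
lemma gfprS_eq (hm : m = g + 1 + 2 * H) (hg : g = p + 2 * Z) {z cz : List ℤ}
    (hz : shiftTuple m z = admissibleTuple g p) (hcz : shiftTuple m cz = symmComplement g p)
    (B : Matrix (Fin r) (Fin n) ℂ) (A : Matrix (Fin r) (Fin r) ℂ) {k : Fin m} {k' : ℤ}
    (hk' : k' = (k : ℕ) + 1) (hk : (k : ℕ) + 1 + (if H = 0 then 0 else 1) = m) :
    gfprS m Ac (-Bᵀ) B (-A) (-1) (admissibleTuple (2 * H) 0) (symmComplement (2 * H) 0) z cz =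
      Matrix.fromBlocks
        (gfprP m Ac (admissibleTuple (2 * H) 0) (symmComplement (2 * H) 0) z cz)
        (constPoly (-blockCol m k' Bᵀ)) (constPoly (blockRow m k' B)) (pencil 1 (-A)) := by
  obtain ⟨c, hc⟩ : ∃ c : Fin m, (c : ℕ) + 1 = m := ⟨⟨m - 1, by omega⟩, by simp; omega⟩
  have hc' : (m : ℤ) = (c : ℕ) + 1 := by omega
  have hkg : g ≤ k := by split_ifs at hk <;> omega
  have hik : ∀ s : Fin m, ((s : ℕ) + 1 + (if H = 0 then 0 else 1) = m) ↔ s = k := fun s =>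
    ⟨fun h => Fin.ext (by split_ifs at h hk <;> omega), fun h => h ▸ hk⟩
  have hadm := admissibleTuple_zero (2 * H) H rfl
  have hw0 : ∀ i ∈ pairTuple ((2 * H : ℕ) : ℤ) H, i ≠ 0 := fun i hi => by
    have := (mem_pairTuple hi).1
    push_cast at this
    omega
  have hw : tupleProd (fiedlerP m Ac) (admissibleTuple (2 * H) 0) =
      tupleProd (fiedlerP m Ac) (pairTuple ((2 * H : ℕ) : ℤ) H) * fiedlerP m Ac 0 := by
    rw [hadm]
    simp [tupleProd]
  -- The index 0 occurs in w only at the end, so B and A enter through the last factor alone.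
  have hwS : tupleProd (fiedlerS m Ac (-Bᵀ) B (-A) (-1)) (admissibleTuple (2 * H) 0) =
      blockDiag2 (tupleProd (fiedlerP m Ac) (pairTuple ((2 * H : ℕ) : ℤ) H)) 1 *
        Matrix.fromBlocks (fiedlerP m Ac 0) (blockCol m m Bᵀ) (-blockRow m m B) A := by
    have h1 := tupleProd_eq_blockDiag2 (fiedlerS m Ac (-Bᵀ) B (-A) (-1)) (fiedlerP m Ac)
      (pairTuple ((2 * H : ℕ) : ℤ) H) fun i hi => fiedlerS_of_ne Ac _ _ _ (hw0 i hi)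
    rw [← h1, hadm, tupleProd, List.map_append, List.prod_append, List.map_singleton,
      List.prod_singleton, fiedlerS_zero, blockCol_neg, neg_neg, neg_neg]
    rfl
  have hE : ∀ t, tupleProd (fiedlerPExt m r Ac) t = blockDiag2 (tupleProd (fiedlerP m Ac) t) 1 :=
    fun t => tupleProd_eq_blockDiag2 _ _ t fun _ _ => rfl
  have hzS := tupleProd_eq_blockDiag2 (fiedlerS m Ac (-Bᵀ) B (-A) (-1)) (fiedlerP m Ac) z
    fun i hi => fiedlerS_of_ne Ac _ _ _ (ne_zero_of_mem_shift hg (by omega) hz hi)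
  have hcol : tupleProd (fiedlerP m Ac) (pairTuple ((2 * H : ℕ) : ℤ) H) * blockCol m m Bᵀ =
      blockCol m k' Bᵀ := by
    rw [tupleProd_pairTuple Ac hm]
    refine comp_mul_blockCol _ (fun s => ?_) _ hc' hk'
    rw [pairProd_last_col _ hm s hc]
    exact if_congr (hik s) rfl rfl
  -- M_{c_w} carries e_mᵀ to e_kᵀ. The factors of M_{c_z} change only rows before g, hence before
  -- the block of e_k.
  have hrow : blockRow m m B * (tupleProd (fiedlerP m Ac) (symmComplement (2 * H) 0) *
      tupleProd (fiedlerP m Ac) cz) = blockRow m k' B := by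
    rw [tupleProd_cw Ac hm, tupleProd_cz Ac hm hg hcz, map_mul, ← Matrix.mul_assoc,
      ← Matrix.mul_assoc, blockRow_mul_comp _ (fun s => ?_) B hc' hk',
      blockRow_mul_comp _ (fun s => ?_) B hk' hk', blockRow_mul_comp _ (fun s => ?_) B hk' hk']
    · rw [hankel_row _ (by omega)]
      exact if_congr (Fin.ext_iff.symm) rfl rfl
    · rw [negOdd_row _ hg hkg]
      exact if_congr (Fin.ext_iff.symm) rfl rfl
    · rw [posOdd_last_row _ hm hc]
      exact if_congr (hik s) rfl rfl
  rw [gfprS, hwS, hE, hE, hzS, Matrix.mul_assoc, ← constPoly_mul, blockDiag2_mul, Matrix.one_mul,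
    pencil_blockDiag2_mul, hcol, hrow, gfprP, Matrix.mul_assoc, ← constPoly_mul,
    pencil_mul_constPoly, hw]

end TuplePencils

/-! ### Unimodular equivalence, and the strictly proper part -/

section Linearization

variable {m n r p Z H g : ℕ} {Ac : ℕ → Matrix (Fin n) (Fin n) ℂ}

lemma outer_mul_blockCol (a : ℕ → Matrix (Fin n) (Fin n) ℂ) (hm : m = g + 1 + 2 * H)
    (hg : g = p + 2 * Z) {k : Fin m} {k' : ℤ} (hk' : k' = (k : ℕ) + 1)
    (hk : (k : ℕ) + 1 + (if H = 0 then 0 else 1) = m) (C : Matrix (Fin n) (Fin r) ℂ) :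
    compRingEquiv (Fin m) (Fin n) ℂ (outer m a p Z g H) * blockCol m m C = blockCol m k' C := by
  refine comp_mul_blockCol (c := ⟨m - 1, by omega⟩) _ (fun s => ?_) C (by simp; omega) hk'
  rw [outer_eq a hm hg, blk_apply, outerFun_last_col a hm hg s.2]
  refine if_congr ⟨fun h => Fin.ext (by split_ifs at h hk <;> omega), fun h => h ▸ hk⟩ rfl rfl

lemma blockRow_mul_outer (a : ℕ → Matrix (Fin n) (Fin n) ℂ) (hm : m = g + 1 + 2 * H)
    (hg : g = p + 2 * Z) {k : Fin m} {k' : ℤ} (hk' : k' = (k : ℕ) + 1)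
    (hk : (k : ℕ) + 1 + (if H = 0 then 0 else 1) = m) (B : Matrix (Fin r) (Fin n) ℂ) :
    blockRow m m B * compRingEquiv (Fin m) (Fin n) ℂ (outer m a p Z g H) = blockRow m k' B := by
  refine blockRow_mul_comp (c := ⟨m - 1, by omega⟩) _ (fun s => ?_) B (by simp; omega) hk'
  rw [outer_eq a hm hg, blk_apply, outerFun_last_row a hm s.2]
  refine if_congr ⟨fun h => Fin.ext (by split_ifs at h hk <;> omega), fun h => h ▸ hk⟩ rfl rfl

/-- The pencil of the tuples, with signs, is unimodularly equivalent to `diag(I, P(λ))`, by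
transformations that carry the block unit vector `e_k` to the last one. -/
lemma exists_unimodular_reduction (hm : m = g + 1 + 2 * H) (hg : g = p + 2 * Z)
    (ha : p ≠ 0 → (Ac m).det ≠ 0) {ε : Fin m → ℤˣ} {k : Fin m} {k' : ℤ} (hk' : k' = (k : ℕ) + 1)
    (hk : (k : ℕ) + 1 + (if H = 0 then 0 else 1) = m) (hε : ε k = 1) :
    ∃ U V : Matrix (Fin m × Fin n) (Fin m × Fin n) ℂ[X], IsUnit U ∧ IsUnit V ∧
      U * (constPoly (quasiIdentity n ε) *
        pencil (compRingEquiv (Fin m) (Fin n) ℂ (outer m (revCoeff m Ac) p Z g H *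
          blk m (redX (revCoeff m Ac) p) * outer m (revCoeff m Ac) p Z g H))
        (-compRingEquiv (Fin m) (Fin n) ℂ (outer m (revCoeff m Ac) p Z g H *
          blk m (redY (revCoeff m Ac) p) * outer m (revCoeff m Ac) p Z g H))) * V =
        idOplus m (matPoly m Ac) ∧
      (∀ (r : ℕ) (C : Matrix (Fin n) (Fin r) ℂ),
        U * constPoly (blockCol m k' C) = constPoly (blockCol m m C)) ∧
      (∀ (r : ℕ) (B : Matrix (Fin r) (Fin n) ℂ),
        constPoly (blockRow m k' B) * V = constPoly (blockRow m m B)) := by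
  obtain ⟨M, V, ⟨M, rfl⟩, hV, h, hcol, hrow⟩ :=
    exists_reduction Ac (show m = p + 2 * (Z + H) + 1 by omega) ha
  obtain ⟨O, hO⟩ := (isUnit_outer (revCoeff m Ac) hm hg).map (compRingEquiv (Fin m) (Fin n) ℂ)
  have hOc := fun r C => outer_mul_blockCol (r := r) (revCoeff m Ac) hm hg hk' hk C
  have hOr := fun r B => blockRow_mul_outer (r := r) (revCoeff m Ac) hm hg hk' hk B
  simp only [map_mul, ← hO] at hOc hOr ⊢
  generalize compRingEquiv (Fin m) (Fin n) ℂ (blk m (redX (revCoeff m Ac) p)) = X' at *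
  generalize compRingEquiv (Fin m) (Fin n) ℂ (blk m (redY (revCoeff m Ac) p)) = Y' at *
  have hc : ∀ N N' : Matrix (Fin m × Fin n) (Fin m × Fin n) ℂ, N * N' = 1 → N' * N = 1 →
      IsUnit (constPoly N) := fun N N' h h' =>
    IsUnit.map (Polynomial.C : ℂ →+* ℂ[X]).mapMatrix ⟨⟨N, N', h, h'⟩, rfl⟩
  have hQ := hc _ _ (quasiIdentity_mul_self (n := n) ε) (quasiIdentity_mul_self ε)
  have hQQ : constPoly (quasiIdentity n ε) * constPoly (quasiIdentity n ε) = 1 := by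
    rw [← constPoly_mul, quasiIdentity_mul_self, constPoly_one]
  obtain ⟨o', h1, h2⟩ : ∃ o' : Matrix (Fin m × Fin n) (Fin m × Fin n) ℂ,
      o' * O.val = 1 ∧ O.val * o' = 1 := ⟨_, O.inv_mul, O.mul_inv⟩
  clear hO
  generalize O.val = o at *
  have hpen : pencil (o * X' * o) (-(o * Y' * o)) =
      constPoly o * pencil X' (-Y') * constPoly o := by
    rw [constPoly_mul_pencil, pencil_mul_constPoly, mul_neg, neg_mul]
  have hOO : constPoly o' * constPoly o = 1 := by rw [← constPoly_mul, h1, constPoly_one]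
  have hOO' : constPoly o * constPoly o' = 1 := by rw [← constPoly_mul, h2, constPoly_one]
  -- U = M⁻¹O⁻¹Q and O⁻¹V undo the outer factors, since Q² = 1. U carries e_k to e_m because O e_m =
  -- e_k and the k-th sign is 1.
  refine ⟨(M⁻¹).val * (constPoly o' * constPoly (quasiIdentity n ε)), constPoly o' * V,
    (M⁻¹).isUnit.mul ((hc _ _ h1 h2).mul hQ), (hc _ _ h1 h2).mul hV, ?_, fun r C => ?_,
    fun r B => ?_⟩
  · rw [hpen]
    calc _ = ↑M⁻¹ * constPoly o' * (constPoly (quasiIdentity n ε) * constPoly (quasiIdentity n ε)) *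
          constPoly o * pencil X' (-Y') * (constPoly o * constPoly o') * V := by
            simp only [mul_assoc]
      _ = ↑M⁻¹ * (constPoly o' * constPoly o) * (pencil X' (-Y') * V) := by
            rw [hQQ, hOO', mul_one, mul_one]
            simp only [mul_assoc]
      _ = _ := by rw [hOO, mul_one, h, Units.inv_mul_cancel_left]
  · rw [Matrix.mul_assoc, ← constPoly_mul, ← constPoly_mul, Matrix.mul_assoc,
      quasiIdentity_mul_blockCol ε hk', hε, Units.val_one, Int.cast_one, one_smul, ← hOc,
      ← Matrix.mul_assoc, h1, Matrix.one_mul, constPoly_blockCol]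
    conv_lhs => rw [← hcol, ← Matrix.mul_assoc, Units.inv_mul, Matrix.one_mul]
  · rw [← Matrix.mul_assoc, ← constPoly_mul, ← hOr, Matrix.mul_assoc (blockRow m m B),
      h2, Matrix.mul_one, constPoly_blockRow, hrow]

/-- The reversed coefficients, with the strictly proper part added to the one of index `m`. -/
noncomputable def properCoeff (m : ℕ) (Ac : ℕ → Matrix (Fin n) (Fin n) ℂ)
    (W : Matrix (Fin n) (Fin n) (RatFunc ℂ)) (t : ℕ) : Matrix (Fin n) (Fin n) (RatFunc ℂ) :=
  constRat (revCoeff m Ac t) + if t = m then W else 0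

lemma matTendsInf_properCoeff {W : Matrix (Fin n) (Fin n) (RatFunc ℂ)} (hW : MatTendsInf W 0)
    (t : ℕ) : MatTendsInf (properCoeff m Ac W t) (revCoeff m Ac t) := by
  have h : MatTendsInf (if t = m then W else 0) (0 : Matrix (Fin n) (Fin n) ℂ) := by
    split_ifs
    · exact hW
    · exact matTendsInf_zero
  have := (matTendsInf_constRat (revCoeff m Ac t)).add h
  rwa [add_zero] at this

/-- In the reversed polynomial a_m is multiplied by μᵐ = λ⁻ᵐ, so a strictly proper part added to a_m
turns λ⁻ᵐP into λ⁻ᵐG. -/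
lemma tail_properCoeff (W : Matrix (Fin n) (Fin n) (RatFunc ℂ)) :
    tail (properCoeff m Ac W) m (Matrix.scalar (Fin n) (RatFunc.X : RatFunc ℂ)⁻¹) 0 =
      ((RatFunc.X : RatFunc ℂ) ^ m)⁻¹ • (polyRat (matPoly m Ac) + W) := by
  have hP : polyRat (matPoly m Ac) = ∑ i ∈ Finset.range (m + 1),
      (RatFunc.X : RatFunc ℂ) ^ (m - i) • constRat (revCoeff m Ac i) := by
    rw [← Finset.sum_range_reflect, matPoly]
    ext1 x y
    rw [polyRat, Matrix.map_apply, Matrix.sum_apply, Matrix.sum_apply, map_sum]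
    refine Finset.sum_congr rfl fun u hu => ?_
    rw [Finset.mem_range] at hu
    rw [revCoeff, show m - (m + 1 - 1 - u) = u by omega]
    simp only [constPoly, constRat, Matrix.smul_apply, Matrix.map_apply, smul_eq_mul, map_mul,
      map_pow, RatFunc.algebraMap_X, RatFunc.algebraMap_C]
  have hs : ∀ i (M : Matrix (Fin n) (Fin n) (RatFunc ℂ)),
      Matrix.scalar (Fin n) (RatFunc.X : RatFunc ℂ)⁻¹ ^ i * M =
        ((RatFunc.X : RatFunc ℂ) ^ i)⁻¹ • M := fun i M => by
    rw [← map_pow, inv_pow, Matrix.scalar_apply]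
    ext1 x y
    rw [Matrix.diagonal_mul, Matrix.smul_apply, smul_eq_mul]
  rw [tail, hP, smul_add, Finset.smul_sum]
  simp only [properCoeff, hs, smul_add, Finset.sum_add_distrib, zero_add, Nat.sub_zero]
  congr 1
  · refine Finset.sum_congr rfl fun i hi => ?_
    rw [Finset.mem_range] at hi
    have hX : (RatFunc.X : RatFunc ℂ) ≠ 0 := RatFunc.X_ne_zero
    rw [smul_smul]
    congr 1
    rw [inv_mul_eq_div, eq_div_iff (pow_ne_zero _ hX), inv_mul_eq_div,
      div_eq_iff (pow_ne_zero _ hX), ← pow_add]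
    congr 1
    omega
  · rw [Finset.sum_eq_single m]
    · simp
    · intro i _ hi
      simp [hi]
    · simp

/-- The transfer function built on the reduced pencil, divided by `λ`. -/
lemma inv_X_smul_transfer_reduced {N : ℕ} (hm : m = p + 2 * N + 1)
    (C : Matrix (Fin n) (Fin r) ℂ) (B : Matrix (Fin r) (Fin n) ℂ)
    (D : Matrix (Fin r) (Fin r) (RatFunc ℂ)) :
    (RatFunc.X : RatFunc ℂ)⁻¹ •
      (polyRat (pencil (compRingEquiv (Fin m) (Fin n) ℂ (blk m (redX (revCoeff m Ac) p)))
          (-compRingEquiv (Fin m) (Fin n) ℂ (blk m (redY (revCoeff m Ac) p)))) +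
        constRat (blockCol m m C) * D * constRat (blockRow m m B)) =
      compRingEquiv (Fin m) (Fin n) (RatFunc ℂ) (redPencil m
        (properCoeff m Ac (constRat C * D * constRat B)) p 1
        (Matrix.scalar (Fin n) (RatFunc.X : RatFunc ℂ)⁻¹)) := by
  set W := constRat C * D * constRat B with hW
  have hprod : ∀ (s t : Fin m) (x y : Fin n), (constRat (blockCol m m C) * D *
      constRat (blockRow m m B)) (s, x) (t, y) =
      if (s : ℕ) + 1 = m ∧ (t : ℕ) + 1 = m then W x y else 0 := by
    intro s t x y
    have e1 : ((s : ℕ) : ℤ) + 1 = m ↔ (s : ℕ) + 1 = m := by omega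
    have e2 : ((t : ℕ) : ℤ) + 1 = m ↔ (t : ℕ) + 1 = m := by omega
    simp only [hW, Matrix.mul_apply, constRat, blockCol, blockRow, Matrix.map_apply, of_apply, e1,
      e2]
    by_cases h1 : (s : ℕ) + 1 = m <;> by_cases h2 : (t : ℕ) + 1 = m <;> simp [h1, h2]
  let φ : Matrix (Fin n) (Fin n) ℂ →+* Matrix (Fin n) (Fin n) (RatFunc ℂ) := RatFunc.C.mapMatrix
  have hX : ∀ s t : Fin m, redX (properCoeff m Ac W) p s t =
      constRat (redX (revCoeff m Ac) p s t) := by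
    intro s t
    refine Eq.trans ?_ (map_redX φ (revCoeff m Ac) p s t).symm
    have hs := s.2
    have ht := t.2
    have ha : ∀ i < m, properCoeff m Ac W i = φ (revCoeff m Ac i) := fun i hi => by
      rw [properCoeff, if_neg hi.ne, add_zero]
      rfl
    unfold redX
    split_ifs <;> first | rfl | exact ha _ (by omega)
  -- The coefficient a_m occurs only in the last diagonal block of Y', with a minus sign, and
  -- nowhere in X'.
  have hY : ∀ s t : Fin m, redY (properCoeff m Ac W) p s t =
      constRat (redY (revCoeff m Ac) p s t) -
        if (s : ℕ) + 1 = m ∧ (t : ℕ) + 1 = m then W else 0 := by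
    intro s t
    refine Eq.trans ?_ (congrArg (· - _) (map_redY φ (revCoeff m Ac) p s t).symm)
    have hs := s.2
    have ht := t.2
    have ha : ∀ i < m, properCoeff m Ac W i = φ (revCoeff m Ac i) := fun i hi => by
      rw [properCoeff, if_neg hi.ne, add_zero]
      rfl
    have hm' : properCoeff m Ac W m = φ (revCoeff m Ac m) + W := by
      rw [properCoeff, if_pos rfl]
      rfl
    unfold redY
    by_cases hst : (s : ℕ) + 1 = m ∧ (t : ℕ) + 1 = m
    · rw [if_neg (by omega), if_neg (by omega), if_pos (by omega), if_pos (by omega),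
        if_neg (by omega), if_neg (by omega), if_pos (by omega), if_pos (by omega), if_pos hst,
        hst.1, hm', neg_add, sub_eq_add_neg]
    · rw [if_neg hst, sub_zero]
      split_ifs <;> first | rfl | exact ha _ (by omega) | exact congrArg _ (ha _ (by omega))
  ext1 ⟨s, x⟩ ⟨t, y⟩
  rw [polyRat_pencil_eq, Matrix.smul_apply, Matrix.add_apply, hprod]
  simp only [compRingEquiv_apply, comp_apply, redPencil, blk_apply, hX, hY, one_mul,
    Matrix.scalar_apply, Matrix.add_apply, Matrix.sub_apply, Matrix.smul_apply,
    Matrix.diagonal_mul, smul_eq_mul]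
  have hX0 : (RatFunc.X : RatFunc ℂ) ≠ 0 := RatFunc.X_ne_zero
  simp only [constRat, Matrix.map_apply, Matrix.neg_apply, comp_apply, blk_apply, map_neg]
  split_ifs
  · field_simp
    ring
  · rw [Matrix.zero_apply]
    field_simp
    ring

end Linearization

/-! ### Irreducibility and strong linearization -/

section StrongLinearization

variable {m n r p Z H g : ℕ} {Ac : ℕ → Matrix (Fin n) (Fin n) ℂ}

/-- The transfer function of `S(λ)` is obtained from that of a unimodularly equivalent system
matrix by multiplication by polynomial matrices. -/
lemma isIrreducible_of_reduction {G : Matrix (Fin n) (Fin n) (RatFunc ℂ)}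
    {S : SystemMatrix (Fin n) (Fin r)} (hmin : S.IsMinimalRealization G)
    {T : SystemMatrix (Fin m × Fin n) (Fin r)} (hm : 0 < m)
    (hTA : T.A = S.A) (hTE : T.E = S.E)
    {U V : Matrix (Fin m × Fin n) (Fin m × Fin n) ℂ[X]} (hP : U * T.P * V = idOplus m S.P)
    (hC : U * constPoly T.C = constPoly (blockCol m m S.C))
    (hB : constPoly T.B * V = constPoly (blockRow m m S.B)) : T.IsIrreducible := by
  have hmc : (m : ℤ) = ((⟨m - 1, by omega⟩ : Fin m) : ℕ) + 1 := by simp; omega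
  refine ⟨⟨by rw [hTE]; exact hmin.1.1, rfl⟩, fun r' T' hT' => ?_⟩
  -- G is the last diagonal block of U · (transfer function of T) · V, so a realization of the
  -- latter of size r' yields one of G of the same size.
  obtain ⟨T'', hT''⟩ := exists_realization_mul T' hT'.1
    (constPoly (blockRow m m (1 : Matrix (Fin n) (Fin n) ℂ)) * U)
    (V * constPoly (blockCol m m (1 : Matrix (Fin n) (Fin n) ℂ)))
  refine hmin.2 r' T'' ?_
  rw [hT'.2] at hT''
  convert hT''
  rw [← hmin.1.2, SystemMatrix.transfer, SystemMatrix.transfer, hTA, hTE, Matrix.mul_add,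
    Matrix.add_mul]
  have e1 := congrArg polyRat hC
  have e2 := congrArg polyRat hB
  rw [polyRat_mul, polyRat_constPoly, polyRat_constPoly] at e1 e2
  congr 1
  · rw [← polyRat_mul, ← polyRat_mul]
    congr 1
    rw [Matrix.mul_assoc, Matrix.mul_assoc, ← Matrix.mul_assoc T.P, ← Matrix.mul_assoc U,
      ← Matrix.mul_assoc U, hP, constPoly_blockRow, constPoly_blockCol, idOplus_mul_blockCol,
      blockRow_mul_blockCol _ _ hmc, constPoly_one, Matrix.one_mul, Matrix.mul_one]
  · rw [polyRat_mul, polyRat_mul]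
    simp only [Matrix.mul_assoc]
    rw [← Matrix.mul_assoc (polyRat U), e1, ← Matrix.mul_assoc (constRat T.B), e2,
      polyRat_constPoly, polyRat_constPoly, ← constRat_mul,
      ← Matrix.mul_assoc (constRat (blockRow m m (1 : Matrix (Fin n) (Fin n) ℂ))),
      ← constRat_mul, blockRow_mul_blockCol _ _ hmc, blockRow_mul_blockCol _ _ hmc, Matrix.one_mul,
      Matrix.mul_one]

/-- The pencil with signs is a Rosenbrock strong linearization. -/
lemma isRosenbrockStrongLinearization_of_sign (hm : m = g + 1 + 2 * H) (hg : g = p + 2 * Z)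
    (ha : p ≠ 0 → (Ac m).det ≠ 0) {ε : Fin m → ℤˣ} {k : Fin m} {k' : ℤ} (hk' : k' = (k : ℕ) + 1)
    (hk : (k : ℕ) + 1 + (if H = 0 then 0 else 1) = m) (hε : ε k = 1)
    {C : Matrix (Fin n) (Fin r) ℂ} {B : Matrix (Fin r) (Fin n) ℂ} {A E : Matrix (Fin r) (Fin r) ℂ}
    {G : Matrix (Fin n) (Fin n) (RatFunc ℂ)}
    (hmin : SystemMatrix.IsMinimalRealization ⟨matPoly m Ac, C, B, A, E⟩ G) :
    IsRosenbrockStrongLinearization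
      (Matrix.fromBlocks (constPoly (quasiIdentity n ε) *
        pencil (compRingEquiv (Fin m) (Fin n) ℂ (outer m (revCoeff m Ac) p Z g H *
          blk m (redX (revCoeff m Ac) p) * outer m (revCoeff m Ac) p Z g H))
        (-compRingEquiv (Fin m) (Fin n) ℂ (outer m (revCoeff m Ac) p Z g H *
          blk m (redY (revCoeff m Ac) p) * outer m (revCoeff m Ac) p Z g H)))
        (constPoly (blockCol m k' C)) (constPoly (blockRow m k' B)) (pencil (-E) A))
      ⟨matPoly m Ac, C, B, A, E⟩ G := by
  obtain ⟨U, V, hU, hV, hP, hC, hB⟩ := exists_unimodular_reduction hm hg ha hk' hk hε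
  have hE : E.det ≠ 0 := hmin.1.1
  refine ⟨⟨_, blockCol m k' C, blockRow m k' B, A, E⟩, rfl, ?_, hE, ?_, ?_, ?_⟩
  · rw [constPoly_mul_pencil]
    exact ⟨_, -_, by rw [neg_neg]⟩
  · exact isIrreducible_of_reduction hmin (by omega) rfl rfl hP (hC r C) (hB r B)
  · refine ⟨U, V, 1, 1, isUnimodular_of_isUnit hU, isUnimodular_of_isUnit hV, by simp, by simp, ?_⟩
    rw [blockDiag2, blockDiag2, constPoly_one, Matrix.fromBlocks_multiply,
      Matrix.fromBlocks_multiply, idOplusSystem]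
    simp only [Matrix.zero_mul, Matrix.mul_zero, add_zero, zero_add, Matrix.one_mul,
      Matrix.mul_one]
    congr 1
    · exact hC r C
    · exact hB r B
  -- The strictly proper part vanishes at infinity, so adding it to a_m leaves the limits of all
  -- coefficients unchanged.
  · have hW : MatTendsInf (constRat C * (polyRat (pencil E (-A)))⁻¹ * constRat B)
        (0 : Matrix (Fin n) (Fin n) ℂ) := by
      have := ((matTendsInf_constRat C).mul (matTendsInf_pencil_inv hE (-A))).mul
        (matTendsInf_constRat B)
      rwa [Matrix.mul_zero, Matrix.zero_mul] at this
    have hm' : m = p + 2 * (Z + H) + 1 := by omega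
    obtain ⟨Ol, Or, hOl, hOr, h⟩ := exists_biproper_reduction (p := p) hm'
      (matTendsInf_properCoeff (m := m) (Ac := Ac) hW) (or_iff_not_imp_left.2 ha) tendsInf_X_inv
    rw [tail_properCoeff, ← inv_X_smul_transfer_reduced hm'] at h
    have hG : polyRat (matPoly m Ac) + constRat C * (polyRat (pencil E (-A)))⁻¹ * constRat B = G :=
      hmin.1.2
    rw [hG] at h
    have hOu : IsUnit (compRingEquiv (Fin m) (Fin n) ℂ (outer m (revCoeff m Ac) p Z g H)) :=
      (isUnit_outer (revCoeff m Ac) hm hg).map _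
    have hOc := outer_mul_blockCol (revCoeff m Ac) hm hg hk' hk C
    have hOr' := blockRow_mul_outer (revCoeff m Ac) hm hg hk' hk B
    have hQ : IsUnit (quasiIdentity n ε) :=
      ⟨⟨_, _, quasiIdentity_mul_self ε, quasiIdentity_mul_self ε⟩, rfl⟩
    simp only [map_mul]
    generalize compRingEquiv (Fin m) (Fin n) ℂ (outer m (revCoeff m Ac) p Z g H) = o at *
    generalize compRingEquiv (Fin m) (Fin n) ℂ (blk m (redX (revCoeff m Ac) p)) = X' at *
    generalize compRingEquiv (Fin m) (Fin n) ℂ (blk m (redY (revCoeff m Ac) p)) = Y' at *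
    have hb1 := isBiproper_constRat (hQ.mul hOu)
    have hb2 := isBiproper_constRat hOu
    refine ⟨Ol * (constRat (quasiIdentity n ε * o))⁻¹, (constRat o)⁻¹ * Or, hOl.mul hb1.inv,
      hb2.inv.mul hOr, ?_⟩
    have hQc : blockCol m k' C = quasiIdentity n ε * o * blockCol m m C := by
      rw [Matrix.mul_assoc, hOc, quasiIdentity_mul_blockCol ε hk', hε]
      simp
    have hT : SystemMatrix.transfer ⟨constPoly (quasiIdentity n ε) *
        pencil (o * X' * o) (-(o * Y' * o)), blockCol m k' C, blockRow m k' B, A, E⟩ =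
        constRat (quasiIdentity n ε * o) * (polyRat (pencil X' (-Y')) +
          constRat (blockCol m m C) * (polyRat (pencil E (-A)))⁻¹ * constRat (blockRow m m B)) *
          constRat o := by
      have hpen : constPoly (quasiIdentity n ε) * pencil (o * X' * o) (-(o * Y' * o)) =
          constPoly (quasiIdentity n ε * o) * pencil X' (-Y') * constPoly o := by
        rw [constPoly_mul_pencil, constPoly_mul_pencil, pencil_mul_constPoly]
        simp only [mul_neg, neg_mul, mul_assoc]
      rw [SystemMatrix.transfer, hpen, polyRat_mul, polyRat_mul, polyRat_constPoly,
        polyRat_constPoly, hQc, ← hOr', constRat_mul _ (blockCol m m C), constRat_mul _ o,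
        constRat_mul (blockRow m m B)]
      simp only [Matrix.mul_add, Matrix.add_mul, Matrix.mul_assoc]
    rw [hT, ← h, ← Matrix.smul_mul, ← Matrix.mul_smul]
    calc _ = Ol * ((constRat (quasiIdentity n ε * o))⁻¹ * constRat (quasiIdentity n ε * o)) *
          ((RatFunc.X : RatFunc ℂ)⁻¹ • (polyRat (pencil X' (-Y')) +
          constRat (blockCol m m C) * (polyRat (pencil E (-A)))⁻¹ * constRat (blockRow m m B))) *
          (constRat o * (constRat o)⁻¹) * Or := by simp only [Matrix.mul_assoc]
      _ = _ := by
        rw [Matrix.nonsing_inv_mul _ hb1.isUnit_det, Matrix.mul_nonsing_inv _ hb2.isUnit_det,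
          Matrix.mul_one, Matrix.mul_one]

/-- A minimal realization of positive size has a nonzero input matrix. -/
lemma SystemMatrix.IsMinimalRealization.B_ne_zero {ι : Type} {S : SystemMatrix ι (Fin r)}
    {G : Matrix ι ι (RatFunc ℂ)} (h : S.IsMinimalRealization G) (hr : 0 < r) : S.B ≠ 0 := by
  intro hB
  have h0 : ∀ κ τ : Type, constRat (0 : Matrix κ τ ℂ) = 0 := fun κ τ => by ext1; simp [constRat]
  have := h.2 0 ⟨S.P, 0, 0, 0, 1⟩ ⟨by simp, by
    rw [← h.1.2, SystemMatrix.transfer, SystemMatrix.transfer, hB, h0, h0, h0]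
    simp⟩
  omega

end StrongLinearization

/-! ### Assembly of the theorem -/

lemma IsTOddPoly.neg {ι : Type} {M : Matrix ι ι ℂ[X]} (h : IsTOddPoly M) : IsTOddPoly (-M) := by
  ext1 i j
  have := congrFun (congrFun h i) j
  simp only [Matrix.map_apply, Matrix.transpose_apply, Matrix.neg_apply] at this ⊢
  rw [Polynomial.neg_comp, this]

theorem theorem4p18 {n m r : ℕ}
    (G : Matrix (Fin n) (Fin n) (RatFunc ℂ)) (hG : IsTOddRat G)
    -- a minimal `T`-odd realization `G(λ) = P(λ) + Bᵀ (λ I_r - A)⁻¹ B`, `P(λ) = ∑_{j ≤ m} λ^j A_j`,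
    -- with system matrix `S(λ) = [P(λ), -Bᵀ; B, λ I_r - A]`
    (Ac : ℕ → Matrix (Fin n) (Fin n) ℂ) (hm : Ac m ≠ 0)
    (B : Matrix (Fin r) (Fin n) ℂ) (A : Matrix (Fin r) (Fin r) ℂ)
    (S : SystemMatrix (Fin n) (Fin r))
    (hS : S = { P := matPoly m Ac, C := -Bᵀ, B := B, A := -A, E := -1 })
    (hmin : S.IsMinimalRealization G)
    (hP : IsTOddPoly (matPoly m Ac)) (hA : IsTOddPoly (pencil 1 (-A)))
    -- `h` is even, `w` is the simple admissible tuple of `{0:h}`, and `c_w` its symmetric complement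
    (h : ℕ) (hhm : h < m) (hh : Even h)
    (q : ℕ) (hq : q = 0 ∨ q = 1) (w : List ℤ) (hw : IsAdmissibleTuple h q w)
    (cw : List ℤ) (hcw : cw = symmComplement h q)
    -- `z + m` is an admissible tuple of `{0:m-h-1}` of index `p`, `c_z + m` its symmetric complement
    (p : ℕ) (z : List ℤ) (hz : IsAdmissibleTuple (m - h - 1) p (shiftTuple m z))
    (cz : List ℤ) (hcz : shiftTuple m cz = symmComplement (m - h - 1) p)
    (L : Matrix (Fin m × Fin n) (Fin m × Fin n) ℂ[X]) (hL : L = gfprP m Ac w cw z cz)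
    (LL : Matrix ((Fin m × Fin n) ⊕ Fin r) ((Fin m × Fin n) ⊕ Fin r) ℂ[X])
    (hLL : LL = gfprS m Ac S.C S.B S.A S.E w cw z cz) :
    -- `k = m - i_0(w)` is a block number
    ∃ k : Fin m, ((k : ℕ) : ℤ) + 1 = m - inversionsAt 0 w ∧
    -- `Q`, with parameters `ε`, is the quasi-identity matrix, unique up to sign, making `L` `T`-odd
    ∃ ε : Fin m → ℤˣ,
      IsTOddPoly (constPoly (quasiIdentity n ε) * L) ∧
      (∀ ε' : Fin m → ℤˣ, IsTOddPoly (constPoly (quasiIdentity n ε') * L) →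
        quasiIdentity n ε' = quasiIdentity n ε ∨ quasiIdentity n ε' = -quasiIdentity n ε) ∧
      -- the block form of `diag(𝐬 Q, I_r) 𝕃(λ)`, with `𝐬` the `k`-th parameter of `Q`
      constPoly (extQuasiIdentity n r (ε k) ε) * LL =
        Matrix.fromBlocks
          (constPoly ((((ε k : ℤˣ) : ℤ) : ℂ) • quasiIdentity n ε) * L)
          (constPoly (-blockCol m (m - inversionsAt 0 w) Bᵀ))
          (constPoly (blockRow m (m - inversionsAt 0 w) B))
          (pencil 1 (-A)) ∧
      IsTOddPoly (constPoly (extQuasiIdentity n r (ε k) ε) * LL) ∧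
      -- uniqueness of `diag(𝐬 Q, I_r)`
      (∀ ε' : Fin m → ℤˣ, IsTOddPoly (constPoly (extQuasiIdentity n r (ε' k) ε') * LL) →
        extQuasiIdentity n r (ε' k) ε' = extQuasiIdentity n r (ε k) ε) ∧
      (0 < r → ∀ ε' : Fin m → ℤˣ, IsTOddPoly (constPoly (extQuasiIdentity n r 1 ε') * LL) →
        extQuasiIdentity n r 1 ε' = extQuasiIdentity n r (ε k) ε) ∧
      -- strong linearization
      (((Ac m).det = 0 → p = 0) →
        IsRosenbrockStrongLinearization (constPoly (extQuasiIdentity n r (ε k) ε) * LL) S G) ∧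
      -- the transfer function
      IsTOddRat (polyRat (constPoly ((((ε k : ℤˣ) : ℤ) : ℂ) • quasiIdentity n ε) * L) +
        constRat (blockCol m (m - inversionsAt 0 w) Bᵀ) * (polyRat (pencil 1 (-A)))⁻¹ *
          constRat (blockRow m (m - inversionsAt 0 w) B)) := by

  obtain ⟨H, rfl⟩ : ∃ H, h = 2 * H := hh.two_dvd
  obtain ⟨hq1, hq2, rfl⟩ := hw
  obtain rfl : q = 0 := by
    rcases hq with rfl | rfl
    · rfl
    · obtain ⟨x, hx⟩ := hq2
      omega
  obtain ⟨hz1, ⟨Z, hZ⟩, hz⟩ := hz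
  obtain ⟨g, hg⟩ : ∃ g, g = m - 2 * H - 1 := ⟨_, rfl⟩
  rw [← hg] at hz1 hZ hz hcz
  have hmg : m = g + 1 + 2 * H := by omega
  have hgp : g = p + 2 * Z := by omega
  have hinv := inversionsAt_admissibleTuple (h := 2 * H) rfl
  obtain ⟨k, hk⟩ : ∃ k : Fin m, (k : ℕ) + 1 + (if H = 0 then 0 else 1) = m :=
    ⟨⟨m - 1 - (if H = 0 then 0 else 1), by omega⟩, by simp only; split_ifs <;> omega⟩
  obtain ⟨k', hkk⟩ : ∃ k' : ℤ, k' = m - inversionsAt 0 (admissibleTuple (2 * H) 0) := ⟨_, rfl⟩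
  have hk' : k' = (k : ℕ) + 1 := by
    rw [hkk, hinv]
    split_ifs at hk ⊢ <;> omega
  rw [← hkk]
  subst hS hcw hL hLL
  simp only [gfprS_eq Ac hmg hgp hz hcz B A hk' hk, gfprP_eq Ac hmg hgp hz hcz]
  have hodd := isTOdd_outer hmg hgp (transpose_revCoeff hP)
  have huniq := fun ε' => quasiIdentity_unique (n := n) (a := revCoeff m Ac)
    (ε := fun s : Fin m => signOuter p g s) (ε' := ε') hmg hgp (by simpa [revCoeff] using hm)
  -- These are the signs of 𝐬Q, whose k-th parameter is the square of a sign, hence 1.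
  have hstrong := fun ha hε => isRosenbrockStrongLinearization_of_sign (Ac := Ac) hmg hgp ha
    (ε := fun s : Fin m => signOuter p g k * signOuter p g s) hk' hk hε hmin
  generalize pencil (compRingEquiv (Fin m) (Fin n) ℂ (outer m (revCoeff m Ac) p Z g H *
    blk m (redX (revCoeff m Ac) p) * outer m (revCoeff m Ac) p Z g H)) _ = L at *
  generalize hε : (fun s : Fin m => signOuter p g s) = ε at *
  have hεs : ∀ s : Fin m, signOuter p g s = ε s := fun s => congrFun hε s
  simp only [hεs] at hstrong huniq
  have hsign : ∀ (δ : ℤˣ) (ε' : Fin m → ℤˣ), IsTOddPoly (constPoly (quasiIdentity n ε') * L) →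
      IsTOddPoly (constPoly (quasiIdentity n fun s => δ * ε' s) * L) := by
    intro δ ε' h
    rcases Int.units_eq_one_or δ with rfl | rfl
    · simpa using h
    · simp only [neg_mul, one_mul, quasiIdentity_neg, constPoly_neg]
      exact h.neg
  have hεε : ε k * ε k = 1 := Int.units_mul_self _
  have hext : ∀ (δ : ℤˣ) (ε' : Fin m → ℤˣ), constPoly (extQuasiIdentity n r δ ε') *
      Matrix.fromBlocks L (constPoly (-blockCol m k' Bᵀ)) (constPoly (blockRow m k' B))
        (pencil 1 (-A)) =
      Matrix.fromBlocks (constPoly (quasiIdentity n fun s => δ * ε' s) * L)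
        (constPoly (-((((δ * ε' k : ℤˣ) : ℤ) : ℂ) • blockCol m k' Bᵀ)))
        (constPoly (blockRow m k' B)) (pencil 1 (-A)) := by
    intro δ ε'
    rw [extQuasiIdentity, constPoly_blockDiag2, smul_quasiIdentity, blockDiag2,
      Matrix.fromBlocks_multiply, constPoly_one]
    simp only [Matrix.zero_mul, add_zero, zero_add, Matrix.one_mul]
    rw [← constPoly_mul, Matrix.mul_neg, quasiIdentity_mul_blockCol _ hk']
  -- Beyond T-oddness of the upper left block, the sign of the block column must match the block
  -- row, on which I_r acts trivially.
  have hextOdd : ∀ (δ : ℤˣ) (ε' : Fin m → ℤˣ), IsTOddPoly (constPoly (extQuasiIdentity n r δ ε') *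
      Matrix.fromBlocks L (constPoly (-blockCol m k' Bᵀ)) (constPoly (blockRow m k' B))
        (pencil 1 (-A))) ↔ IsTOddPoly (constPoly (quasiIdentity n fun s => δ * ε' s) * L) ∧
        (((δ * ε' k : ℤˣ) : ℤ) : ℂ) • Bᵀ = Bᵀ := by
    intro δ ε'
    rw [hext, isTOddPoly_fromBlocks, neg_inj, blockCol_transpose]
    have : ∀ c : ℂ, c • blockCol m k' Bᵀ = blockCol m k' (c • Bᵀ) := fun c => by
      ext a b
      simp [blockCol]
    rw [this]
    exact ⟨fun h => ⟨h.1, blockCol_injective hk' h.2.2⟩, fun h => ⟨h.1, hA, by rw [h.2]⟩⟩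
  have huniq' : ∀ ε' : Fin m → ℤˣ, IsTOddPoly (constPoly (quasiIdentity n ε') * L) →
      ∃ δ : ℤˣ, ∀ s, ε' s = δ * ε s := fun ε' h => huniq ε' fun e he => by
    rcases he with rfl | rfl
    exacts [hodd, h]
  have heq : ∀ (δ δ' : ℤˣ) (ε₁ ε₂ : Fin m → ℤˣ), (∀ s, δ * ε₁ s = δ' * ε₂ s) →
      extQuasiIdentity n r δ ε₁ = extQuasiIdentity n r δ' ε₂ := by
    intro δ δ' ε₁ ε₂ h
    rw [extQuasiIdentity, extQuasiIdentity, smul_quasiIdentity, smul_quasiIdentity, funext h]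
  have hblock := hext (ε k) ε
  rw [hεε, Units.val_one, Int.cast_one, one_smul] at hblock
  refine ⟨k, hk'.symm, ε, hodd, fun ε' h' => ?_, ?_, ?_, fun ε' h' => ?_, fun hr ε' h' => ?_,
    fun ha => ?_, ?_⟩
  · obtain ⟨δ, hδ⟩ := huniq' ε' h'
    rw [funext hδ]
    rcases Int.units_eq_one_or δ with rfl | rfl
    · simp
    · simp [quasiIdentity_neg]
  · rw [hblock, smul_quasiIdentity]
  · rw [hextOdd, hεε]
    exact ⟨hsign _ _ hodd, by simp⟩
  · obtain ⟨δ, hδ⟩ := huniq' _ ((hextOdd _ _).1 h').1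
    refine heq _ _ _ _ fun s => ?_
    -- The k-th parameter of 𝐬'Q' is 1, and this pins down the free sign as δ = ε k.
    have h1 := hδ k
    rw [Int.units_mul_self] at h1
    rw [hδ, eq_comm, ← mul_one (ε k), h1, mul_left_comm, hεε, mul_one]
  · obtain ⟨h1, h2⟩ := (hextOdd _ _).1 h'
    obtain ⟨δ, hδ⟩ := huniq' _ h1
    refine heq _ _ _ _ fun s => ?_
    -- The other sign would give -Bᵀ = Bᵀ, hence B = 0, against minimality with r > 0.
    have h3 : (1 : ℤˣ) * ε' k = 1 := by
      rcases Int.units_eq_one_or (1 * ε' k) with h3 | h3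
      · exact h3
      · rw [h3] at h2
        refine absurd ?_ (hmin.B_ne_zero hr)
        ext x y
        have := congrFun (congrFun h2 y) x
        simpa [neg_eq_self] using this
    have h4 := hδ k
    rw [h3] at h4
    rw [hδ, eq_comm, ← mul_one (ε k), h4, mul_left_comm, hεε, mul_one]
  · rw [hblock]
    have := hstrong (fun hp hdet => hp (ha hdet)) hεε
    rwa [neg_neg, blockCol_neg] at this
  · rw [smul_quasiIdentity]
    refine (hsign _ _ hodd).polyRat.add ?_
    have hu : IsUnit (polyRat (pencil (1 : Matrix (Fin r) (Fin r) ℂ) (-A))).det :=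
      isUnit_det_polyRat_pencil (by simp) _
    exact (hA.polyRat.inv hu).congr (blockRow m k' B)
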